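/- Let $(M,g)$ be a complete smooth Riemannian manifold of finite dimension (without boundary), with volume measure $dv_g$, let $\Omega\subset M$ be an open set and let $p>1$. Let $\rho\in W^{1,p}_{loc}(\Omega)$ be nonnegative a.e. and $p$-superharmonic in the weak sense, that is, $$\int_\Omega |\nabla\rho|^{p-2}\,(\nabla\rho\cdot\nabla\varphi)\,dv_g\ \ge\ 0\qquad\text{for every } 0\le\varphi\in C^1_0(\Omega).$$ Let $D^{1,p}(\Omega)$ be the completion of $C^\infty_0(\Omega)$ with respect to $\left(\int_\Omega|\nabla u|^p\,dv_g\right)^{1/p}$; a function $u$ represents an element of $D^{1,p}(\Omega)$ if there are $\varphi_j\in C_0^\infty(\Omega)$ that converge to $u$ in $L^p_{loc}(\Omega)$ and whose gradients converge in $L^p(\Omega)$ (to $\nabla u$). Put $$c(\Omega):=\inf_{u\in D^{1,p}(\Omega),\ u\ne 0}\ \frac{\int_\Omega|\nabla u|^p\,dv_g}{\int_\Omega\frac{|u|^p}{\rho^p}|\nabla\rho|^p\,dv_g}\ \in[0,\infty],$$ where $u\neq 0$ means that $\int_\Omega|\nabla u|^p\,dv_g\neq 0$, the integrand $\frac{|u|^p}{\rho^p}|\nabla\rho|^p$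 is read as $0$ where $\rho=0$, and the quotient is read as $\infty$ if its denominator is $0$. A minimizer is an element $u\ne0$ of $D^{1,p}(\Omega)$ at which this infimum is attained. Then: 1. If $\nabla\rho$ does not vanish a.e. in $\Omega$ and $\rho^{\frac{p-1}{p}}\in D^{1,p}(\Omega)$, then $c(\Omega)=\left(\frac{p-1}{p}\right)^p$ and $\rho^{\frac{p-1}{p}}$ is a minimizer. 2. If $\rho^{\frac{p-1}{p}}\notin D^{1,p}(\Omega)$, $p\ge2$ and $c(\Omega)=\left(\frac{p-1}{p}\right)^p$, then $c(\Omega)$ is not attained, i.e. there is no minimizer in $D^{1,p}(\Omega)$. -/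

import Mathlib

open Set Filter Topology MeasureTheory Bundle
open scoped Manifold ContDiff ENNReal

noncomputable section

namespace HardyRiem

variable {n : ℕ} {M : Type*} [EMetricSpace M] [ChartedSpace (EuclideanSpace ℝ (Fin n)) M]
  [RiemannianBundle (fun x : M ↦ TangentSpace (𝓡 n) x)]

/-! ### Riemannian volume -/

variable (n) in
/-- The coordinate vector field `∂_i` of the preferred chart at `x₀`, at the point with
coordinates `z`. -/
def coordVec (x₀ : M) (z : EuclideanSpace ℝ (Fin n)) (i : Fin n) :
    TangentSpace (𝓡 n) ((chartAt (EuclideanSpace ℝ (Fin n)) x₀).symm z) :=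
  mfderiv (𝓡 n) (𝓡 n) (chartAt (EuclideanSpace ℝ (Fin n)) x₀).symm z
    (EuclideanSpace.single i (1 : ℝ) : EuclideanSpace ℝ (Fin n))

variable (n) in
/-- The density `√(det (g_{ij}))` of the Riemannian volume in the preferred chart at `x₀`. -/
def volDensity (x₀ : M) (z : EuclideanSpace ℝ (Fin n)) : ℝ :=
  √ (Matrix.of fun i j : Fin n ↦ inner ℝ (coordVec n x₀ z i) (coordVec n x₀ z j)).det

variable (n) in
/-- The measure `√(det (g_{ij})) dz` of the preferred chart at `x₀`, carried to the chart domain in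
`M` (and zero outside the chart domain). -/
def chartVol [MeasurableSpace M] (x₀ : M) : Measure M :=
  (((volume : Measure (EuclideanSpace ℝ (Fin n))).restrict
      (chartAt (EuclideanSpace ℝ (Fin n)) x₀).target).withDensity
        (fun z ↦ ENNReal.ofReal (volDensity n x₀ z))).map
    (chartAt (EuclideanSpace ℝ (Fin n)) x₀).symm

variable (n M) in
/-- The Riemannian volume measure `dv_g`. The chart measures agree on the overlaps of the chart
domains, so that their supremum (the least measure above all of them) is the measure which is given
by `√(det (g_{ij})) dz` in each chart. -/
def riemVol [MeasurableSpace M] : Measure M := ⨆ x₀ : M, chartVol n x₀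

/-! ### Gradient and test functions -/

variable (n) in
/-- The gradient `∇ f` of a differentiable function: the vector with `⟨∇ f, v⟩_g = df v`. -/
def grad (f : M → ℝ) (x : M) : TangentSpace (𝓡 n) x :=
  haveI : FiniteDimensional ℝ (TangentSpace (𝓡 n) x) :=
    inferInstanceAs (FiniteDimensional ℝ (EuclideanSpace ℝ (Fin n)))
  haveI : CompleteSpace (TangentSpace (𝓡 n) x) := FiniteDimensional.complete ℝ _
  (InnerProductSpace.toDual ℝ (TangentSpace (𝓡 n) x)).symm
    (mfderiv (𝓡 n) 𝓘(ℝ, ℝ) f x : TangentSpace (𝓡 n) x →L[ℝ] ℝ)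

variable (n) in
/-- `φ` belongs to `C^k_0(Ω)`: it is of class `C^k` with compact support contained in `Ω`. -/
def IsTest (k : ℕ∞) (Ω : Set M) (φ : M → ℝ) : Prop :=
  ContMDiff (𝓡 n) 𝓘(ℝ, ℝ) k φ ∧ HasCompactSupport φ ∧ tsupport φ ⊆ Ω

/-! ### Sobolev spaces -/

/-- The functions `F j` converge to zero in `L^p(A)`. -/
def LpNull [MeasurableSpace M] (μ : Measure M) (p : ℝ) (A : Set M) (F : ℕ → M → ℝ) : Prop :=
  (∀ j, AEMeasurable (F j) (μ.restrict A)) ∧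
    Tendsto (fun j ↦ ∫⁻ x in A, ‖F j x‖ₑ ^ p ∂μ) atTop (𝓝 0)

variable (n) in
/-- `u ∈ W^{1,p}(U)` with gradient `G`, for an open set `U`. Here `W^{1,p}(U)` is the completion of
the set of all `φ ∈ C^∞(U)` with `∫_U |φ|^p < ∞` and `∫_U |∇ φ|^p < ∞` with respect to the
`W^{1,p}`-norm. -/
def HasGradW [MeasurableSpace M] (p : ℝ) (U : Set M) (u : M → ℝ)
    (G : ∀ x : M, TangentSpace (𝓡 n) x) : Prop :=
  ∃ φ : ℕ → M → ℝ,
    (∀ j, ContMDiffOn (𝓡 n) 𝓘(ℝ, ℝ) ∞ (φ j) U ∧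
      ∫⁻ x in U, ‖φ j x‖ₑ ^ p ∂(riemVol n M) < ⊤ ∧
      ∫⁻ x in U, ‖grad n (φ j) x‖ₑ ^ p ∂(riemVol n M) < ⊤) ∧
    LpNull (riemVol n M) p U (fun j x ↦ φ j x - u x) ∧
    LpNull (riemVol n M) p U (fun j x ↦ ‖grad n (φ j) x - G x‖)

variable (n) in
/-- `u ∈ W^{1,p}_{loc}(Ω)` with gradient `G`: `u ∈ W^{1,p}(U)` with gradient `G` for every open `U`
with compact closure contained in `Ω`. -/
def HasGradWLoc [MeasurableSpace M] (p : ℝ) (Ω : Set M) (u : M → ℝ)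
    (G : ∀ x : M, TangentSpace (𝓡 n) x) : Prop :=
  ∀ U : Set M, IsOpen U → IsCompact (closure U) → closure U ⊆ Ω → HasGradW n p U u G

variable (n) in
/-- `u ∈ D^{1,p}(Ω)` with gradient `H`. The space `D^{1,p}(Ω)` is the completion of `C^∞_0(Ω)` for
the norm `(∫_Ω |∇ u|^p)^{1/p}`; a function `u` represents an element of it if `u` is the limit in
`L^p_{loc}(Ω)` of a sequence in `C^∞_0(Ω)` whose gradients converge (to `H`) in `L^p(Ω)`. -/
def HasGradD [MeasurableSpace M] (p : ℝ) (Ω : Set M) (u : M → ℝ)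
    (H : ∀ x : M, TangentSpace (𝓡 n) x) : Prop :=
  ∃ φ : ℕ → M → ℝ,
    (∀ j, IsTest n ⊤ Ω (φ j)) ∧
    (∀ K : Set M, IsCompact K → K ⊆ Ω →
      LpNull (riemVol n M) p K (fun j x ↦ φ j x - u x)) ∧
    LpNull (riemVol n M) p Ω (fun j x ↦ ‖grad n (φ j) x - H x‖)

variable (n) in
/-- The function `u` belongs to `D^{1,p}(Ω)`. -/
def MemD [MeasurableSpace M] (p : ℝ) (Ω : Set M) (u : M → ℝ) : Prop :=
  ∃ H : ∀ x : M, TangentSpace (𝓡 n) x, HasGradD n p Ω u H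

variable (n) in
/-- `-Δ_p ρ ≥ 0` on `Ω` in the weak sense, for a function `ρ` with weak gradient `G`. -/
def IsPSuperharmonic [MeasurableSpace M] (p : ℝ) (Ω : Set M)
    (G : ∀ x : M, TangentSpace (𝓡 n) x) : Prop :=
  ∀ φ : M → ℝ, IsTest n 1 Ω φ → (∀ x, 0 ≤ φ x) →
    0 ≤ ∫ x in Ω, ‖G x‖ ^ (p - 2) * inner ℝ (G x) (grad n φ x) ∂(riemVol n M)

/-! ### The best constant -/

variable (n) in
/-- `∫_Ω |H|^p dv_g`. -/
def energy [MeasurableSpace M] (p : ℝ) (Ω : Set M) (H : ∀ x : M, TangentSpace (𝓡 n) x) : ℝ≥0∞ :=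
  ∫⁻ x in Ω, ‖H x‖ₑ ^ p ∂(riemVol n M)

variable (n) in
/-- `∫_Ω (|u|^p / ρ^p) |∇ρ|^p dv_g`, where `G = ∇ρ`. The integrand is read as zero where `ρ = 0`;
there `∇ρ = 0` almost everywhere. -/
def hardyIntegral [MeasurableSpace M] (p : ℝ) (Ω : Set M) (ρ : M → ℝ)
    (G : ∀ x : M, TangentSpace (𝓡 n) x) (u : M → ℝ) : ℝ≥0∞ :=
  ∫⁻ x in Ω, ENNReal.ofReal (|u x| ^ p / ρ x ^ p * ‖G x‖ ^ p) ∂(riemVol n M)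

variable (n) in
/-- The best constant `c(Ω)`: the infimum of `∫_Ω |∇u|^p / ∫_Ω (|u|^p / ρ^p) |∇ρ|^p` over all
`u ∈ D^{1,p}(Ω)` that are not zero in `D^{1,p}(Ω)`. The quotient is `∞` if the denominator is `0`
(the numerator is not). -/
def bestConst [MeasurableSpace M] (p : ℝ) (Ω : Set M) (ρ : M → ℝ)
    (G : ∀ x : M, TangentSpace (𝓡 n) x) : ℝ≥0∞ :=
  ⨅ (u : M → ℝ) (H : ∀ x : M, TangentSpace (𝓡 n) x) (_ : HasGradD n p Ω u H)
    (_ : energy n p Ω H ≠ 0), energy n p Ω H / hardyIntegral n p Ω ρ G u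

variable (n) in
/-- `u` is a minimizer: it is a nonzero element of `D^{1,p}(Ω)` at which the infimum in the
definition of `c(Ω)` is attained. -/
def IsMinimizer [MeasurableSpace M] (p : ℝ) (Ω : Set M) (ρ : M → ℝ)
    (G : ∀ x : M, TangentSpace (𝓡 n) x) (u : M → ℝ) : Prop :=
  ∃ H : ∀ x : M, TangentSpace (𝓡 n) x, HasGradD n p Ω u H ∧ energy n p Ω H ≠ 0 ∧
    energy n p Ω H / hardyIntegral n p Ω ρ G u = bestConst n p Ω ρ G

end HardyRiem

end

namespace HardyRiem

set_option linter.unusedSectionVars false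

/-! Write a = (p-1)/p. Superharmonicity is tested with |u|^p F(ρ), where F ≥ 0 is a function of one
variable. Young's inequality then gives ∫ |u|^p |∇ρ|^p b(ρ) ≤ ∫ |∇u|^p whenever b ≤ -F' - (p-1)
F^{p/(p-1)} (`hardy_test`). The choice F(s) = a^{p-1} s^{1-p} yields b(s) = a^p s^{-p}, which is the
Hardy inequality with constant a^p. So c(Ω) ≥ a^p always.

For the first claim, the chain rule turns |∇ρ^a| into a ρ^{a-1} |∇ρ|, and both integrands are then
literally proportional with factor a^p (`HasGradD.energy_rpow_eq`). The energy is finite, and it can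
vanish only if ∇ρ = 0 a.e., so the quotient is exactly a^p. The chain rule itself needs care: ρ and
ρ^a have gradients in different spaces and t^a is not C¹ at 0. The two gradients are matched by
comparing regularized compositions (`HasGradApprox.norm_rpow`).

For the second claim, the inequality is improved by perturbation. The coefficient a^{p-1} maximizes
c ↦ (p-1)c - (p-1)c^{p/(p-1)}. Multiplying F by 1 + ε/(1+s) therefore costs only O(ε²), while
differentiating the new factor gains a positive term of order ε with weight s/(1+s)²
(`improvedWeight_le`). If the Hardy inequality were an equality for some u with finite Hardy
integral, dividing by ε and letting ε tend to 0 would force ∫ κ(ρ) |u|^p ρ^{-p} |∇ρ|^p = 0 with κ(s)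
= s/(1+s)², hence a vanishing Hardy integral (`HasGradD.hardy_ne`). A minimizer at the level a^p is
thus impossible. Together with `HasGradD.energy_rpow_eq` this even shows that ρ^a lies in D^{1,p}(Ω)
only when ∇ρ = 0 a.e.; the first claim is proved directly all the same.

The rest is foundation: the Riemannian volume agrees with the chart measures, so null sets and L^p
limits can be moved to coordinates, where integration by parts for limits of C¹ functions gives the
calculus of weak gradients. -/

/-- The model space. -/
abbrev Euc (n : ℕ) : Type := EuclideanSpace ℝ (Fin n)

/-! ### Coordinate frames and Gram matrices. -/

section Frame

variable {n : ℕ} {M : Type*} [EMetricSpace M] [ChartedSpace (EuclideanSpace ℝ (Fin n)) M]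
  [IsManifold (𝓡 n) ∞ M]

variable (n) in
/-- The coordinate frame of the preferred chart at `x₀`, as a vector field. -/
noncomputable def frame (x₀ : M) (i : Fin n) (x : M) : TangentSpace (𝓡 n) x :=
  (trivializationAt (EuclideanSpace ℝ (Fin n)) (TangentSpace (𝓡 n) : M → Type _) x₀).localFrame
    (EuclideanSpace.basisFun (Fin n) ℝ).toBasis i x

lemma frame_eq (x₀ : M) {x : M} (hx : x ∈ (chartAt (Euc n) x₀).source) (i : Fin n) :
    frame n x₀ i x = (mfderiv (𝓡 n) (𝓡 n) (chartAt (Euc n) x₀).symm (chartAt (Euc n) x₀ x)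
      (EuclideanSpace.single i (1 : ℝ) : Euc n) : Euc n) := by
  have h : x ∈ (trivializationAt (Euc n) (TangentSpace (𝓡 n) : M → Type _) x₀).baseSet := by
    simpa using hx
  have h2 := TangentBundle.symmL_trivializationAt (I := 𝓡 n) (𝕜 := ℝ) hx
  rw [frame, Trivialization.localFrame_apply_of_mem_baseSet _ _ h]
  simp only [Trivialization.basisAt]
  have h3 := congrArg (fun L => L (EuclideanSpace.single i (1 : ℝ) : Euc n)) h2
  simp [extChartAt, OpenPartialHomeomorph.extend, mfderivWithin_univ] at h3
  simp
  exact (Trivialization.symmL_apply (R := ℝ)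
    (trivializationAt (Euc n) (TangentSpace (𝓡 n) : M → Type _) x₀) h (EuclideanSpace.single i (1 : ℝ) : Euc n)).symm.trans h3

lemma frame_symm_eq (x₀ : M) {z : Euc n} (hz : z ∈ (chartAt (Euc n) x₀).target) (i : Fin n) :
    frame n x₀ i ((chartAt (Euc n) x₀).symm z) = coordVec n x₀ z i := by
  rw [frame_eq x₀ ((chartAt (Euc n) x₀).map_target hz)]
  unfold coordVec
  have := (chartAt (Euc n) x₀).right_inv hz
  exact congrArg (fun w => (mfderiv (𝓡 n) (𝓡 n) (chartAt (Euc n) x₀).symm w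
      (EuclideanSpace.single i (1 : ℝ) : Euc n) : Euc n)) this

lemma frame_linearIndependent (x₀ : M) {x : M} (hx : x ∈ (chartAt (Euc n) x₀).source) :
    LinearIndependent ℝ (fun i ↦ frame n x₀ i x) := by
  have h : x ∈ (trivializationAt (Euc n) (TangentSpace (𝓡 n) : M → Type _) x₀).baseSet := by
    simpa using hx
  exact ((trivializationAt (Euc n) (TangentSpace (𝓡 n) : M → Type _) x₀).isLocalFrameOn_localFrame_baseSet
    (𝓡 n) 1 (EuclideanSpace.basisFun (Fin n) ℝ).toBasis).linearIndependent h

lemma frame_span (x₀ : M) {x : M} (hx : x ∈ (chartAt (Euc n) x₀).source) :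
    ⊤ ≤ Submodule.span ℝ (Set.range fun i ↦ frame n x₀ i x) := by
  have h : x ∈ (trivializationAt (Euc n) (TangentSpace (𝓡 n) : M → Type _) x₀).baseSet := by
    simpa using hx
  exact ((trivializationAt (Euc n) (TangentSpace (𝓡 n) : M → Type _) x₀).isLocalFrameOn_localFrame_baseSet
    (𝓡 n) 1 (EuclideanSpace.basisFun (Fin n) ℝ).toBasis).generating h

lemma contDiffOn_comp_symm (x₀ : M) {U : Set M} (k : ℕ∞) {φ : M → ℝ}
    (hφ : ContMDiffOn (𝓡 n) 𝓘(ℝ, ℝ) k φ U) :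
    ContDiffOn ℝ k (φ ∘ (chartAt (Euc n) x₀).symm)
      ((chartAt (Euc n) x₀).target ∩ (chartAt (Euc n) x₀).symm ⁻¹' U) := by
  rw [← contMDiffOn_iff_contDiffOn]
  have h : ContMDiffOn (𝓡 n) (𝓡 n) k (chartAt (Euc n) x₀).symm (chartAt (Euc n) x₀).target :=
    (contMDiffOn_chart_symm (I := 𝓡 n) (n := ∞) (x := x₀)).of_le (by exact_mod_cast le_top)
  exact hφ.comp (h.mono inter_subset_left) fun z hz ↦ hz.2

/-- The coefficients of Y in the basis b are obtained from its inner products with b by inverting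
the Gram matrix. In this form inner products of gradients are controlled by scalar functions only,
namely by the partial derivatives and the metric coefficients. -/
lemma inner_eq_sum_gram_inv {V ι : Type*} [NormedAddCommGroup V] [InnerProductSpace ℝ V]
    [Fintype ι] [DecidableEq ι] (b : ι → V) (hb : LinearIndependent ℝ b)
    (hs : ⊤ ≤ Submodule.span ℝ (Set.range b)) (X Y : V) :
    inner ℝ X Y =
      ∑ i, ∑ j, (Matrix.gram ℝ b)⁻¹ i j * inner ℝ X (b i) * inner ℝ Y (b j) := by
  obtain ⟨c, hc⟩ : ∃ c : ι → ℝ, Y = ∑ j, c j • b j :=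
    ⟨fun j ↦ (Module.Basis.mk hb hs).repr Y j, by
      conv_lhs => rw [← (Module.Basis.mk hb hs).sum_repr Y]
      simp⟩
  have h1 : (fun i ↦ inner ℝ Y (b i)) = (Matrix.gram ℝ b).mulVec c := by
    ext i
    simp [hc, Matrix.mulVec, dotProduct, sum_inner, inner_smul_left, Matrix.gram_apply, mul_comm,
      real_inner_comm]
  have hdet : IsUnit (Matrix.gram ℝ b).det :=
    isUnit_iff_ne_zero.2 (Matrix.det_gram_ne_zero_iff_linearIndependent.2 hb)
  have h2 : c = (Matrix.gram ℝ b)⁻¹.mulVec (fun i ↦ inner ℝ Y (b i)) := by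
    rw [h1, Matrix.mulVec_mulVec, Matrix.nonsing_inv_mul _ hdet, Matrix.one_mulVec]
  have h3 : ∀ i, c i = ∑ j, (Matrix.gram ℝ b)⁻¹ i j * inner ℝ Y (b j) := fun i ↦ congrFun h2 i
  conv_lhs => rw [hc]
  simp only [inner_sum, inner_smul_right, h3, Finset.sum_mul]
  exact Finset.sum_congr rfl fun i _ ↦ Finset.sum_congr rfl fun j _ ↦ by ring

end Frame

/-! ### Continuity of the metric coefficients and of inner products of gradients. -/

section Gram

variable {n : ℕ} {M : Type*} [EMetricSpace M] [ChartedSpace (EuclideanSpace ℝ (Fin n)) M]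
  [IsManifold (𝓡 n) ∞ M]
variable [RiemannianBundle (fun x : M ↦ TangentSpace (𝓡 n) x)]
    [IsContMDiffRiemannianBundle (𝓡 n) ∞ (EuclideanSpace ℝ (Fin n))
      (fun x : M ↦ TangentSpace (𝓡 n) x)]

lemma continuousOn_gram (x₀ : M) (i j : Fin n) :
    ContinuousOn (fun x : M ↦ inner ℝ (frame n x₀ i x) (frame n x₀ j x))
      (chartAt (Euc n) x₀).source := by
  have key : ∀ i, ContinuousOn (fun x : M ↦ (⟨x, frame n x₀ i x⟩ :
      TotalSpace (Euc n) (TangentSpace (𝓡 n) : M → Type _))) (chartAt (Euc n) x₀).source := by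
    intro i
    have := ((trivializationAt (EuclideanSpace ℝ (Fin n)) (TangentSpace (𝓡 n) : M → Type _)
      x₀).contMDiffOn_localFrame_baseSet (I := 𝓡 n) 1
      (EuclideanSpace.basisFun (Fin n) ℝ).toBasis i).continuousOn
    simp at this
    exact this
  have : IsContinuousRiemannianBundle (EuclideanSpace ℝ (Fin n))
      (fun x : M ↦ TangentSpace (𝓡 n) x) := by
    obtain ⟨g, hg, hg'⟩ := IsContMDiffRiemannianBundle.exists_contMDiff (IB := 𝓡 n) (n := ∞)
      (F := EuclideanSpace ℝ (Fin n)) (E := fun x : M ↦ TangentSpace (𝓡 n) x)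
    exact ⟨g, hg.continuous, hg'⟩
  exact (key i).inner_bundle (key j)

/-- The tangent space carries two vector space instances, its own and the one coming from the norm
of the metric. The inner product lemmas need the second. -/
lemma frame_linearIndependent' (x₀ : M) {x : M} (hx : x ∈ (chartAt (Euc n) x₀).source) :
    @LinearIndependent (Fin n) ℝ (TangentSpace (𝓡 n) x) (fun i ↦ frame n x₀ i x) _
      (NormedAddCommGroup.toAddCommGroup.toAddCommMonoid) (NormedSpace.toModule) :=
  frame_linearIndependent x₀ hx

lemma frame_span' (x₀ : M) {x : M} (hx : x ∈ (chartAt (Euc n) x₀).source) :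
    (⊤ : @Submodule ℝ (TangentSpace (𝓡 n) x) _
      (NormedAddCommGroup.toAddCommGroup.toAddCommMonoid) (NormedSpace.toModule)) ≤
    @Submodule.span ℝ (TangentSpace (𝓡 n) x) _
      (NormedAddCommGroup.toAddCommGroup.toAddCommMonoid) (NormedSpace.toModule)
      (Set.range fun i ↦ frame n x₀ i x) :=
  frame_span x₀ hx

lemma inner_eq_sum_frame (x₀ : M) {x : M} (hx : x ∈ (chartAt (Euc n) x₀).source)
    (X Y : TangentSpace (𝓡 n) x) :
    inner ℝ X Y =
      ∑ i, ∑ j, (Matrix.gram ℝ (fun i ↦ frame n x₀ i x))⁻¹ i j * inner ℝ X (frame n x₀ i x) *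
        inner ℝ Y (frame n x₀ j x) :=
  inner_eq_sum_gram_inv (V := TangentSpace (𝓡 n) x) (fun i ↦ frame n x₀ i x)
    (frame_linearIndependent' x₀ hx) (frame_span' x₀ hx) X Y

lemma det_gram_ne_zero (x₀ : M) {x : M} (hx : x ∈ (chartAt (Euc n) x₀).source) :
    (Matrix.gram ℝ (fun i ↦ frame n x₀ i x)).det ≠ 0 :=
  Matrix.det_gram_ne_zero_iff_linearIndependent.2 (frame_linearIndependent' x₀ hx)

lemma inner_grad (φ : M → ℝ) (x : M) (v : TangentSpace (𝓡 n) x) :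
    inner ℝ (grad n φ x) v = (mfderiv (𝓡 n) 𝓘(ℝ, ℝ) φ x v : ℝ) := by
  have : FiniteDimensional ℝ (TangentSpace (𝓡 n) x) :=
    inferInstanceAs (FiniteDimensional ℝ (EuclideanSpace ℝ (Fin n)))
  have : CompleteSpace (TangentSpace (𝓡 n) x) := FiniteDimensional.complete ℝ _
  exact InnerProductSpace.toDual_symm_apply

lemma eq_zero_of_inner_frame (x₀ : M) {x : M} (hx : x ∈ (chartAt (Euc n) x₀).source)
    {X : TangentSpace (𝓡 n) x} (h : ∀ i, inner ℝ X (frame n x₀ i x) = 0) : X = 0 := by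
  have := inner_eq_sum_frame x₀ hx X X
  simp only [h] at this
  simpa using this

lemma fderiv_comp_symm (x₀ : M) {φ : M → ℝ} {z : Euc n} (hz : z ∈ (chartAt (Euc n) x₀).target)
    (hφ : MDifferentiableAt (𝓡 n) 𝓘(ℝ, ℝ) φ ((chartAt (Euc n) x₀).symm z)) (i : Fin n) :
    fderiv ℝ (φ ∘ (chartAt (Euc n) x₀).symm) z (EuclideanSpace.single i 1) =
      inner ℝ (grad n φ ((chartAt (Euc n) x₀).symm z))
        (frame n x₀ i ((chartAt (Euc n) x₀).symm z)) := by
  rw [inner_grad, frame_symm_eq x₀ hz]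
  have h1 : MDifferentiableAt (𝓡 n) (𝓡 n) (chartAt (Euc n) x₀).symm z :=
    ((contMDiffOn_chart_symm (I := 𝓡 n) (n := ∞) (x := x₀)).contMDiffAt
      ((chartAt (Euc n) x₀).open_target.mem_nhds hz)).mdifferentiableAt (by simp)
  have h2 := mfderiv_comp z hφ h1
  rw [mfderiv_eq_fderiv] at h2
  rw [h2]
  rfl

lemma continuousOn_inner_grad_frame (x₀ : M) {U : Set M} (hU : IsOpen U) {φ : M → ℝ}
    (hφ : ContMDiffOn (𝓡 n) 𝓘(ℝ, ℝ) 1 φ U) (i : Fin n) :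
    ContinuousOn (fun x ↦ inner ℝ (grad n φ x) (frame n x₀ i x))
      (U ∩ (chartAt (Euc n) x₀).source) := by
  set c := chartAt (Euc n) x₀ with hc
  have hV : IsOpen (c.target ∩ c.symm ⁻¹' U) := c.isOpen_inter_preimage_symm hU
  have h1 : ContinuousOn (fderiv ℝ (φ ∘ c.symm)) (c.target ∩ c.symm ⁻¹' U) :=
    (contDiffOn_comp_symm x₀ 1 hφ).continuousOn_fderiv_of_isOpen hV le_rfl
  have h2 : ContinuousOn (fun x ↦ fderiv ℝ (φ ∘ c.symm) (c x) (EuclideanSpace.single i 1))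
      (U ∩ c.source) :=
    (h1.comp (c.continuousOn.mono inter_subset_right) fun x hx ↦
      ⟨c.map_source hx.2, by simpa [c.left_inv hx.2] using hx.1⟩).clm_apply continuousOn_const
  refine h2.congr fun x hx ↦ ?_
  have h3 := fderiv_comp_symm x₀ (φ := φ) (c.map_source hx.2)
    (by
      rw [← hc, c.left_inv hx.2]
      exact (hφ.contMDiffAt (hU.mem_nhds hx.1)).mdifferentiableAt (by simp)) i
  rw [← hc, c.left_inv hx.2] at h3
  exact h3.symm

/-- Near each point the expansion through the inverse Gram matrix expresses the inner product by
continuous scalar functions, so continuity of the gradient as a section of the tangent bundle is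
never needed. -/
lemma continuousOn_inner_grad {U : Set M} (hU : IsOpen U) {φ ψ : M → ℝ}
    (hφ : ContMDiffOn (𝓡 n) 𝓘(ℝ, ℝ) 1 φ U) (hψ : ContMDiffOn (𝓡 n) 𝓘(ℝ, ℝ) 1 ψ U) :
    ContinuousOn (fun x ↦ inner ℝ (grad n φ x) (grad n ψ x)) U := by
  intro x₀ hx₀
  set s := (chartAt (Euc n) x₀).source
  have hs : IsOpen s := (chartAt (Euc n) x₀).open_source
  have hgram : ContinuousOn (fun x ↦ Matrix.gram ℝ (fun i ↦ frame n x₀ i x)) (U ∩ s) := by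
    refine continuousOn_pi.2 fun i ↦ continuousOn_pi.2 fun j ↦ ?_
    exact (continuousOn_gram x₀ i j).mono inter_subset_right
  have hinv : ContinuousOn (fun x ↦ (Matrix.gram ℝ (fun i ↦ frame n x₀ i x))⁻¹) (U ∩ s) := by
    simp only [Matrix.inv_def, Ring.inverse_eq_inv']
    have hdet : ContinuousOn (fun x ↦ (Matrix.gram ℝ (fun i ↦ frame n x₀ i x)).det) (U ∩ s) :=
      (Continuous.matrix_det continuous_id).comp_continuousOn hgram
    have hadj : ContinuousOn (fun x ↦ (Matrix.gram ℝ (fun i ↦ frame n x₀ i x)).adjugate) (U ∩ s) :=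
      (Continuous.matrix_adjugate continuous_id).comp_continuousOn hgram
    exact (hdet.inv₀ fun x hx ↦ det_gram_ne_zero x₀ hx.2).smul hadj
  have hmain : ContinuousOn (fun x ↦ ∑ i, ∑ j, (Matrix.gram ℝ (fun i ↦ frame n x₀ i x))⁻¹ i j *
      inner ℝ (grad n φ x) (frame n x₀ i x) * inner ℝ (grad n ψ x) (frame n x₀ j x)) (U ∩ s) := by
    refine continuousOn_finsetSum _ fun i _ ↦ continuousOn_finsetSum _ fun j _ ↦ ?_
    refine ContinuousOn.mul (ContinuousOn.mul ?_ (continuousOn_inner_grad_frame x₀ hU hφ i))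
      (continuousOn_inner_grad_frame x₀ hU hψ j)
    exact continuousOn_pi.1 (continuousOn_pi.1 hinv i) j
  have h1 : ContinuousOn (fun x ↦ inner ℝ (grad n φ x) (grad n ψ x)) (U ∩ s) :=
    hmain.congr fun x hx ↦ inner_eq_sum_frame x₀ hx.2 (grad n φ x) (grad n ψ x)
  exact (h1.continuousAt ((hU.inter hs).mem_nhds
    ⟨hx₀, mem_chart_source _ x₀⟩)).continuousWithinAt

end Gram

/-! ### Change of charts and the Riemannian volume. -/

lemma det_gram_sum {V ι : Type*} [NormedAddCommGroup V] [InnerProductSpace ℝ V]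
    [Fintype ι] [DecidableEq ι] (v w : ι → V) (J : Matrix ι ι ℝ)
    (h : ∀ i, v i = ∑ k, J k i • w k) :
    (Matrix.gram ℝ v).det = J.det ^ 2 * (Matrix.gram ℝ w).det := by
  have : Matrix.gram ℝ v = J.transpose * Matrix.gram ℝ w * J := by
    ext i j
    simp only [Matrix.gram_apply, h, Matrix.mul_apply, Matrix.transpose_apply, sum_inner,
      inner_sum, inner_smul_left, inner_smul_right, Finset.sum_mul, Finset.mul_sum]
    refine Finset.sum_congr rfl fun k _ ↦ Finset.sum_congr rfl fun l _ ↦ ?_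
    simp [real_inner_comm]
    ring
  rw [this, Matrix.det_mul, Matrix.det_mul, Matrix.det_transpose]
  ring

lemma clm_apply_eq_sum {n : ℕ} {F : Type*} [NormedAddCommGroup F] [NormedSpace ℝ F]
    (L : Euc n →L[ℝ] F) (v : Euc n) : L v = ∑ k, v k • L (EuclideanSpace.single k 1) := by
  conv_lhs => rw [← (EuclideanSpace.basisFun (Fin n) ℝ).sum_repr v, map_sum]
  simp

section Volume

variable {n : ℕ} {M : Type*} [EMetricSpace M] [ChartedSpace (EuclideanSpace ℝ (Fin n)) M]
  [IsManifold (𝓡 n) ∞ M]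

lemma frame_change (x₀ x₁ : M) {x : M} (h₀ : x ∈ (chartAt (Euc n) x₀).source)
    (h₁ : x ∈ (chartAt (Euc n) x₁).source) (i : Fin n) :
    frame n x₁ i x = ∑ k, (fderiv ℝ (chartAt (Euc n) x₀ ∘ (chartAt (Euc n) x₁).symm)
      (chartAt (Euc n) x₁ x) (EuclideanSpace.single i 1)) k • frame n x₀ k x := by
  set c₀ := chartAt (Euc n) x₀ with hc₀
  set c₁ := chartAt (Euc n) x₁ with hc₁
  have hx : c₁.symm (c₁ x) = x := c₁.left_inv h₁
  have hsm0 : MDifferentiableAt (𝓡 n) (𝓡 n) c₀.symm (c₀ x) :=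
    ((contMDiffOn_chart_symm (I := 𝓡 n) (n := ∞) (x := x₀)).contMDiffAt
      (c₀.open_target.mem_nhds (c₀.map_source h₀))).mdifferentiableAt (by simp)
  have hsm1 : MDifferentiableAt (𝓡 n) (𝓡 n) c₁.symm (c₁ x) :=
    ((contMDiffOn_chart_symm (I := 𝓡 n) (n := ∞) (x := x₁)).contMDiffAt
      (c₁.open_target.mem_nhds (c₁.map_source h₁))).mdifferentiableAt (by simp)
  have hch : MDifferentiableAt (𝓡 n) (𝓡 n) c₀ x :=
    ((contMDiffOn_chart (I := 𝓡 n) (n := ∞) (x := x₀)).contMDiffAt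
      (c₀.open_source.mem_nhds h₀)).mdifferentiableAt (by simp)
  have hτ : MDifferentiableAt (𝓡 n) (𝓡 n) (c₀ ∘ c₁.symm) (c₁ x) :=
    MDifferentiableAt.comp (I' := 𝓡 n) _ (by rwa [hx]) hsm1
  -- Near the point, the second parametrization is the first one precomposed with the transition
  -- map; the chain rule then gives the change of frame.
  have hev : c₁.symm =ᶠ[𝓝 (c₁ x)] c₀.symm ∘ (c₀ ∘ c₁.symm) := by
    have : ∀ᶠ z in 𝓝 (c₁ x), c₁.symm z ∈ c₀.source :=
      (c₁.continuousAt_symm (c₁.map_source h₁)).eventually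
        (by rw [hx]; exact c₀.open_source.mem_nhds h₀)
    filter_upwards [this] with z hz
    simp [c₀.left_inv hz]
  have hcx : (c₀ ∘ c₁.symm) (c₁ x) = c₀ x := by simp [hx]
  have h3 := (mfderiv_comp (I' := 𝓡 n) (c₁ x) (g := c₀.symm) (by rwa [hcx]) hτ)
  have h4 := hev.mfderiv_eq (I := 𝓡 n) (I' := 𝓡 n)
  -- The type of the derivative depends on the base point, so the equality of base points is used
  -- only after reading the derivative as a map of the model space.
  have h5 : ∀ w, w = c₀ x → (mfderiv (𝓡 n) (𝓡 n) c₀.symm w : Euc n →L[ℝ] Euc n) =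
      (mfderiv (𝓡 n) (𝓡 n) c₀.symm (c₀ x) : Euc n →L[ℝ] Euc n) := by
    rintro _ rfl
    rfl
  have h6 : (mfderiv (𝓡 n) (𝓡 n) c₁.symm (c₁ x) : Euc n →L[ℝ] Euc n) =
      (mfderiv (𝓡 n) (𝓡 n) c₀.symm (c₀ x) : Euc n →L[ℝ] Euc n).comp
        (fderiv ℝ (c₀ ∘ c₁.symm) (c₁ x)) := by
    rw [← h5 _ hcx, ← mfderiv_eq_fderiv]
    exact h4.trans h3
  have h7 : ∀ v : Euc n, (mfderiv (𝓡 n) (𝓡 n) c₀.symm (c₀ x) : Euc n →L[ℝ] Euc n) v =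
      ∑ k, v k • (frame n x₀ k x : Euc n) := by
    intro v
    refine (clm_apply_eq_sum (F := Euc n) _ v).trans (Finset.sum_congr rfl fun k _ ↦ ?_)
    rw [frame_eq x₀ h₀]
    rfl
  rw [frame_eq x₁ h₁]
  have h8 := congrArg (fun L : Euc n →L[ℝ] Euc n ↦ L (EuclideanSpace.single i 1)) h6
  exact h8.trans (h7 _)

variable [RiemannianBundle (fun x : M ↦ TangentSpace (𝓡 n) x)]
    [IsContMDiffRiemannianBundle (𝓡 n) ∞ (EuclideanSpace ℝ (Fin n))
      (fun x : M ↦ TangentSpace (𝓡 n) x)]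

lemma volDensity_eq (x₀ : M) {z : Euc n} (hz : z ∈ (chartAt (Euc n) x₀).target) :
    volDensity n x₀ z = √ (Matrix.gram ℝ
      (fun i ↦ frame n x₀ i ((chartAt (Euc n) x₀).symm z))).det := by
  simp only [frame_symm_eq x₀ hz]
  rfl

lemma det_gram_pos (x₀ : M) {x : M} (hx : x ∈ (chartAt (Euc n) x₀).source) :
    0 < (Matrix.gram ℝ (fun i ↦ frame n x₀ i x)).det :=
  (Matrix.posDef_gram_of_linearIndependent (frame_linearIndependent' x₀ hx)).det_pos

lemma volDensity_pos (x₀ : M) {z : Euc n} (hz : z ∈ (chartAt (Euc n) x₀).target) :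
    0 < volDensity n x₀ z := by
  rw [volDensity_eq x₀ hz]
  exact Real.sqrt_pos.2 (det_gram_pos x₀ ((chartAt (Euc n) x₀).map_target hz))

lemma continuousOn_volDensity (x₀ : M) :
    ContinuousOn (volDensity n x₀) (chartAt (Euc n) x₀).target := by
  have h : ContinuousOn (fun x ↦ √ (Matrix.gram ℝ (fun i ↦ frame n x₀ i x)).det)
      (chartAt (Euc n) x₀).source := by
    refine ContinuousOn.sqrt ((Continuous.matrix_det continuous_id).comp_continuousOn ?_)
    exact continuousOn_pi.2 fun i ↦ continuousOn_pi.2 fun j ↦ continuousOn_gram x₀ i j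
  exact (h.comp (chartAt (Euc n) x₀).continuousOn_symm
    fun z hz ↦ (chartAt (Euc n) x₀).map_target hz).congr fun z hz ↦ volDensity_eq x₀ hz

/-- The Gram determinant is multiplied by the square of the Jacobian determinant, and the square
root turns this into the factor of the change of variables formula. -/
lemma volDensity_change (x₀ x₁ : M) {z : Euc n} (hz : z ∈ (chartAt (Euc n) x₁).target)
    (hz' : (chartAt (Euc n) x₁).symm z ∈ (chartAt (Euc n) x₀).source) :
    volDensity n x₁ z =
      |(fderiv ℝ (chartAt (Euc n) x₀ ∘ (chartAt (Euc n) x₁).symm) z).det| *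
        volDensity n x₀ ((chartAt (Euc n) x₀ ∘ (chartAt (Euc n) x₁).symm) z) := by
  set c₀ := chartAt (Euc n) x₀ with hc₀
  set c₁ := chartAt (Euc n) x₁ with hc₁
  set L := fderiv ℝ (c₀ ∘ c₁.symm) z with hL
  have h1 : c₁.symm z ∈ c₁.source := c₁.map_target hz
  have h2 : c₀.symm ((c₀ ∘ c₁.symm) z) = c₁.symm z := c₀.left_inv hz'
  rw [volDensity_eq x₁ hz, volDensity_eq x₀ (z := (c₀ ∘ c₁.symm) z) (c₀.map_source hz'), ← hc₀, ← hc₁, h2,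
    det_gram_sum _ (fun i ↦ frame n x₀ i (c₁.symm z))
      (LinearMap.toMatrix (EuclideanSpace.basisFun (Fin n) ℝ).toBasis
        (EuclideanSpace.basisFun (Fin n) ℝ).toBasis (L : Euc n →ₗ[ℝ] Euc n))]
  · rw [LinearMap.det_toMatrix, Real.sqrt_mul (sq_nonneg _), Real.sqrt_sq_eq_abs]
  · intro i
    have := frame_change x₀ x₁ hz' h1 i
    rw [← hc₁, c₁.right_inv hz] at this
    rw [this]
    refine Finset.sum_congr rfl fun k _ ↦ ?_
    simp [LinearMap.toMatrix_apply, hL]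
    rfl

variable [MeasurableSpace M] [BorelSpace M]

lemma measurableSet_target_inter (x₀ : M) {A : Set M} (hA : MeasurableSet A) :
    MeasurableSet ((chartAt (Euc n) x₀).target ∩ (chartAt (Euc n) x₀).symm ⁻¹' A) := by
  have h1 := (continuousOn_iff_continuous_domRestrict.1
    (chartAt (Euc n) x₀).continuousOn_symm).measurable hA
  have h2 := (chartAt (Euc n) x₀).open_target.measurableSet.subtype_image h1
  convert h2 using 1
  ext z
  simp [and_comm]

lemma chartVol_apply (x₀ : M) {A : Set M} (hA : MeasurableSet A) :
    chartVol n x₀ A = ∫⁻ z in (chartAt (Euc n) x₀).target ∩ (chartAt (Euc n) x₀).symm ⁻¹' A,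
      ENNReal.ofReal (volDensity n x₀ z) := by
  have ht := (chartAt (Euc n) x₀).open_target.measurableSet
  have h1 : AEMeasurable (chartAt (Euc n) x₀).symm
      ((volume : Measure (Euc n)).restrict (chartAt (Euc n) x₀).target) :=
    (chartAt (Euc n) x₀).continuousOn_symm.aemeasurable ht
  rw [chartVol, Measure.map_apply_of_aemeasurable
    (h1.mono_ac (withDensity_absolutelyContinuous _ _)) hA, withDensity_apply' _ _,
    Measure.restrict_restrict' ht, inter_comm]

lemma chartVol_source_compl (x₀ : M) : chartVol n x₀ (chartAt (Euc n) x₀).sourceᶜ = 0 := by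
  rw [chartVol_apply x₀ (chartAt (Euc n) x₀).open_source.measurableSet.compl]
  have : (chartAt (Euc n) x₀).target ∩ (chartAt (Euc n) x₀).symm ⁻¹'
      (chartAt (Euc n) x₀).sourceᶜ = ∅ := by
    ext z
    simp only [mem_inter_iff, mem_preimage, mem_compl_iff, mem_empty_iff_false, iff_false, not_and,
      not_not]
    exact fun hz ↦ (chartAt (Euc n) x₀).map_target hz
  rw [this]
  simp

lemma chartVol_congr (x₀ x₁ : M) {A : Set M} (hA : MeasurableSet A)
    (h₀ : A ⊆ (chartAt (Euc n) x₀).source) (h₁ : A ⊆ (chartAt (Euc n) x₁).source) :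
    chartVol n x₁ A = chartVol n x₀ A := by
  rw [chartVol_apply x₁ hA, chartVol_apply x₀ hA]
  set c₀ := chartAt (Euc n) x₀ with hc₀
  set c₁ := chartAt (Euc n) x₁ with hc₁
  set B := c₁.target ∩ c₁.symm ⁻¹' A with hB
  have himg : c₀.target ∩ c₀.symm ⁻¹' A = (c₀ ∘ c₁.symm) '' B := by
    ext z
    constructor
    · rintro ⟨hz, hzA⟩
      refine ⟨c₁ (c₀.symm z), ⟨c₁.map_source (h₁ hzA), ?_⟩, ?_⟩
      · simpa [c₁.left_inv (h₁ hzA)] using hzA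
      · simp [c₁.left_inv (h₁ hzA), c₀.right_inv hz]
    · rintro ⟨w, ⟨hw, hwA⟩, rfl⟩
      refine ⟨c₀.map_source (h₀ hwA), ?_⟩
      simpa [c₀.left_inv (h₀ hwA)] using hwA
  have hBm : MeasurableSet B := measurableSet_target_inter x₁ hA
  have hder : ∀ z ∈ B, HasFDerivWithinAt (c₀ ∘ c₁.symm) (fderiv ℝ (c₀ ∘ c₁.symm) z) B z := by
    rintro z ⟨hz, hzA⟩
    have hsm1 : MDifferentiableAt (𝓡 n) (𝓡 n) c₁.symm z :=
      ((contMDiffOn_chart_symm (I := 𝓡 n) (n := ∞) (x := x₁)).contMDiffAt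
        (c₁.open_target.mem_nhds hz)).mdifferentiableAt (by simp)
    have hch : MDifferentiableAt (𝓡 n) (𝓡 n) c₀ (c₁.symm z) :=
      ((contMDiffOn_chart (I := 𝓡 n) (n := ∞) (x := x₀)).contMDiffAt
        (c₀.open_source.mem_nhds (h₀ hzA))).mdifferentiableAt (by simp)
    have : MDifferentiableAt (𝓡 n) (𝓡 n) (c₀ ∘ c₁.symm) z :=
      MDifferentiableAt.comp (I' := 𝓡 n) _ hch hsm1
    exact (mdifferentiableAt_iff_differentiableAt.1 this).hasFDerivAt.hasFDerivWithinAt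
  have hinj : InjOn (c₀ ∘ c₁.symm) B := by
    rintro z ⟨hz, hzA⟩ w ⟨hw, hwA⟩ hzw
    exact c₁.symm.injOn hz hw (c₀.injOn (h₀ hzA) (h₀ hwA) hzw)
  rw [himg, lintegral_image_eq_lintegral_abs_det_fderiv_mul volume hBm hder hinj]
  refine setLIntegral_congr_fun hBm fun z hz ↦ ?_
  rw [← ENNReal.ofReal_mul (abs_nonneg _), volDensity_change x₀ x₁ hz.1 (h₀ hz.2)]

/-- A supremum of measures is not computed set by set, so the upper bound comes from exhibiting a
measure that dominates every chart measure and equals the given one on the chart domain. -/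
lemma riemVol_apply (x₀ : M) {A : Set M} (hA : MeasurableSet A)
    (h₀ : A ⊆ (chartAt (Euc n) x₀).source) :
    riemVol n M A = chartVol n x₀ A := by
  set s := (chartAt (Euc n) x₀).source with hs
  have hsm : MeasurableSet s := (chartAt (Euc n) x₀).open_source.measurableSet
  refine le_antisymm ?_ (le_iSup (fun x : M ↦ chartVol n x) x₀ A)
  -- The dominating measure: on the domain s of the given chart every chart measure is at most
  -- `chartVol n x₀`, because they agree on overlaps; off s the volume itself is kept.
  have hle : riemVol n M ≤ (chartVol n x₀).restrict s + (riemVol n M).restrict sᶜ := by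
    refine iSup_le fun x₁ ↦ Measure.le_iff.2 fun B hB ↦ ?_
    have h1 : chartVol n x₁ (B ∩ s) ≤ chartVol n x₀ (B ∩ s) := by
      set s₁ := (chartAt (Euc n) x₁).source with hs₁
      have hs₁m : MeasurableSet s₁ := (chartAt (Euc n) x₁).open_source.measurableSet
      calc chartVol n x₁ (B ∩ s)
          ≤ chartVol n x₁ ((B ∩ s) ∩ s₁) + chartVol n x₁ ((B ∩ s) \ s₁) :=
            measure_le_inter_add_sdiff _ _ _
        _ = chartVol n x₀ ((B ∩ s) ∩ s₁) + 0 := by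
            congr 1
            · exact chartVol_congr x₀ x₁ ((hB.inter hsm).inter hs₁m)
                (inter_subset_left.trans inter_subset_right) inter_subset_right
            · exact measure_mono_null (fun x hx ↦ hx.2) (chartVol_source_compl x₁)
        _ ≤ chartVol n x₀ (B ∩ s) := by
            rw [add_zero]
            exact measure_mono inter_subset_left
    calc chartVol n x₁ B ≤ chartVol n x₁ (B ∩ s) + chartVol n x₁ (B \ s) :=
          measure_le_inter_add_sdiff _ _ _
      _ ≤ chartVol n x₀ (B ∩ s) + riemVol n M (B \ s) :=
          add_le_add h1 (le_iSup (fun x : M ↦ chartVol n x) x₁ _)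
      _ = _ := by
          rw [Measure.add_apply, Measure.restrict_apply hB, Measure.restrict_apply hB,
            sdiff_eq]
  calc riemVol n M A ≤ _ := hle A
    _ = chartVol n x₀ A := by
      rw [Measure.add_apply, Measure.restrict_apply hA, Measure.restrict_apply hA,
        inter_eq_left.2 h₀, ← sdiff_eq, sdiff_eq_empty.2 h₀, measure_empty, add_zero]

end Volume

/-! ### Comparison of the volume with Lebesgue measure in a chart. -/

section LocalVolume

variable {n : ℕ} {M : Type*} [EMetricSpace M] [ChartedSpace (EuclideanSpace ℝ (Fin n)) M]
  [IsManifold (𝓡 n) ∞ M]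
  [RiemannianBundle (fun x : M ↦ TangentSpace (𝓡 n) x)]
  [IsContMDiffRiemannianBundle (𝓡 n) ∞ (EuclideanSpace ℝ (Fin n))
      (fun x : M ↦ TangentSpace (𝓡 n) x)]
  [MeasurableSpace M] [BorelSpace M]

/-- The density is positive on the chart target, so both measures have the same null sets. The set A
is arbitrary, since exceptional sets of a.e. statements need not be measurable. -/
lemma riemVol_null_iff (x₀ : M) {A : Set M} (hA : A ⊆ (chartAt (Euc n) x₀).source) :
    riemVol n M A = 0 ↔
      volume ((chartAt (Euc n) x₀).target ∩ (chartAt (Euc n) x₀).symm ⁻¹' A) = 0 := by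
  set c := chartAt (Euc n) x₀ with hc
  have hsm : MeasurableSet c.source := c.open_source.measurableSet
  constructor
  · intro h
    set A' := toMeasurable (riemVol n M) A ∩ c.source with hA'
    have hm : MeasurableSet A' := (measurableSet_toMeasurable _ _).inter hsm
    have h0 : riemVol n M A' = 0 :=
      measure_mono_null inter_subset_left (by rw [measure_toMeasurable, h])
    rw [riemVol_apply x₀ hm inter_subset_right, chartVol_apply x₀ hm] at h0
    have hBm := measurableSet_target_inter (n := n) x₀ hm
    have h1 : volume (c.target ∩ c.symm ⁻¹' A') = 0 := by
      have hdens : AEMeasurable (fun z ↦ ENNReal.ofReal (volDensity n x₀ z))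
          (volume.restrict (c.target ∩ c.symm ⁻¹' A')) :=
        (((continuousOn_volDensity (n := n) x₀).aemeasurable c.open_target.measurableSet).mono_set
          inter_subset_left).ennreal_ofReal
      rw [setLIntegral_eq_zero_iff' hBm hdens] at h0
      refine measure_mono_null (fun z hz ↦ ?_) h0
      simp only [mem_compl_iff, mem_ofPred_eq, Classical.not_imp]
      exact ⟨hz, by simpa using volDensity_pos (n := n) x₀ hz.1⟩
    refine measure_mono_null (inter_subset_inter_right _ (preimage_mono ?_)) h1
    exact subset_inter (subset_toMeasurable _ _) hA
  · intro h
    set N := toMeasurable volume (c.target ∩ c.symm ⁻¹' A) with hN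
    have hNm : MeasurableSet N := measurableSet_toMeasurable _ _
    have hm : MeasurableSet (c.source ∩ c ⁻¹' N) := by
      have h1 := (continuousOn_iff_continuous_domRestrict.1 c.continuousOn).measurable hNm
      have h2 := hsm.subtype_image h1
      convert h2 using 1
      ext z
      simp [and_comm]
    have hsub : A ⊆ c.source ∩ c ⁻¹' N := fun x hx ↦
      ⟨hA hx, subset_toMeasurable _ _ ⟨c.map_source (hA hx), by simpa [c.left_inv (hA hx)] using hx⟩⟩
    refine measure_mono_null hsub ?_
    rw [riemVol_apply x₀ hm inter_subset_left, chartVol_apply x₀ hm]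
    refine setLIntegral_measure_zero _ _ (measure_mono_null (t := N) ?_ ?_)
    · rintro z ⟨hz, hz'⟩
      have h2 : c (c.symm z) ∈ N := hz'.2
      rwa [c.right_inv hz] at h2
    · rw [hN, measure_toMeasurable, h]

/-- The density is continuous and positive, hence bounded below by some m > 0 on the compact K, and
C = 1/m works. -/
lemma exists_map_le_smul_riemVol (x₀ : M) {K : Set (Euc n)} (hK : IsCompact K)
    (hKt : K ⊆ (chartAt (Euc n) x₀).target) {U : Set M} (hU : MeasurableSet U)
    (hKU : K ⊆ (chartAt (Euc n) x₀).symm ⁻¹' U) :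
    ∃ C : ℝ≥0∞, C ≠ ⊤ ∧ (volume.restrict K).map (chartAt (Euc n) x₀).symm ≤
      C • (riemVol n M).restrict U := by
  set c := chartAt (Euc n) x₀ with hc
  obtain ⟨m, hm0, hm⟩ : ∃ m : ℝ, 0 < m ∧ ∀ z ∈ K, m ≤ volDensity n x₀ z := by
    rcases K.eq_empty_or_nonempty with rfl | hne
    · exact ⟨1, one_pos, by simp⟩
    · obtain ⟨z, hz, hmin⟩ := hK.exists_isMinOn hne ((continuousOn_volDensity x₀).mono hKt)
      exact ⟨_, volDensity_pos x₀ (hKt hz), fun w hw ↦ hmin hw⟩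
  have hcm : AEMeasurable c.symm (volume.restrict K) :=
    (c.continuousOn_symm.mono hKt).aemeasurable hK.measurableSet
  refine ⟨ENNReal.ofReal m⁻¹, by simp, Measure.le_iff.2 fun B hB ↦ ?_⟩
  have hBU := hB.inter hU
  rw [Measure.map_apply_of_aemeasurable hcm hB, Measure.restrict_apply₀'
    hK.measurableSet.nullMeasurableSet, Measure.smul_apply, Measure.restrict_apply hB, smul_eq_mul]
  calc volume (c.symm ⁻¹' B ∩ K) = ∫⁻ z in c.symm ⁻¹' B ∩ K, 1 := by simp
    _ ≤ ∫⁻ z in c.symm ⁻¹' B ∩ K, ENNReal.ofReal m⁻¹ * ENNReal.ofReal (volDensity n x₀ z) := by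
        have hsub : c.symm ⁻¹' B ∩ K = K ∩ (c.target ∩ c.symm ⁻¹' B) := by
          ext z
          have := @hKt z
          simp only [mem_inter_iff]
          tauto
        have hms : MeasurableSet (c.symm ⁻¹' B ∩ K) := by
          rw [hsub]
          exact hK.measurableSet.inter (measurableSet_target_inter x₀ hB)
        refine setLIntegral_mono' hms fun z hz ↦ ?_
        rw [← ENNReal.ofReal_mul (by positivity), ← ENNReal.ofReal_one]
        refine ENNReal.ofReal_le_ofReal ?_
        rw [inv_mul_eq_div, one_le_div hm0]
        exact hm z hz.2
    _ = ENNReal.ofReal m⁻¹ * ∫⁻ z in c.symm ⁻¹' B ∩ K, ENNReal.ofReal (volDensity n x₀ z) :=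
        lintegral_const_mul' _ _ (by simp)
    _ ≤ ENNReal.ofReal m⁻¹ * chartVol n x₀ (B ∩ U) := by
        rw [chartVol_apply x₀ hBU]
        refine mul_le_mul_right (lintegral_mono_set ?_) _
        exact fun z hz ↦ ⟨hKt hz.2, hz.1, hKU hz.2⟩
    _ ≤ _ := by
        exact mul_le_mul_right (le_iSup (fun x : M ↦ chartVol n x) x₀ _) _

lemma exists_setLIntegral_comp_symm_le (x₀ : M) {K : Set (Euc n)} (hK : IsCompact K)
    (hKt : K ⊆ (chartAt (Euc n) x₀).target) {U : Set M} (hU : MeasurableSet U)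
    (hKU : K ⊆ (chartAt (Euc n) x₀).symm ⁻¹' U) :
    ∃ C : ℝ≥0∞, C ≠ ⊤ ∧ ∀ f : M → ℝ≥0∞, AEMeasurable f ((riemVol n M).restrict U) →
      ∫⁻ z in K, f ((chartAt (Euc n) x₀).symm z) ≤ C * ∫⁻ x in U, f x ∂(riemVol n M) := by
  obtain ⟨C, hC, hle⟩ := exists_map_le_smul_riemVol x₀ hK hKt hU hKU
  refine ⟨C, hC, fun f hf ↦ ?_⟩
  have hac : (volume.restrict K).map (chartAt (Euc n) x₀).symm ≪ (riemVol n M).restrict U :=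
    (Measure.absolutelyContinuous_of_le hle).trans
      (Measure.AbsolutelyContinuous.rfl.smul_left _)
  rw [← lintegral_map' (hf.mono_ac hac) (((chartAt (Euc n) x₀).continuousOn_symm.mono
    hKt).aemeasurable hK.measurableSet)]
  calc _ ≤ ∫⁻ x, f x ∂(C • (riemVol n M).restrict U) := lintegral_mono' hle le_rfl
    _ = _ := by rw [lintegral_smul_measure, smul_eq_mul]

instance : IsLocallyFiniteMeasure (riemVol n M) := by
  refine ⟨fun x ↦ ?_⟩
  set c := chartAt (Euc n) x with hc
  have hcx : c x ∈ c.target := c.map_source (mem_chart_source _ x)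
  obtain ⟨K, hK, hKm, hKt⟩ : ∃ K, IsCompact K ∧ K ∈ 𝓝 (c x) ∧ K ⊆ c.target := by
    obtain ⟨K, hKm, hKt, hK⟩ := local_compact_nhds (c.open_target.mem_nhds hcx)
    exact ⟨K, hK, hKm, hKt⟩
  have hW : IsOpen (c.source ∩ c ⁻¹' interior K) := c.isOpen_inter_preimage isOpen_interior
  refine ⟨c.source ∩ c ⁻¹' interior K, hW.mem_nhds
    ⟨mem_chart_source _ x, mem_interior_iff_mem_nhds.2 hKm⟩, ?_⟩
  rw [riemVol_apply x hW.measurableSet inter_subset_left, chartVol_apply x hW.measurableSet]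
  obtain ⟨C, hC⟩ := hK.exists_bound_of_continuousOn ((continuousOn_volDensity x).mono hKt)
  calc _ ≤ ∫⁻ z in K, ENNReal.ofReal C := by
        refine (lintegral_mono_set (t := K) ?_).trans (setLIntegral_mono' hK.measurableSet ?_)
        · rintro z ⟨hz, hz'⟩
          have := interior_subset hz'.2
          rwa [c.right_inv hz] at this
        · exact fun z hz ↦ ENNReal.ofReal_le_ofReal ((le_abs_self _).trans (hC z hz))
    _ < ⊤ := by
        rw [setLIntegral_const]
        exact ENNReal.mul_lt_top (by simp) hK.measure_lt_top

end LocalVolume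

/-! ### Convergence of integrals of products. -/

section Convergence

variable {X : Type*} [MeasurableSpace X] {μ : Measure X}

/-- Products of an `L¹`-convergent sequence with a boundedly a.e. convergent one converge in
integral. -/
lemma tendsto_integral_mul_of_L1 {a b : X → ℝ} {aj bj : ℕ → X → ℝ} {C : ℝ}
    (ha : Integrable a μ) (haj : ∀ j, AEStronglyMeasurable (aj j) μ)
    (hbj : ∀ j, AEStronglyMeasurable (bj j) μ)
    (hC : ∀ j, ∀ᵐ x ∂μ, |bj j x| ≤ C) (hlim : ∀ᵐ x ∂μ, Tendsto (fun j ↦ bj j x) atTop (𝓝 (b x)))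
    (hL1 : Tendsto (fun j ↦ ∫⁻ x, ‖aj j x - a x‖ₑ ∂μ) atTop (𝓝 0)) :
    Integrable (fun x ↦ b x * a x) μ ∧
      Tendsto (fun j ↦ ∫ x, bj j x * aj j x ∂μ) atTop (𝓝 (∫ x, b x * a x ∂μ)) := by
  have hbm : AEStronglyMeasurable b μ := aestronglyMeasurable_of_tendsto_ae _ hbj hlim
  have hC' : ∀ᵐ x ∂μ, ∀ j, |bj j x| ≤ C := ae_all_iff.2 hC
  have hbC : ∀ᵐ x ∂μ, |b x| ≤ C := by
    filter_upwards [hC', hlim] with x hx hx'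
    exact le_of_tendsto hx'.abs (Eventually.of_forall hx)
  have hint : Integrable (fun x ↦ b x * a x) μ := ha.bdd_mul hbm hbC
  refine ⟨hint, ?_⟩
  -- Split b_j a_j - b a = b_j (a_j - a) + (b_j - b) a. The first term is small in L¹ because the
  -- b_j are bounded, the second by dominated convergence.
  have hkey : Tendsto (fun j ↦ ∫⁻ x, ‖bj j x * aj j x - b x * a x‖ₑ ∂μ) atTop (𝓝 0) := by
    have h1 : Tendsto (fun j ↦ ENNReal.ofReal C * ∫⁻ x, ‖aj j x - a x‖ₑ ∂μ) atTop (𝓝 0) := by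
      simpa using ENNReal.Tendsto.const_mul hL1 (Or.inr ENNReal.ofReal_ne_top)
    have h2 : Tendsto (fun j ↦ ∫⁻ x, ‖(bj j x - b x) * a x‖ₑ ∂μ) atTop (𝓝 0) := by
      have : Tendsto (fun j ↦ ∫⁻ x, ‖(bj j x - b x) * a x‖ₑ ∂μ) atTop (𝓝 (∫⁻ _, 0 ∂μ)) := by
        refine tendsto_lintegral_of_dominated_convergence'
          (fun x ↦ ENNReal.ofReal (2 * C) * ‖a x‖ₑ) (fun j ↦ ?_) (fun j ↦ ?_) ?_ ?_
        · exact (((hbj j).sub hbm).mul ha.1).enorm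
        · filter_upwards [hC j, hbC] with x h1 h2
          rw [enorm_mul]
          gcongr
          rw [Real.enorm_eq_ofReal_abs]
          refine ENNReal.ofReal_le_ofReal ((abs_sub _ _).trans ?_)
          linarith
        · rw [lintegral_const_mul' _ _ ENNReal.ofReal_ne_top]
          exact ENNReal.mul_ne_top ENNReal.ofReal_ne_top ha.2.ne
        · filter_upwards [hlim] with x hx
          have : Tendsto (fun j ↦ (bj j x - b x) * a x) atTop (𝓝 0) := by
            simpa using (hx.sub_const (b x)).mul_const (a x)
          simpa using this.enorm
      simpa using this
    have h3 := h1.add h2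
    rw [add_zero] at h3
    refine tendsto_of_tendsto_of_tendsto_of_le_of_le tendsto_const_nhds h3
      (fun j ↦ zero_le) (fun j ↦ ?_)
    have hm : AEMeasurable (fun x ↦ ENNReal.ofReal C * ‖aj j x - a x‖ₑ) μ :=
      ((haj j).sub ha.1).enorm.const_mul _
    rw [← lintegral_const_mul' _ _ ENNReal.ofReal_ne_top, ← lintegral_add_left' hm]
    refine lintegral_mono_ae ?_
    filter_upwards [hC j] with x hx
    have : bj j x * aj j x - b x * a x = bj j x * (aj j x - a x) + (bj j x - b x) * a x := by ring
    rw [this]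
    refine (enorm_add_le _ _).trans ?_
    gcongr
    rw [enorm_mul]
    gcongr
    rw [Real.enorm_eq_ofReal_abs]
    exact ENNReal.ofReal_le_ofReal hx
  refine tendsto_integral_of_L1 _ hint.1 ?_ hkey
  have : ∀ᶠ j in atTop, ∫⁻ x, ‖aj j x - a x‖ₑ ∂μ < ⊤ := hL1.eventually (gt_mem_nhds (by simp))
  filter_upwards [this] with j hj
  have haj' : Integrable (aj j) μ := by
    have h : Integrable (fun x ↦ aj j x - a x) μ := ⟨(haj j).sub ha.1, hj⟩
    exact (h.add ha).congr (Eventually.of_forall fun x ↦ by simp)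
  exact haj'.bdd_mul (hbj j) (hC j)

lemma exists_subseq_tendsto_ae {p : ℝ} (hp : 1 < p) {f : ℕ → X → ℝ}
    (hf : ∀ j, AEMeasurable (f j) μ)
    (h : Tendsto (fun j ↦ ∫⁻ x, ‖f j x‖ₑ ^ p ∂μ) atTop (𝓝 0)) :
    ∃ ns : ℕ → ℕ, StrictMono ns ∧ ∀ᵐ x ∂μ, Tendsto (fun j ↦ f (ns j) x) atTop (𝓝 0) := by
  have hp0 : 0 < p := by linarith
  have h1 : Tendsto (fun j ↦ eLpNorm (f j - fun _ ↦ (0 : ℝ)) (ENNReal.ofReal p) μ) atTop (𝓝 0) := by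
    have h2 : ∀ j, eLpNorm (f j - fun _ ↦ (0 : ℝ)) (ENNReal.ofReal p) μ =
        (∫⁻ x, ‖f j x‖ₑ ^ p ∂μ) ^ (1 / p) := fun j ↦ by
      rw [eLpNorm_eq_lintegral_rpow_enorm_toReal (by simpa using hp0) (by simp)]
      simp [ENNReal.toReal_ofReal hp0.le]
    simp only [h2]
    have := (ENNReal.continuous_rpow_const (y := 1 / p)).tendsto 0 |>.comp h
    rwa [ENNReal.zero_rpow_of_pos (by positivity)] at this
  obtain ⟨ns, hns, hae⟩ := (tendstoInMeasure_of_tendsto_eLpNorm (by simpa using hp0)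
    (fun j ↦ (hf j).aestronglyMeasurable) aestronglyMeasurable_const h1).exists_seq_tendsto_ae
  exact ⟨ns, hns, hae⟩

/-- Hölder's inequality for a null sequence in `L^p`. -/
lemma tendsto_lintegral_rpow_mul {p : ℝ} (hp : 1 < p) {g : X → ℝ≥0∞} {a : ℕ → X → ℝ≥0∞}
    (hg : AEMeasurable g μ) (ha : ∀ j, AEMeasurable (a j) μ) (hgp : ∫⁻ x, g x ^ p ∂μ < ⊤)
    (h : Tendsto (fun j ↦ ∫⁻ x, a j x ^ p ∂μ) atTop (𝓝 0)) :
    Tendsto (fun j ↦ ∫⁻ x, g x ^ (p - 1) * a j x ∂μ) atTop (𝓝 0) := by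
  have hp0 : 0 < p := by linarith
  have hpq : (p / (p - 1)).HolderConjugate p := (Real.HolderConjugate.conjExponent hp).symm
  have h1 : ∀ j, ∫⁻ x, g x ^ (p - 1) * a j x ∂μ ≤
      (∫⁻ x, g x ^ p ∂μ) ^ (1 / (p / (p - 1))) * (∫⁻ x, a j x ^ p ∂μ) ^ (1 / p) := fun j ↦ by
    refine (ENNReal.lintegral_mul_le_Lp_mul_Lq μ hpq (hg.pow_const _) (ha j)).trans_eq ?_
    simp only [← ENNReal.rpow_mul]
    rw [mul_div_cancel₀ _ (by linarith : p - 1 ≠ 0)]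
  have h2 : Tendsto (fun j ↦ (∫⁻ x, g x ^ p ∂μ) ^ (1 / (p / (p - 1))) *
      (∫⁻ x, a j x ^ p ∂μ) ^ (1 / p)) atTop (𝓝 0) := by
    have h3 := (ENNReal.continuous_rpow_const (y := 1 / p)).tendsto 0 |>.comp h
    rw [ENNReal.zero_rpow_of_pos (by positivity)] at h3
    have h4 := ENNReal.Tendsto.const_mul (a := (∫⁻ x, g x ^ p ∂μ) ^ (1 / (p / (p - 1)))) h3
      (Or.inr (ENNReal.rpow_ne_top_of_nonneg (by
        have : 0 < p - 1 := by linarith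
        positivity) hgp.ne))
    simpa using h4
  exact tendsto_of_tendsto_of_tendsto_of_le_of_le tendsto_const_nhds h2 (fun j ↦ zero_le) h1

/-- On a set of finite measure, null sequences in `L^p` are null sequences in `L¹`. -/
lemma tendsto_lintegral_of_rpow [IsFiniteMeasure μ] {p : ℝ} (hp : 1 < p) {a : ℕ → X → ℝ≥0∞}
    (ha : ∀ j, AEMeasurable (a j) μ) (h : Tendsto (fun j ↦ ∫⁻ x, a j x ^ p ∂μ) atTop (𝓝 0)) :
    Tendsto (fun j ↦ ∫⁻ x, a j x ∂μ) atTop (𝓝 0) := by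
  have := tendsto_lintegral_rpow_mul (μ := μ) hp (g := fun _ ↦ 1) aemeasurable_const ha
    (by simp) h
  simpa using this

end Convergence

/-! ### Weak derivatives of limits of C¹ functions on open sets of Euclidean space. -/

section Euclidean

variable {n : ℕ} {V : Set (Euc n)} {e : Euc n}

/-- `r` is a limit in `L¹_loc(V)` of `C¹` functions whose derivatives in the direction `e` converge
to `γ` in `L¹_loc(V)`. -/
def IsC1Limit (V : Set (Euc n)) (e : Euc n) (r γ : Euc n → ℝ) : Prop :=
  ∃ f : ℕ → Euc n → ℝ, (∀ j, ContDiffOn ℝ 1 (f j) V) ∧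
    (∀ K ⊆ V, IsCompact K → Tendsto (fun j ↦ ∫⁻ z in K, ‖f j z - r z‖ₑ) atTop (𝓝 0)) ∧
    (∀ K ⊆ V, IsCompact K → Tendsto (fun j ↦ ∫⁻ z in K, ‖fderiv ℝ (f j) z e - γ z‖ₑ)
      atTop (𝓝 0)) ∧
    (∀ᵐ z, z ∈ V → Tendsto (fun j ↦ f j z) atTop (𝓝 (r z))) ∧
    ∀ᵐ z, z ∈ V → Tendsto (fun j ↦ fderiv ℝ (f j) z e) atTop (𝓝 (γ z))

lemma integrableOn_of_tendsto {K : Set (Euc n)} (hK : IsCompact K) {f : ℕ → Euc n → ℝ}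
    {r : Euc n → ℝ} (hf : ∀ j, ContinuousOn (f j) K)
    (h : Tendsto (fun j ↦ ∫⁻ z in K, ‖f j z - r z‖ₑ) atTop (𝓝 0))
    (hae : ∀ᵐ z, z ∈ K → Tendsto (fun j ↦ f j z) atTop (𝓝 (r z))) :
    IntegrableOn r K := by
  have hr : AEStronglyMeasurable r (volume.restrict K) :=
    aestronglyMeasurable_of_tendsto_ae atTop
      (fun j ↦ (hf j).aestronglyMeasurable hK.measurableSet)
      ((ae_restrict_iff' hK.measurableSet).2 hae)
  obtain ⟨j, hj⟩ := (h.eventually (gt_mem_nhds (show (0 : ℝ≥0∞) < ⊤ by simp))).exists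
  have h1 : IntegrableOn (f j) K := (hf j).integrableOn_compact hK
  have h2 : Integrable (fun z ↦ f j z - r z) (volume.restrict K) := ⟨h1.1.sub hr, hj⟩
  exact (h1.sub h2).congr (Eventually.of_forall fun z ↦ by simp)

lemma IsC1Limit.integrableOn {r γ : Euc n → ℝ} (hV : IsOpen V) (h : IsC1Limit V e r γ)
    {K : Set (Euc n)} (hKV : K ⊆ V) (hK : IsCompact K) : IntegrableOn r K ∧ IntegrableOn γ K := by
  obtain ⟨f, hf, h1, h2, h3, h4⟩ := h
  refine ⟨integrableOn_of_tendsto hK (fun j ↦ (hf j).continuousOn.mono hKV) (h1 K hKV hK) ?_,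
    integrableOn_of_tendsto hK (fun j ↦ ?_) (h2 K hKV hK) ?_⟩
  · filter_upwards [h3] with z hz hzK using hz (hKV hzK)
  · exact (((hf j).continuousOn_fderiv_of_isOpen hV le_rfl).clm_apply continuousOn_const).mono hKV
  · filter_upwards [h4] with z hz hzK using hz (hKV hzK)

/-- Integration by parts for F ∘ f against ψ. Since f is C¹ on V only, every integrand is written as
an indicator of the support of ψ, on which all factors are continuous. -/
lemma integral_comp_mul_fderiv (hV : IsOpen V) {f : Euc n → ℝ} (hf : ContDiffOn ℝ 1 f V)
    {F F' : ℝ → ℝ} (hF : ∀ t, HasDerivAt F (F' t) t) (hF' : Continuous F') {ψ : Euc n → ℝ}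
    (hψ : ContDiff ℝ ∞ ψ) (hψc : HasCompactSupport ψ) (hψV : tsupport ψ ⊆ V) :
    ∫ z in tsupport ψ, ψ z * F' (f z) * fderiv ℝ f z e =
      - ∫ z in tsupport ψ, fderiv ℝ ψ z e * F (f z) := by
  have hFc : Continuous F := continuous_iff_continuousAt.2 fun t ↦ (hF t).continuousAt
  have hd : ∀ z ∈ V, HasFDerivAt (F ∘ f) (F' (f z) • fderiv ℝ f z) z := fun z hz ↦
    (hF (f z)).comp_hasFDerivAt z
      ((hf.contDiffAt (hV.mem_nhds hz)).differentiableAt one_ne_zero).hasFDerivAt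
  have hK : IsCompact (tsupport ψ) := hψc
  have hc1 : ContinuousOn (fun z ↦ F' (f z) * fderiv ℝ f z e) (tsupport ψ) :=
    ((hF'.comp_continuousOn hf.continuousOn).mul
      ((hf.continuousOn_fderiv_of_isOpen hV le_rfl).clm_apply continuousOn_const)).mono hψV
  have hc2 : ContinuousOn (fun z ↦ F (f z)) (tsupport ψ) :=
    (hFc.comp_continuousOn hf.continuousOn).mono hψV
  have hψd : Continuous (fun z ↦ fderiv ℝ ψ z e) :=
    (hψ.continuous_fderiv (by simp)).clm_apply continuous_const
  have hsupp : ∀ z ∉ tsupport ψ, ψ z = 0 := fun z hz ↦ image_eq_zero_of_notMem_tsupport hz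
  have hsupp' : ∀ z ∉ tsupport ψ, fderiv ℝ ψ z e = 0 := fun z hz ↦ by
    have : fderiv ℝ ψ z = 0 := by
      by_contra hne
      exact hz (support_fderiv_subset ℝ hne)
    simp [this]
  have i1 : IntegrableOn (fun z ↦ ψ z * (F' (f z) * fderiv ℝ f z e)) (tsupport ψ) :=
    (hψ.continuous.continuousOn.mul hc1).integrableOn_compact hK
  have i2 : IntegrableOn (fun z ↦ fderiv ℝ ψ z e * F (f z)) (tsupport ψ) :=
    (hψd.continuousOn.mul hc2).integrableOn_compact hK
  have i3 : IntegrableOn (fun z ↦ ψ z * F (f z)) (tsupport ψ) :=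
    (hψ.continuous.continuousOn.mul hc2).integrableOn_compact hK
  have e1 : ∀ z, fderiv ℝ (F ∘ f) z e * ψ z =
      (tsupport ψ).indicator (fun z ↦ ψ z * (F' (f z) * fderiv ℝ f z e)) z := fun z ↦ by
    by_cases hz : z ∈ tsupport ψ
    · rw [indicator_of_mem hz, (hd z (hψV hz)).fderiv]
      simp [mul_comm]
    · rw [indicator_of_notMem hz, hsupp z hz, mul_zero]
  have e2 : ∀ z, (F ∘ f) z * fderiv ℝ ψ z e =
      (tsupport ψ).indicator (fun z ↦ fderiv ℝ ψ z e * F (f z)) z := fun z ↦ by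
    by_cases hz : z ∈ tsupport ψ
    · rw [indicator_of_mem hz]
      simp [mul_comm]
    · rw [indicator_of_notMem hz, hsupp' z hz, mul_zero]
  have e3 : ∀ z, (F ∘ f) z * ψ z =
      (tsupport ψ).indicator (fun z ↦ ψ z * F (f z)) z := fun z ↦ by
    by_cases hz : z ∈ tsupport ψ
    · rw [indicator_of_mem hz]
      simp [mul_comm]
    · rw [indicator_of_notMem hz, hsupp z hz, mul_zero]
  have hm := hK.measurableSet
  have := integral_mul_fderiv_eq_neg_fderiv_mul_of_integrable (μ := (volume : Measure (Euc n)))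
    (f := F ∘ f) (g := ψ) (v := e)
    (by simpa only [e1] using (integrable_indicator_iff hm).2 i1)
    (by simpa only [e2] using (integrable_indicator_iff hm).2 i2)
    (by simpa only [e3] using (integrable_indicator_iff hm).2 i3)
    (fun z hz ↦ (hd z (hψV hz)).differentiableAt)
    (fun z _ ↦ hψ.differentiable (by simp) z)
  simp only [e1, e2, integral_indicator hm] at this
  rw [this, neg_neg]
  simp [mul_assoc]

/-- The chain rule for limits of `C¹` functions, in the weak form. -/
lemma IsC1Limit.integral_comp {r γ : Euc n → ℝ} (hV : IsOpen V) (h : IsC1Limit V e r γ)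
    {F F' : ℝ → ℝ} (hF : ∀ t, HasDerivAt F (F' t) t) (hF' : Continuous F') {C : ℝ}
    (hC : ∀ t, |F' t| ≤ C) {ψ : Euc n → ℝ}
    (hψ : ContDiff ℝ ∞ ψ) (hψc : HasCompactSupport ψ) (hψV : tsupport ψ ⊆ V) :
    ∫ z in tsupport ψ, ψ z * F' (r z) * γ z = - ∫ z in tsupport ψ, fderiv ℝ ψ z e * F (r z) := by
  have hK : IsCompact (tsupport ψ) := hψc
  have hm := hK.measurableSet
  obtain ⟨hri, hγi⟩ := h.integrableOn hV hψV hK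
  obtain ⟨f, hf, h1, h2, h3, h4⟩ := h
  have hFc : Continuous F := continuous_iff_continuousAt.2 fun t ↦ (hF t).continuousAt
  have hfc : ∀ j, ContinuousOn (f j) (tsupport ψ) := fun j ↦ (hf j).continuousOn.mono hψV
  -- The bound on F' makes F Lipschitz, so L¹ convergence of f_j passes to F ∘ f_j even though F may
  -- be unbounded.
  have hLip : ∀ s t, |F s - F t| ≤ C * |s - t| := fun s t ↦ by
    have := Convex.norm_image_sub_le_of_norm_hasDerivWithin_le (f := F) (f' := F') (C := C)
      (s := univ) (x := t) (y := s) (fun x _ ↦ (hF x).hasDerivWithinAt) (fun x _ ↦ hC x)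
      convex_univ (mem_univ _) (mem_univ _)
    simpa using this
  have hψd : Continuous (fun z ↦ fderiv ℝ ψ z e) :=
    (hψ.continuous_fderiv (by simp)).clm_apply continuous_const
  obtain ⟨A, hA⟩ := hK.exists_bound_of_continuousOn hψ.continuous.continuousOn
  obtain ⟨B, hB⟩ := hK.exists_bound_of_continuousOn hψd.continuousOn
  have h3' : ∀ᵐ z ∂(volume.restrict (tsupport ψ)), Tendsto (fun j ↦ f j z) atTop (𝓝 (r z)) := by
    rw [ae_restrict_iff' hm]
    filter_upwards [h3] with z hz hzK using hz (hψV hzK)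
  have hC0 : 0 ≤ C := (abs_nonneg _).trans (hC 0)
  have l1 : Tendsto (fun j ↦ ∫ z in tsupport ψ, ψ z * F' (f j z) * fderiv ℝ (f j) z e) atTop
      (𝓝 (∫ z in tsupport ψ, ψ z * F' (r z) * γ z)) := by
    refine (tendsto_integral_mul_of_L1 (C := A * C) hγi (fun j ↦ ?_) (fun j ↦ ?_) (fun j ↦ ?_) ?_
      (h2 _ hψV hK)).2
    · exact ((((hf j).continuousOn_fderiv_of_isOpen hV le_rfl).clm_apply
        continuousOn_const).mono hψV).aestronglyMeasurable hm
    · exact (hψ.continuous.continuousOn.mul (hF'.comp_continuousOn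
        (hfc j))).aestronglyMeasurable hm
    · refine (ae_restrict_iff' hm).2 (Eventually.of_forall fun z hz ↦ ?_)
      rw [abs_mul]
      exact mul_le_mul (hA z hz) (hC _) (abs_nonneg _) ((norm_nonneg _).trans (hA z hz))
    · filter_upwards [h3'] with z hz
      exact ((hF'.tendsto _).comp hz).const_mul _
  have hFr : IntegrableOn (fun z ↦ F (r z)) (tsupport ψ) := by
    have : IntegrableOn (fun z ↦ |F 0| + C * |r z|) (tsupport ψ) :=
      (integrableOn_const hK.measure_lt_top.ne).add (hri.abs.const_mul C)
    refine this.mono' (hFc.comp_aestronglyMeasurable hri.1) (Eventually.of_forall fun z ↦ ?_)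
    have := hLip (r z) 0
    rw [sub_zero] at this
    have h5 := abs_sub_abs_le_abs_sub (F (r z)) (F 0)
    rw [Real.norm_eq_abs]
    linarith
  have l2 : Tendsto (fun j ↦ ∫ z in tsupport ψ, fderiv ℝ ψ z e * F (f j z)) atTop
      (𝓝 (∫ z in tsupport ψ, fderiv ℝ ψ z e * F (r z))) := by
    refine (tendsto_integral_mul_of_L1 (C := B) (bj := fun _ z ↦ fderiv ℝ ψ z e) hFr
      (fun j ↦ ?_) (fun j ↦ ?_) (fun j ↦ ?_) ?_ ?_).2
    · exact (hFc.comp_continuousOn (hfc j)).aestronglyMeasurable hm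
    · exact hψd.aestronglyMeasurable
    · exact (ae_restrict_iff' hm).2 (Eventually.of_forall fun z hz ↦ hB z hz)
    · exact Eventually.of_forall fun z ↦ tendsto_const_nhds
    · have h5 : Tendsto (fun j ↦ ENNReal.ofReal C * ∫⁻ z in tsupport ψ, ‖f j z - r z‖ₑ)
          atTop (𝓝 0) := by
        simpa using ENNReal.Tendsto.const_mul (h1 _ hψV hK) (Or.inr ENNReal.ofReal_ne_top)
      refine tendsto_of_tendsto_of_tendsto_of_le_of_le tendsto_const_nhds h5
        (fun j ↦ zero_le) (fun j ↦ ?_)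
      rw [← lintegral_const_mul' _ _ ENNReal.ofReal_ne_top]
      refine lintegral_mono fun z ↦ ?_
      simp only [Real.enorm_eq_ofReal_abs]
      rw [← ENNReal.ofReal_mul hC0]
      exact ENNReal.ofReal_le_ofReal (hLip _ _)
  have heq := fun j ↦ integral_comp_mul_fderiv (e := e) hV (hf j) hF hF' hψ hψc hψV
  simp only [heq] at l1
  exact tendsto_nhds_unique l1 l2.neg

/-- The fundamental lemma of the calculus of variations, with integrals over the support of ψ to
match the integration by parts above. -/
lemma ae_eq_zero_of_setIntegral_tsupport (hV : IsOpen V) {g : Euc n → ℝ}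
    (hg : ∀ K ⊆ V, IsCompact K → IntegrableOn g K)
    (h : ∀ ψ : Euc n → ℝ, ContDiff ℝ ∞ ψ → HasCompactSupport ψ → tsupport ψ ⊆ V →
      ∫ z in tsupport ψ, ψ z * g z = 0) :
    ∀ᵐ z, z ∈ V → g z = 0 := by
  refine hV.ae_eq_zero_of_integral_contDiff_smul_eq_zero
    ((locallyIntegrableOn_iff hV.isLocallyClosed).2 fun K hKV hK ↦ hg K hKV hK)
    fun ψ hψ hψc hψV ↦ ?_
  rw [← h ψ hψ hψc hψV, setIntegral_eq_integral_of_forall_compl_eq_zero]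
  · simp
  · intro z hz
    rw [image_eq_zero_of_notMem_tsupport hz, zero_mul]

/-- Weak derivatives of compositions that agree almost everywhere agree almost everywhere. -/
lemma IsC1Limit.comp_unique {r γ s η : Euc n → ℝ} (hV : IsOpen V) (h : IsC1Limit V e r γ)
    (h' : IsC1Limit V e s η) {F F' : ℝ → ℝ} (hF : ∀ t, HasDerivAt F (F' t) t)
    (hF' : Continuous F') {C : ℝ} (hC : ∀ t, |F' t| ≤ C) {Q Q' : ℝ → ℝ}
    (hQ : ∀ t, HasDerivAt Q (Q' t) t) (hQ' : Continuous Q') {D : ℝ} (hD : ∀ t, |Q' t| ≤ D)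
    (heq : ∀ᵐ z, z ∈ V → F (r z) = Q (s z)) :
    ∀ᵐ z, z ∈ V → F' (r z) * γ z = Q' (s z) * η z := by
  have key : ∀ {r γ : Euc n → ℝ} {F' : ℝ → ℝ} {C : ℝ}, IsC1Limit V e r γ → Continuous F' →
      (∀ t, |F' t| ≤ C) → ∀ K ⊆ V, IsCompact K → IntegrableOn (fun z ↦ F' (r z) * γ z) K := by
    intro r γ F' C h hF' hC K hKV hK
    have hi := h.integrableOn hV hKV hK
    exact hi.2.bdd_mul (hF'.comp_aestronglyMeasurable hi.1.1) (Eventually.of_forall fun z ↦ hC _)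
  have := ae_eq_zero_of_setIntegral_tsupport hV (g := fun z ↦ F' (r z) * γ z - Q' (s z) * η z)
    (fun K hKV hK ↦ (key h hF' hC K hKV hK).sub (key h' hQ' hD K hKV hK)) ?_
  · filter_upwards [this] with z hz hzV using sub_eq_zero.1 (hz hzV)
  · intro ψ hψ hψc hψV
    have hK : IsCompact (tsupport ψ) := hψc
    have h1 := h.integral_comp hV hF hF' hC hψ hψc hψV
    have h2 := h'.integral_comp hV hQ hQ' hD hψ hψc hψV
    have h3 : ∫ z in tsupport ψ, fderiv ℝ ψ z e * F (r z) =
        ∫ z in tsupport ψ, fderiv ℝ ψ z e * Q (s z) := by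
      refine setIntegral_congr_ae hK.measurableSet ?_
      filter_upwards [heq] with z hz hzK
      rw [hz (hψV hzK)]
    obtain ⟨A, hA⟩ := hK.exists_bound_of_continuousOn hψ.continuous.continuousOn
    have hi : ∀ {g : Euc n → ℝ}, IntegrableOn g (tsupport ψ) →
        IntegrableOn (fun z ↦ ψ z * g z) (tsupport ψ) := fun hg ↦
      Integrable.bdd_mul hg hψ.continuous.aestronglyMeasurable
        ((ae_restrict_iff' hK.measurableSet).2 (Eventually.of_forall fun z hz ↦ hA z hz))
    simp only [mul_sub]
    rw [integral_sub (hi (key h hF' hC _ hψV hK)) (hi (key h' hQ' hD _ hψV hK))]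
    simp only [← mul_assoc]
    rw [h1, h2, h3, sub_self]

end Euclidean

/-- The weak derivative vanishes almost everywhere on the zero set of the function. -/
lemma IsC1Limit.ae_eq_zero {n : ℕ} {V : Set (Euc n)} {e : Euc n} {r γ : Euc n → ℝ}
    (hV : IsOpen V) (h : IsC1Limit V e r γ) : ∀ᵐ z, z ∈ V → r z = 0 → γ z = 0 := by
  -- Apply the chain rule to F_k(t) = arctan((k+1)t)/(k+1). These functions tend to 0 uniformly,
  -- while their derivatives are bounded by 1 and tend to the indicator of {0}. In the limit b γ is
  -- the weak derivative of 0.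
  set b : Euc n → ℝ := fun z ↦ if r z = 0 then 1 else 0 with hb
  have hF : ∀ (k : ℕ) (t : ℝ), HasDerivAt (fun t ↦ ((k : ℝ) + 1)⁻¹ * Real.arctan ((k + 1) * t))
      (1 / (1 + ((k + 1) * t) ^ 2)) t := fun k t ↦ by
    have h0 : ((k : ℝ) + 1) ≠ 0 := by positivity
    have := (((hasDerivAt_id t).const_mul ((k : ℝ) + 1)).arctan).const_mul ((k : ℝ) + 1)⁻¹
    refine this.congr_deriv ?_
    simp only [id, mul_one]
    field_simp
  have hF' : ∀ k : ℕ, Continuous (fun t : ℝ ↦ 1 / (1 + (((k : ℝ) + 1) * t) ^ 2)) := fun k ↦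
    Continuous.div (by fun_prop) (by fun_prop) fun t ↦ by positivity
  have hC : ∀ (k : ℕ) (t : ℝ), |1 / (1 + (((k : ℝ) + 1) * t) ^ 2)| ≤ 1 := fun k t ↦ by
    rw [abs_of_nonneg (by positivity), div_le_one (by positivity)]
    nlinarith [sq_nonneg (((k : ℝ) + 1) * t)]
  have hlim : ∀ z, Tendsto (fun k : ℕ ↦ 1 / (1 + (((k : ℝ) + 1) * r z) ^ 2)) atTop (𝓝 (b z)) := by
    intro z
    by_cases hz : r z = 0
    · simp [hb, hz]
    · simp only [hb, hz, if_false]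
      have h1 : Tendsto (fun k : ℕ ↦ ((k : ℝ) + 1) * |r z|) atTop atTop :=
        (tendsto_atTop_add_const_right _ _ tendsto_natCast_atTop_atTop).atTop_mul_const
          (abs_pos.2 hz)
      have h2 : Tendsto (fun k : ℕ ↦ 1 + (((k : ℝ) + 1) * |r z|) ^ 2) atTop atTop :=
        tendsto_atTop_add_const_left _ _ ((tendsto_pow_atTop two_ne_zero).comp h1)
      refine (h2.inv_tendsto_atTop).congr fun k ↦ ?_
      simp [mul_pow]
  have hbm : ∀ K ⊆ V, IsCompact K → IntegrableOn (fun z ↦ b z * γ z) K := by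
    intro K hKV hK
    have hi := h.integrableOn hV hKV hK
    exact (tendsto_integral_mul_of_L1 (C := 1) (aj := fun _ ↦ γ) hi.2 (fun _ ↦ hi.2.1)
      (fun k ↦ (hF' k).comp_aestronglyMeasurable hi.1.1)
      (fun k ↦ Eventually.of_forall fun z ↦ hC k _) (Eventually.of_forall hlim) (by simp)).1
  have := ae_eq_zero_of_setIntegral_tsupport hV hbm fun ψ hψ hψc hψV ↦ by
    have hK : IsCompact (tsupport ψ) := hψc
    have hm := hK.measurableSet
    have hi := h.integrableOn hV hψV hK
    obtain ⟨A, hA⟩ := hK.exists_bound_of_continuousOn hψ.continuous.continuousOn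
    have hψd : Continuous (fun z ↦ fderiv ℝ ψ z e) :=
      (hψ.continuous_fderiv (by simp)).clm_apply continuous_const
    have hψi : IntegrableOn (fun z ↦ fderiv ℝ ψ z e) (tsupport ψ) :=
      hψd.continuousOn.integrableOn_compact hK
    have l1 : Tendsto (fun k : ℕ ↦ ∫ z in tsupport ψ,
        ψ z * (1 / (1 + (((k : ℝ) + 1) * r z) ^ 2)) * γ z) atTop
        (𝓝 (∫ z in tsupport ψ, ψ z * b z * γ z)) := by
      refine (tendsto_integral_mul_of_L1 (C := A * 1) (aj := fun _ ↦ γ) hi.2 (fun _ ↦ hi.2.1)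
        (fun k ↦ hψ.continuous.aestronglyMeasurable.mul
          ((hF' k).comp_aestronglyMeasurable hi.1.1))
        (fun k ↦ (ae_restrict_iff' hm).2 (Eventually.of_forall fun z hz ↦ ?_))
        (Eventually.of_forall fun z ↦ (hlim z).const_mul _) (by simp)).2
      rw [Pi.mul_apply, abs_mul]
      exact mul_le_mul (hA z hz) (hC _ _) (abs_nonneg _) ((norm_nonneg _).trans (hA z hz))
    have l2 : Tendsto (fun k : ℕ ↦ ∫ z in tsupport ψ, fderiv ℝ ψ z e *
        (((k : ℝ) + 1)⁻¹ * Real.arctan ((k + 1) * r z))) atTop (𝓝 0) := by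
      have h0 : Tendsto (fun k : ℕ ↦ ((k : ℝ) + 1)⁻¹ * (Real.pi / 2)) atTop (𝓝 0) := by
        simpa using (tendsto_one_div_add_atTop_nhds_zero_nat (𝕜 := ℝ)).mul_const (Real.pi / 2)
      have h1 : ∀ (k : ℕ) (t : ℝ), |((k : ℝ) + 1)⁻¹ * Real.arctan ((k + 1) * t)| ≤
          ((k : ℝ) + 1)⁻¹ * (Real.pi / 2) := fun k t ↦ by
        rw [abs_mul, abs_of_pos (by positivity : (0 : ℝ) < ((k : ℝ) + 1)⁻¹)]
        gcongr
        exact abs_le.2 ⟨(Real.neg_pi_div_two_lt_arctan _).le, (Real.arctan_lt_pi_div_two _).le⟩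
      have h2 : Tendsto (fun k : ℕ ↦ (((k : ℝ) + 1)⁻¹ * (Real.pi / 2)) *
          ∫ z in tsupport ψ, |fderiv ℝ ψ z e|) atTop (𝓝 0) := by
        simpa using h0.mul_const (∫ z in tsupport ψ, |fderiv ℝ ψ z e|)
      refine squeeze_zero_norm (fun k ↦ ?_) h2
      rw [← integral_const_mul]
      refine norm_integral_le_of_norm_le (hψi.abs.const_mul _) (Eventually.of_forall fun z ↦ ?_)
      rw [Real.norm_eq_abs, abs_mul, mul_comm]
      exact mul_le_mul_of_nonneg_right (h1 k _) (abs_nonneg _)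
    have heq := fun k ↦ h.integral_comp hV (hF k) (hF' k) (hC k) hψ hψc hψV
    simp only [heq] at l1
    have := tendsto_nhds_unique l1 l2.neg
    simpa [mul_assoc] using this
  filter_upwards [this] with z hz hzV hrz
  simpa [hb, hrz] using hz hzV

/-! ### Gradients as limits on the manifold. -/

section Manifold

variable {n : ℕ} {M : Type*} [EMetricSpace M] [ChartedSpace (EuclideanSpace ℝ (Fin n)) M]
  [IsManifold (𝓡 n) ∞ M]
  [RiemannianBundle (fun x : M ↦ TangentSpace (𝓡 n) x)]
  [IsContMDiffRiemannianBundle (𝓡 n) ∞ (EuclideanSpace ℝ (Fin n))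
      (fun x : M ↦ TangentSpace (𝓡 n) x)]
  [MeasurableSpace M] [BorelSpace M]

variable (n) in
/-- `u` is, on `U`, an `L^p` limit of `C¹` functions whose gradients converge in `L^p` to `G`, with
convergence almost everywhere. -/
def HasGradApprox (p : ℝ) (U : Set M) (u : M → ℝ) (G : ∀ x : M, TangentSpace (𝓡 n) x) : Prop :=
  ∃ φ : ℕ → M → ℝ, (∀ j, ContMDiffOn (𝓡 n) 𝓘(ℝ, ℝ) 1 (φ j) U) ∧
    LpNull (riemVol n M) p U (fun j x ↦ φ j x - u x) ∧
    LpNull (riemVol n M) p U (fun j x ↦ ‖grad n (φ j) x - G x‖) ∧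
    (∀ᵐ x ∂((riemVol n M).restrict U), Tendsto (fun j ↦ φ j x) atTop (𝓝 (u x))) ∧
    ∀ᵐ x ∂((riemVol n M).restrict U), Tendsto (fun j ↦ ‖grad n (φ j) x - G x‖) atTop (𝓝 0)

lemma LpNull.comp_tendsto {μ : Measure M} {p : ℝ} {A : Set M} {F : ℕ → M → ℝ}
    (h : LpNull μ p A F) {ns : ℕ → ℕ} (hns : Tendsto ns atTop atTop) :
    LpNull μ p A (fun j ↦ F (ns j)) :=
  ⟨fun _ ↦ h.1 _, h.2.comp hns⟩

lemma LpNull.mono {μ : Measure M} {p : ℝ} {A B : Set M} {F : ℕ → M → ℝ}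
    (h : LpNull μ p A F) (hBA : B ⊆ A) : LpNull μ p B F :=
  ⟨fun j ↦ (h.1 j).mono_set hBA, tendsto_of_tendsto_of_tendsto_of_le_of_le tendsto_const_nhds h.2
    (fun _ ↦ zero_le) fun _ ↦ lintegral_mono_set hBA⟩

/-- A subsequence makes the functions converge a.e., and a further one the gradients. This puts
W^{1,p} on relatively compact sets and D^{1,p} under one notion. -/
lemma hasGradApprox_of_seq {p : ℝ} (hp : 1 < p) {U : Set M} {u : M → ℝ}
    {G : ∀ x : M, TangentSpace (𝓡 n) x} {φ : ℕ → M → ℝ}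
    (hφ : ∀ j, ContMDiffOn (𝓡 n) 𝓘(ℝ, ℝ) 1 (φ j) U)
    (h1 : LpNull (riemVol n M) p U (fun j x ↦ φ j x - u x))
    (h2 : LpNull (riemVol n M) p U (fun j x ↦ ‖grad n (φ j) x - G x‖)) :
    HasGradApprox n p U u G := by
  obtain ⟨ns, hns, hae⟩ := exists_subseq_tendsto_ae hp h1.1 h1.2
  obtain ⟨ms, hms, hae'⟩ := exists_subseq_tendsto_ae hp (h2.comp_tendsto hns.tendsto_atTop).1
    (h2.comp_tendsto hns.tendsto_atTop).2
  refine ⟨fun j ↦ φ (ns (ms j)), fun j ↦ hφ _, h1.comp_tendsto (hns.comp hms).tendsto_atTop,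
    h2.comp_tendsto (hns.comp hms).tendsto_atTop, ?_, hae'⟩
  filter_upwards [hae] with x hx
  have := (hx.comp hms.tendsto_atTop).add_const (u x)
  simpa using this

lemma HasGradW.hasGradApprox {p : ℝ} (hp : 1 < p) {U : Set M} {u : M → ℝ}
    {G : ∀ x : M, TangentSpace (𝓡 n) x} (h : HasGradW n p U u G) : HasGradApprox n p U u G := by
  obtain ⟨φ, hφ, h1, h2⟩ := h
  exact hasGradApprox_of_seq hp (fun j ↦ (hφ j).1.of_le (by simp)) h1 h2

lemma HasGradD.hasGradApprox {p : ℝ} (hp : 1 < p) {Ω U : Set M} {u : M → ℝ}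
    {G : ∀ x : M, TangentSpace (𝓡 n) x} (h : HasGradD n p Ω u G) (hU : IsCompact (closure U))
    (hUΩ : closure U ⊆ Ω) : HasGradApprox n p U u G := by
  obtain ⟨φ, hφ, h1, h2⟩ := h
  exact hasGradApprox_of_seq hp (fun j ↦ ((hφ j).1.of_le (by simp)).contMDiffOn)
    ((h1 _ hU hUΩ).mono subset_closure) (h2.mono (subset_closure.trans hUΩ))

end Manifold

/-! ### Transfer between the manifold and its charts. -/

section Transfer

variable {n : ℕ} {M : Type*} [EMetricSpace M] [ChartedSpace (EuclideanSpace ℝ (Fin n)) M]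
  [IsManifold (𝓡 n) ∞ M]
  [RiemannianBundle (fun x : M ↦ TangentSpace (𝓡 n) x)]
  [IsContMDiffRiemannianBundle (𝓡 n) ∞ (EuclideanSpace ℝ (Fin n))
      (fun x : M ↦ TangentSpace (𝓡 n) x)]
  [MeasurableSpace M] [BorelSpace M]

lemma ae_chart_of_ae (x₀ : M) {U : Set M} (hU : MeasurableSet U) {P : M → Prop}
    (h : ∀ᵐ x ∂((riemVol n M).restrict U), P x) :
    ∀ᵐ z, z ∈ (chartAt (Euc n) x₀).target ∩ (chartAt (Euc n) x₀).symm ⁻¹' U →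
      P ((chartAt (Euc n) x₀).symm z) := by
  rw [ae_restrict_iff' hU] at h
  have h0 : riemVol n M ((chartAt (Euc n) x₀).source ∩ {x | ¬ (x ∈ U → P x)}) = 0 :=
    measure_mono_null inter_subset_right h
  rw [riemVol_null_iff x₀ inter_subset_left] at h0
  refine measure_mono_null (fun z hz ↦ ?_) h0
  simp only [mem_compl_iff, mem_ofPred_eq, Classical.not_imp] at hz
  obtain ⟨⟨hz1, hz2⟩, hz3⟩ := hz
  exact ⟨hz1, (chartAt (Euc n) x₀).map_target hz1, fun h ↦ hz3 (h hz2)⟩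

lemma ae_of_ae_chart (x₀ : M) {U : Set M} (hU : MeasurableSet U) {P : M → Prop}
    (h : ∀ᵐ z, z ∈ (chartAt (Euc n) x₀).target ∩ (chartAt (Euc n) x₀).symm ⁻¹' U →
      P ((chartAt (Euc n) x₀).symm z)) :
    ∀ᵐ x ∂((riemVol n M).restrict (U ∩ (chartAt (Euc n) x₀).source)), P x := by
  rw [ae_restrict_iff' (hU.inter (chartAt (Euc n) x₀).open_source.measurableSet)]
  have h0 : riemVol n M ((chartAt (Euc n) x₀).source ∩ {x | x ∈ U ∧ ¬ P x}) = 0 := by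
    rw [riemVol_null_iff x₀ inter_subset_left]
    refine measure_mono_null (fun z hz ↦ ?_) h
    simp only [mem_compl_iff, mem_ofPred_eq, Classical.not_imp]
    exact ⟨⟨hz.1, hz.2.2.1⟩, hz.2.2.2⟩
  refine measure_mono_null (fun x hx ↦ ?_) h0
  simp only [mem_compl_iff, mem_ofPred_eq, Classical.not_imp] at hx
  exact ⟨hx.1.2, hx.1.1, hx.2⟩

lemma ae_restrict_of_locally [SecondCountableTopology M] {μ : Measure M} {Ω : Set M}
    (hΩ : IsOpen Ω) {P : M → Prop}
    (h : ∀ x ∈ Ω, ∃ U, IsOpen U ∧ x ∈ U ∧ ∀ᵐ y ∂(μ.restrict U), P y) :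
    ∀ᵐ x ∂(μ.restrict Ω), P x := by
  rw [ae_restrict_iff' hΩ.measurableSet]
  have : μ {x | ¬ (x ∈ Ω → P x)} = 0 := by
    refine measure_null_of_locally_null _ fun x hx ↦ ?_
    simp only [mem_ofPred_eq, Classical.not_imp] at hx
    obtain ⟨U, hU, hxU, hP⟩ := h x hx.1
    rw [ae_restrict_iff' hU.measurableSet] at hP
    refine ⟨{x | ¬ (x ∈ Ω → P x)} ∩ U, inter_mem self_mem_nhdsWithin
      (mem_nhdsWithin_of_mem_nhds (hU.mem_nhds hxU)), measure_mono_null (fun y hy ↦ ?_) hP⟩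
    simp only [mem_inter_iff, mem_ofPred_eq, Classical.not_imp] at hy
    simp only [mem_compl_iff, mem_ofPred_eq, Classical.not_imp]
    exact ⟨hy.2, hy.1.2⟩
  exact this

/-- On a compact coordinate set, Lebesgue measure is dominated by a multiple of the volume, and L^p
convergence on a set of finite measure implies L¹ convergence. -/
lemma LpNull.tendsto_chart {p : ℝ} (hp : 1 < p) (x₀ : M) {U : Set M} (hU : MeasurableSet U)
    {F : ℕ → M → ℝ} (h : LpNull (riemVol n M) p U F) {K : Set (Euc n)} (hK : IsCompact K)
    (hKU : K ⊆ (chartAt (Euc n) x₀).target ∩ (chartAt (Euc n) x₀).symm ⁻¹' U) :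
    Tendsto (fun j ↦ ∫⁻ z in K, ‖F j ((chartAt (Euc n) x₀).symm z)‖ₑ) atTop (𝓝 0) := by
  have hKt := hKU.trans inter_subset_left
  have hKU' := hKU.trans inter_subset_right
  obtain ⟨C, hC, hle⟩ := exists_map_le_smul_riemVol x₀ hK hKt hU hKU'
  have hcm : AEMeasurable (chartAt (Euc n) x₀).symm (volume.restrict K) :=
    ((chartAt (Euc n) x₀).continuousOn_symm.mono hKt).aemeasurable hK.measurableSet
  have hac : (volume.restrict K).map (chartAt (Euc n) x₀).symm ≪ (riemVol n M).restrict U :=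
    (Measure.absolutelyContinuous_of_le hle).trans
      (Measure.AbsolutelyContinuous.rfl.smul_left _)
  have : IsFiniteMeasure (volume.restrict K) := ⟨by simpa using hK.measure_lt_top⟩
  refine tendsto_lintegral_of_rpow hp
    (fun j ↦ (((h.1 j).mono_ac hac).comp_aemeasurable hcm).enorm) ?_
  obtain ⟨D, hD, hle'⟩ := exists_setLIntegral_comp_symm_le x₀ hK hKt hU hKU'
  have h0 : Tendsto (fun j ↦ D * ∫⁻ x in U, ‖F j x‖ₑ ^ p ∂(riemVol n M)) atTop (𝓝 0) := by
    simpa using ENNReal.Tendsto.const_mul h.2 (Or.inr hD)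
  exact tendsto_of_tendsto_of_tendsto_of_le_of_le tendsto_const_nhds h0 (fun _ ↦ zero_le)
    fun j ↦ hle' (fun x ↦ ‖F j x‖ₑ ^ p) ((h.1 j).enorm.pow_const _)

/-- The partial derivatives of a function in a chart are the inner products of its gradient with the
frame. The frame vectors have bounded length on compact sets, so convergence of gradients gives
convergence of the partial derivatives. -/
lemma HasGradApprox.isC1Limit {p : ℝ} (hp : 1 < p) {U : Set M} (hU : IsOpen U) {u : M → ℝ}
    {G : ∀ x : M, TangentSpace (𝓡 n) x} (h : HasGradApprox n p U u G) (x₀ : M) (i : Fin n) :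
    IsC1Limit ((chartAt (Euc n) x₀).target ∩ (chartAt (Euc n) x₀).symm ⁻¹' U)
      (EuclideanSpace.single i 1) (u ∘ (chartAt (Euc n) x₀).symm)
      (fun z ↦ inner ℝ (G ((chartAt (Euc n) x₀).symm z))
        (frame n x₀ i ((chartAt (Euc n) x₀).symm z))) := by
  set c := chartAt (Euc n) x₀ with hc
  obtain ⟨φ, hφ, h1, h2, h3, h4⟩ := h
  have hder : ∀ j, ∀ z ∈ c.target ∩ c.symm ⁻¹' U,
      fderiv ℝ (φ j ∘ c.symm) z (EuclideanSpace.single i 1) -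
        inner ℝ (G (c.symm z)) (frame n x₀ i (c.symm z)) =
      inner ℝ (grad n (φ j) (c.symm z) - G (c.symm z)) (frame n x₀ i (c.symm z)) := by
    intro j z hz
    rw [fderiv_comp_symm x₀ hz.1 (((hφ j).contMDiffAt (hU.mem_nhds hz.2)).mdifferentiableAt
      (by simp)) i]
    exact (inner_sub_left _ _ _).symm
  refine ⟨fun j ↦ φ j ∘ c.symm, fun j ↦ by simpa using contDiffOn_comp_symm x₀ 1 (hφ j),
    fun K hKV hK ↦ h1.tendsto_chart hp x₀ hU.measurableSet hK hKV, fun K hKV hK ↦ ?_,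
    ae_chart_of_ae x₀ hU.measurableSet h3, ?_⟩
  · have hcont : ContinuousOn (fun z ↦ ‖frame n x₀ i (c.symm z)‖) K := by
      have h5 : ContinuousOn (fun x : M ↦ √ (inner ℝ (frame n x₀ i x) (frame n x₀ i x)))
        c.source := (continuousOn_gram x₀ i i).sqrt
      refine ((h5.comp c.continuousOn_symm fun z hz ↦ c.map_target hz).mono
        (hKV.trans inter_subset_left)).congr fun z _ ↦ ?_
      exact norm_eq_sqrt_real_inner _
    obtain ⟨B, hB⟩ := hK.exists_bound_of_continuousOn hcont
    have h0 : Tendsto (fun j ↦ ENNReal.ofReal B *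
        ∫⁻ z in K, ‖‖grad n (φ j) (c.symm z) - G (c.symm z)‖‖ₑ) atTop (𝓝 0) := by
      simpa using ENNReal.Tendsto.const_mul (h2.tendsto_chart hp x₀ hU.measurableSet hK hKV)
        (Or.inr ENNReal.ofReal_ne_top)
    refine tendsto_of_tendsto_of_tendsto_of_le_of_le tendsto_const_nhds h0 (fun _ ↦ zero_le)
      fun j ↦ ?_
    rw [← lintegral_const_mul' _ _ ENNReal.ofReal_ne_top]
    refine setLIntegral_mono' hK.measurableSet fun z hz ↦ ?_
    rw [hder j z (hKV hz), Real.enorm_eq_ofReal_abs, enorm_norm, ← ofReal_norm,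
      ← ENNReal.ofReal_mul' (norm_nonneg _)]
    refine ENNReal.ofReal_le_ofReal ((abs_real_inner_le_norm _ _).trans ?_)
    rw [mul_comm]
    have := hB z hz
    rw [norm_norm] at this
    gcongr
  · filter_upwards [ae_chart_of_ae x₀ hU.measurableSet h4] with z hz hzV
    rw [tendsto_iff_norm_sub_tendsto_zero]
    have h5 := (hz hzV).mul_const ‖frame n x₀ i (c.symm z)‖
    rw [zero_mul] at h5
    refine squeeze_zero (fun _ ↦ norm_nonneg _) (fun j ↦ ?_) h5
    rw [hder j z hzV]
    exact abs_real_inner_le_norm _ _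

end Transfer

/-! ### Regularized powers with bounded continuous derivative. -/

section RpowChain

/-- Together with `hasDerivAt_rpow_abs_rpow_add_one` this serves the chain rule for u^a: for u ≥ 0
and v = u^a, the functions (u² + 1)^{a/2} and (|v|^{2/a} + 1)^{a/2} coincide. Unlike t^a, both outer
functions are C¹ on the line with derivatives bounded by 1. -/
lemma hasDerivAt_rpow_sq_add_one (a t : ℝ) :
    HasDerivAt (fun t : ℝ ↦ (t ^ 2 + 1) ^ (a / 2)) (a * t * (t ^ 2 + 1) ^ (a / 2 - 1)) t := by
  have h0 : t ^ 2 + 1 ≠ 0 := by positivity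
  have := ((hasDerivAt_pow 2 t).add_const 1).rpow_const (p := a / 2) (Or.inl h0)
  refine this.congr_deriv ?_
  push_cast
  ring

lemma abs_deriv_rpow_sq_add_one_le {a : ℝ} (ha0 : 0 < a) (ha1 : a < 1) (t : ℝ) :
    |a * t * (t ^ 2 + 1) ^ (a / 2 - 1)| ≤ 1 := by
  have h0 : 0 < t ^ 2 + 1 := by positivity
  rw [abs_mul, abs_mul, abs_of_pos ha0, abs_of_nonneg (Real.rpow_nonneg h0.le _)]
  have h1 : |t| ≤ (t ^ 2 + 1) ^ (1 / 2 : ℝ) := by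
    rw [← Real.sqrt_eq_rpow]
    exact Real.abs_le_sqrt (by linarith)
  have h2 : (t ^ 2 + 1) ^ (1 / 2 : ℝ) * (t ^ 2 + 1) ^ (a / 2 - 1) ≤ 1 := by
    rw [← Real.rpow_add h0]
    exact Real.rpow_le_one_of_one_le_of_nonpos (by nlinarith [sq_nonneg t]) (by linarith)
  calc a * |t| * (t ^ 2 + 1) ^ (a / 2 - 1)
      ≤ 1 * (t ^ 2 + 1) ^ (1 / 2 : ℝ) * (t ^ 2 + 1) ^ (a / 2 - 1) := by gcongr
    _ ≤ 1 := by rwa [one_mul]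

lemma hasDerivAt_rpow_abs_rpow_add_one {a : ℝ} (ha0 : 0 < a) (ha1 : a < 1) (s : ℝ) :
    HasDerivAt (fun s : ℝ ↦ (|s| ^ (2 / a) + 1) ^ (a / 2))
      ((|s| ^ (2 / a) + 1) ^ (a / 2 - 1) * (|s| ^ (2 / a - 2) * s)) s := by
  have hb : 1 < 2 / a := by
    rw [one_lt_div ha0]
    linarith
  have h0 : |s| ^ (2 / a) + 1 ≠ 0 := by positivity
  have := ((hasDerivAt_abs_rpow s hb).add_const 1).rpow_const (p := a / 2) (Or.inl h0)
  refine this.congr_deriv ?_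
  field_simp

lemma continuous_deriv_rpow_abs_rpow_add_one {a : ℝ} (ha0 : 0 < a) (ha1 : a < 1) :
    Continuous (fun s : ℝ ↦ (|s| ^ (2 / a) + 1) ^ (a / 2 - 1) * (|s| ^ (2 / a - 2) * s)) := by
  have hb : 2 ≤ 2 / a := by
    rw [le_div_iff₀ ha0]
    linarith
  refine Continuous.mul (Continuous.rpow_const ?_ fun s ↦ Or.inl (by positivity))
    ((continuous_abs.rpow_const fun s ↦ Or.inr (by linarith)).mul continuous_id)
  exact (continuous_abs.rpow_const fun s ↦ Or.inr (by linarith)).add continuous_const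

lemma abs_deriv_rpow_abs_rpow_add_one_le {a : ℝ} (ha0 : 0 < a) (ha1 : a < 1) (s : ℝ) :
    |(|s| ^ (2 / a) + 1) ^ (a / 2 - 1) * (|s| ^ (2 / a - 2) * s)| ≤ 1 := by
  have hb : 2 < 2 / a := by
    rw [lt_div_iff₀ ha0]
    linarith
  rcases eq_or_ne s 0 with rfl | hs
  · simp
  have hs' : 0 < |s| := abs_pos.2 hs
  have h0 : 0 < |s| ^ (2 / a) + 1 := by positivity
  have h1 : |s| ^ (2 / a - 2) * |s| = (|s| ^ (2 / a)) ^ (1 - a / 2) := by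
    rw [← Real.rpow_mul hs'.le]
    nth_rewrite 2 [← Real.rpow_one |s|]
    rw [← Real.rpow_add hs']
    congr 1
    field_simp
    ring
  rw [abs_mul, abs_mul, abs_of_nonneg (Real.rpow_nonneg h0.le _),
    abs_of_nonneg (Real.rpow_nonneg hs'.le _), h1]
  calc (|s| ^ (2 / a) + 1) ^ (a / 2 - 1) * (|s| ^ (2 / a)) ^ (1 - a / 2)
      ≤ (|s| ^ (2 / a) + 1) ^ (a / 2 - 1) * (|s| ^ (2 / a) + 1) ^ (1 - a / 2) := by
        gcongr
        · linarith
        · linarith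
    _ = 1 := by
        rw [← Real.rpow_add h0]
        simp

end RpowChain

/-! ### Vanishing on level sets and the gradient of a power. -/

section GradientCalculus

variable {n : ℕ} {M : Type*} [EMetricSpace M] [ChartedSpace (EuclideanSpace ℝ (Fin n)) M]
  [IsManifold (𝓡 n) ∞ M]
  [RiemannianBundle (fun x : M ↦ TangentSpace (𝓡 n) x)]
  [IsContMDiffRiemannianBundle (𝓡 n) ∞ (EuclideanSpace ℝ (Fin n))
      (fun x : M ↦ TangentSpace (𝓡 n) x)]
  [MeasurableSpace M] [BorelSpace M] [SecondCountableTopology M]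

/-- The gradient vanishes almost everywhere on the zero set of the function. -/
lemma HasGradApprox.ae_eq_zero {p : ℝ} (hp : 1 < p) {U : Set M} (hU : IsOpen U) {u : M → ℝ}
    {G : ∀ x : M, TangentSpace (𝓡 n) x} (h : HasGradApprox n p U u G) :
    ∀ᵐ x ∂((riemVol n M).restrict U), u x = 0 → G x = 0 := by
  refine ae_restrict_of_locally hU fun x₀ hx₀ ↦ ⟨U ∩ (chartAt (Euc n) x₀).source,
    hU.inter (chartAt (Euc n) x₀).open_source, ⟨hx₀, mem_chart_source _ x₀⟩, ?_⟩
  have h1 : ∀ᵐ x ∂((riemVol n M).restrict (U ∩ (chartAt (Euc n) x₀).source)),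
      ∀ i, u x = 0 → inner ℝ (G x) (frame n x₀ i x) = 0 := by
    refine ae_all_iff.2 fun i ↦ ae_of_ae_chart x₀ hU.measurableSet ?_
    exact (h.isC1Limit hp hU x₀ i).ae_eq_zero ((chartAt (Euc n) x₀).isOpen_inter_preimage_symm hU)
  filter_upwards [h1, ae_restrict_mem
    (hU.inter (chartAt (Euc n) x₀).open_source).measurableSet] with x hx hxm hux
  exact eq_zero_of_inner_frame x₀ hxm.2 fun i ↦ hx i hux

/-- Gradients of compositions that agree almost everywhere agree almost everywhere. -/
lemma HasGradApprox.comp_unique {p : ℝ} (hp : 1 < p) {U : Set M} (hU : IsOpen U) {u v : M → ℝ}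
    {G H : ∀ x : M, TangentSpace (𝓡 n) x} (h : HasGradApprox n p U u G)
    (h' : HasGradApprox n p U v H) {F F' : ℝ → ℝ} (hF : ∀ t, HasDerivAt F (F' t) t)
    (hF' : Continuous F') {C : ℝ} (hC : ∀ t, |F' t| ≤ C) {Q Q' : ℝ → ℝ}
    (hQ : ∀ t, HasDerivAt Q (Q' t) t) (hQ' : Continuous Q') {D : ℝ} (hD : ∀ t, |Q' t| ≤ D)
    (heq : ∀ᵐ x ∂((riemVol n M).restrict U), F (u x) = Q (v x)) :
    ∀ᵐ x ∂((riemVol n M).restrict U), F' (u x) • G x = Q' (v x) • H x := by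
  refine ae_restrict_of_locally hU fun x₀ hx₀ ↦ ⟨U ∩ (chartAt (Euc n) x₀).source,
    hU.inter (chartAt (Euc n) x₀).open_source, ⟨hx₀, mem_chart_source _ x₀⟩, ?_⟩
  have h1 : ∀ᵐ x ∂((riemVol n M).restrict (U ∩ (chartAt (Euc n) x₀).source)),
      ∀ i, F' (u x) * inner ℝ (G x) (frame n x₀ i x) =
        Q' (v x) * inner ℝ (H x) (frame n x₀ i x) := by
    refine ae_all_iff.2 fun i ↦ ae_of_ae_chart x₀ hU.measurableSet ?_
    exact (h.isC1Limit hp hU x₀ i).comp_unique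
      ((chartAt (Euc n) x₀).isOpen_inter_preimage_symm hU) (h'.isC1Limit hp hU x₀ i) hF hF' hC
      hQ hQ' hD (ae_chart_of_ae x₀ hU.measurableSet heq)
  filter_upwards [h1, ae_restrict_mem
    (hU.inter (chartAt (Euc n) x₀).open_source).measurableSet] with x hx hxm
  refine sub_eq_zero.1 (eq_zero_of_inner_frame x₀ hxm.2 fun i ↦ ?_)
  rw [inner_sub_left, real_inner_smul_left, real_inner_smul_left, hx i, sub_self]

/-- The gradient of a power `u ^ a`, `0 < a < 1`, of a nonnegative function. -/
lemma HasGradApprox.norm_rpow {p : ℝ} (hp : 1 < p) {U : Set M} (hU : IsOpen U) {u : M → ℝ} {a : ℝ}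
    (ha0 : 0 < a) (ha1 : a < 1) {G H : ∀ x : M, TangentSpace (𝓡 n) x}
    (h : HasGradApprox n p U u G) (h' : HasGradApprox n p U (fun x ↦ u x ^ a) H)
    (hu : ∀ᵐ x ∂((riemVol n M).restrict U), 0 ≤ u x) :
    ∀ᵐ x ∂((riemVol n M).restrict U),
      (u x = 0 → G x = 0 ∧ H x = 0) ∧ (0 < u x → ‖H x‖ = a * u x ^ (a - 1) * ‖G x‖) := by
  -- Two smooth enough compositions that agree a.e., one in u and one in v = u^a. Comparing their
  -- gradients gives a u ∇u = u^{2-a} ∇v after cancelling the positive factor (u² + 1)^{a/2 - 1},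
  -- which determines |∇v| where u > 0.
  have h1 : ∀ᵐ x ∂((riemVol n M).restrict U), (u x ^ 2 + 1) ^ (a / 2) =
      (|u x ^ a| ^ (2 / a) + 1) ^ (a / 2) := by
    filter_upwards [hu] with x hx
    rw [abs_of_nonneg (Real.rpow_nonneg hx _), ← Real.rpow_mul hx, mul_div_cancel₀ _ ha0.ne']
    norm_num
  have h2 := h.comp_unique hp hU h' (hasDerivAt_rpow_sq_add_one a)
    (by
      refine Continuous.mul (by fun_prop) (Continuous.rpow_const (by fun_prop) fun t ↦ ?_)
      exact Or.inl (by positivity))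
    (abs_deriv_rpow_sq_add_one_le ha0 ha1) (hasDerivAt_rpow_abs_rpow_add_one ha0 ha1)
    (continuous_deriv_rpow_abs_rpow_add_one ha0 ha1)
    (abs_deriv_rpow_abs_rpow_add_one_le ha0 ha1) h1
  filter_upwards [h2, h.ae_eq_zero hp hU, h'.ae_eq_zero hp hU] with x hx hG hH
  refine ⟨fun h0 ↦ ⟨hG h0, hH (by rw [h0, Real.zero_rpow ha0.ne'])⟩, fun hpos ↦ ?_⟩
  have hv : 0 < u x ^ a := Real.rpow_pos_of_pos hpos a
  have e1 : |u x ^ a| ^ (2 / a) = u x ^ 2 := by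
    rw [abs_of_pos hv, ← Real.rpow_mul hpos.le, mul_div_cancel₀ _ ha0.ne']
    norm_num
  have e2 : |u x ^ a| ^ (2 / a - 2) * u x ^ a = u x ^ (2 - a) := by
    rw [abs_of_pos hv, ← Real.rpow_mul hpos.le, ← Real.rpow_add hpos]
    congr 1
    field_simp
    ring
  rw [e1, e2] at hx
  have hn := congrArg norm hx
  have hw : 0 < (u x ^ 2 + 1) ^ (a / 2 - 1) := by positivity
  rw [norm_smul, norm_smul, Real.norm_of_nonneg (by positivity),
    Real.norm_of_nonneg (by positivity)] at hn
  have hn' : a * u x * ‖G x‖ = u x ^ (2 - a) * ‖H x‖ := by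
    refine mul_left_cancel₀ hw.ne' ?_
    linarith
  have e3 : u x ^ (2 - a) * u x ^ (a - 1) = u x := by
    rw [← Real.rpow_add hpos]
    norm_num
  refine mul_left_cancel₀ (Real.rpow_pos_of_pos hpos (2 - a)).ne' ?_
  rw [← hn']
  calc a * u x * ‖G x‖ = a * (u x ^ (2 - a) * u x ^ (a - 1)) * ‖G x‖ := by rw [e3]
    _ = _ := by ring

end GradientCalculus

/-! ### Measurability and finiteness of energies; pointwise rules for gradients. -/

section Measurability

variable {n : ℕ} {M : Type*} [EMetricSpace M] [ChartedSpace (EuclideanSpace ℝ (Fin n)) M]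
  [IsManifold (𝓡 n) ∞ M]
  [RiemannianBundle (fun x : M ↦ TangentSpace (𝓡 n) x)]
  [IsContMDiffRiemannianBundle (𝓡 n) ∞ (EuclideanSpace ℝ (Fin n))
      (fun x : M ↦ TangentSpace (𝓡 n) x)]
  [MeasurableSpace M] [BorelSpace M]

lemma continuousOn_norm_grad {U : Set M} (hU : IsOpen U) {φ : M → ℝ}
    (hφ : ContMDiffOn (𝓡 n) 𝓘(ℝ, ℝ) 1 φ U) : ContinuousOn (fun x ↦ ‖grad n φ x‖) U :=
  (continuousOn_inner_grad hU hφ hφ).sqrt.congr fun x _ ↦ norm_eq_sqrt_real_inner (grad n φ x)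

lemma aemeasurable_norm_of_tendsto {U : Set M} (hU : IsOpen U) {φ : ℕ → M → ℝ}
    {G : ∀ x : M, TangentSpace (𝓡 n) x} (hφ : ∀ j, ContMDiffOn (𝓡 n) 𝓘(ℝ, ℝ) 1 (φ j) U)
    (h : ∀ᵐ x ∂((riemVol n M).restrict U),
      Tendsto (fun j ↦ ‖grad n (φ j) x - G x‖) atTop (𝓝 0)) :
    AEMeasurable (fun x ↦ ‖G x‖) ((riemVol n M).restrict U) := by
  refine aemeasurable_of_tendsto_metrizable_ae atTop
    (fun j ↦ (continuousOn_norm_grad hU (hφ j)).aemeasurable hU.measurableSet) ?_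
  filter_upwards [h] with x hx
  rw [tendsto_iff_norm_sub_tendsto_zero]
  exact squeeze_zero (fun _ ↦ norm_nonneg _)
    (fun j ↦ abs_norm_sub_norm_le (grad n (φ j) x) (G x)) hx

lemma aemeasurable_inner_grad_of_tendsto {U : Set M} (hU : IsOpen U) {φ : ℕ → M → ℝ}
    {G : ∀ x : M, TangentSpace (𝓡 n) x} (hφ : ∀ j, ContMDiffOn (𝓡 n) 𝓘(ℝ, ℝ) 1 (φ j) U)
    (h : ∀ᵐ x ∂((riemVol n M).restrict U),
      Tendsto (fun j ↦ ‖grad n (φ j) x - G x‖) atTop (𝓝 0)) {ψ : M → ℝ}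
    (hψ : ContMDiffOn (𝓡 n) 𝓘(ℝ, ℝ) 1 ψ U) :
    AEMeasurable (fun x ↦ inner ℝ (G x) (grad n ψ x)) ((riemVol n M).restrict U) := by
  refine aemeasurable_of_tendsto_metrizable_ae atTop
    (fun j ↦ (continuousOn_inner_grad hU (hφ j) hψ).aemeasurable hU.measurableSet) ?_
  filter_upwards [h] with x hx
  rw [tendsto_iff_norm_sub_tendsto_zero]
  have h0 := hx.mul_const ‖grad n ψ x‖
  rw [zero_mul] at h0
  refine squeeze_zero (fun _ ↦ norm_nonneg _) (fun j ↦ ?_) h0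
  rw [← inner_sub_left]
  exact abs_real_inner_le_norm _ _

lemma enorm_rpow_le_add {V : Type*} [NormedAddCommGroup V] {p : ℝ} (hp : 1 ≤ p) (a b : V) :
    ‖a‖ₑ ^ p ≤ 2 ^ (p - 1) * (‖‖b - a‖‖ₑ ^ p + ‖b‖ₑ ^ p) := by
  have h1 : ‖a‖ₑ ≤ ‖‖b - a‖‖ₑ + ‖b‖ₑ := by
    rw [enorm_norm]
    calc ‖a‖ₑ = ‖-(b - a) + b‖ₑ := by simp
      _ ≤ ‖-(b - a)‖ₑ + ‖b‖ₑ := enorm_add_le _ _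
      _ = _ := by rw [enorm_neg]
  calc ‖a‖ₑ ^ p ≤ (‖‖b - a‖‖ₑ + ‖b‖ₑ) ^ p := by gcongr
    _ ≤ _ := ENNReal.rpow_add_le_mul_rpow_add_rpow _ _ hp

/-- An `L^p`-limit of gradients of finite energy has finite energy. -/
lemma LpNull.setLIntegral_lt_top {p : ℝ} (hp : 1 < p) {U : Set M} {φ : ℕ → M → ℝ}
    {G : ∀ x : M, TangentSpace (𝓡 n) x}
    (h : LpNull (riemVol n M) p U (fun j x ↦ ‖grad n (φ j) x - G x‖))
    (hφ : ∀ j, ∫⁻ x in U, ‖grad n (φ j) x‖ₑ ^ p ∂(riemVol n M) < ⊤) :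
    ∫⁻ x in U, ‖G x‖ₑ ^ p ∂(riemVol n M) < ⊤ := by
  obtain ⟨j, hj⟩ := (h.2.eventually (gt_mem_nhds (show (0 : ℝ≥0∞) < ⊤ by simp))).exists
  have h2 : (2 : ℝ≥0∞) ^ (p - 1) ≠ ⊤ :=
    ENNReal.rpow_ne_top_of_nonneg (by linarith) ENNReal.ofNat_ne_top
  calc ∫⁻ x in U, ‖G x‖ₑ ^ p ∂(riemVol n M)
      ≤ ∫⁻ x in U, 2 ^ (p - 1) * (‖‖grad n (φ j) x - G x‖‖ₑ ^ p + ‖grad n (φ j) x‖ₑ ^ p)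
          ∂(riemVol n M) := lintegral_mono fun x ↦ enorm_rpow_le_add hp.le _ _
    _ = 2 ^ (p - 1) * ((∫⁻ x in U, ‖‖grad n (φ j) x - G x‖‖ₑ ^ p ∂(riemVol n M)) +
          ∫⁻ x in U, ‖grad n (φ j) x‖ₑ ^ p ∂(riemVol n M)) := by
        rw [lintegral_const_mul' _ _ h2, lintegral_add_left' ((h.1 j).enorm.pow_const _)]
    _ < ⊤ := ENNReal.mul_lt_top h2.lt_top (ENNReal.add_lt_top.2 ⟨hj, hφ j⟩)

lemma HasGradW.setLIntegral_lt_top {p : ℝ} (hp : 1 < p) {U : Set M} {u : M → ℝ}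
    {G : ∀ x : M, TangentSpace (𝓡 n) x} (h : HasGradW n p U u G) :
    ∫⁻ x in U, ‖G x‖ₑ ^ p ∂(riemVol n M) < ⊤ := by
  obtain ⟨φ, hφ, -, h2⟩ := h
  exact h2.setLIntegral_lt_top hp fun j ↦ (hφ j).2.2

lemma grad_eq_zero_of_notMem_tsupport {φ : M → ℝ} {x : M} (hx : x ∉ tsupport φ) :
    grad n φ x = 0 := by
  have h1 : φ =ᶠ[𝓝 x] fun _ ↦ 0 := notMem_tsupport_iff_eventuallyEq.1 hx
  have h2 : mfderiv (𝓡 n) 𝓘(ℝ, ℝ) φ x = 0 := by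
    have h3 := h1.mfderiv_eq (I := 𝓡 n) (I' := 𝓘(ℝ, ℝ))
    have h4 := (hasMFDerivAt_const (I := 𝓡 n) (I' := 𝓘(ℝ, ℝ)) (0 : ℝ) x).mfderiv
    exact h3.trans h4
  have h5 : ∀ v : TangentSpace (𝓡 n) x, inner ℝ (grad n φ x) v = 0 := fun v ↦ by
    rw [inner_grad, h2]
    rfl
  exact inner_self_eq_zero (𝕜 := ℝ).1 (h5 _)

lemma IsTest.setLIntegral_lt_top {p : ℝ} (hp : 1 < p) {k : ℕ∞} (hk : 1 ≤ k) {Ω : Set M}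
    {φ : M → ℝ} (h : IsTest n k Ω φ) (U : Set M) :
    ∫⁻ x in U, ‖grad n φ x‖ₑ ^ p ∂(riemVol n M) < ⊤ := by
  obtain ⟨hφ, hc, -⟩ := h
  have hK : IsCompact (tsupport φ) := hc
  have hcont : Continuous (fun x ↦ ‖grad n φ x‖) := by
    rw [← continuousOn_univ]
    exact continuousOn_norm_grad isOpen_univ (hφ.of_le (by exact_mod_cast hk)).contMDiffOn
  obtain ⟨C, hC⟩ := hK.exists_bound_of_continuousOn hcont.continuousOn
  calc ∫⁻ x in U, ‖grad n φ x‖ₑ ^ p ∂(riemVol n M)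
      ≤ ∫⁻ x, ‖grad n φ x‖ₑ ^ p ∂(riemVol n M) := setLIntegral_le_lintegral _ _
    _ ≤ ∫⁻ x, (tsupport φ).indicator (fun _ ↦ ENNReal.ofReal C ^ p) x ∂(riemVol n M) := by
        refine lintegral_mono fun x ↦ ?_
        by_cases hx : x ∈ tsupport φ
        · rw [indicator_of_mem hx]
          have := hC x hx
          rw [norm_norm] at this
          rw [← ofReal_norm]
          gcongr
        · rw [indicator_of_notMem hx, grad_eq_zero_of_notMem_tsupport hx]
          simp [show 0 < p by linarith]
    _ < ⊤ := by
        rw [lintegral_indicator hK.measurableSet, setLIntegral_const]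
        exact ENNReal.mul_lt_top (ENNReal.rpow_lt_top_of_nonneg (by linarith) (by simp))
          hK.measure_lt_top

end Measurability

section ChainRules

variable {n : ℕ} {M : Type*} [EMetricSpace M] [ChartedSpace (EuclideanSpace ℝ (Fin n)) M]
  [IsManifold (𝓡 n) ∞ M]
  [RiemannianBundle (fun x : M ↦ TangentSpace (𝓡 n) x)]
  [IsContMDiffRiemannianBundle (𝓡 n) ∞ (EuclideanSpace ℝ (Fin n))
      (fun x : M ↦ TangentSpace (𝓡 n) x)]

lemma hasMFDerivAt_comp_real {φ : M → ℝ} {x : M} {F : ℝ → ℝ} {d : ℝ}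
    (hφ : MDifferentiableAt (𝓡 n) 𝓘(ℝ, ℝ) φ x) (hF : HasDerivAt F d (φ x)) :
    HasMFDerivAt (𝓡 n) 𝓘(ℝ, ℝ) (F ∘ φ) x
      (d • (mfderiv (𝓡 n) 𝓘(ℝ, ℝ) φ x : TangentSpace (𝓡 n) x →L[ℝ] ℝ)) := by
  have h := hF.hasFDerivAt.hasMFDerivAt.comp x hφ.hasMFDerivAt
  refine h.congr_mfderiv ?_
  ext v
  have key : ∀ a : ℝ, a • d = d • a := fun a ↦ mul_comm a d
  exact key (mfderiv (𝓡 n) 𝓘(ℝ, ℝ) φ x v)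

lemma inner_grad_comp {φ : M → ℝ} {x : M} {F : ℝ → ℝ} {d : ℝ}
    (hφ : MDifferentiableAt (𝓡 n) 𝓘(ℝ, ℝ) φ x) (hF : HasDerivAt F d (φ x))
    (X : TangentSpace (𝓡 n) x) :
    inner ℝ X (grad n (F ∘ φ) x) = d * inner ℝ X (grad n φ x) := by
  rw [real_inner_comm, real_inner_comm (grad n φ x), inner_grad, inner_grad,
    (hasMFDerivAt_comp_real hφ hF).mfderiv]
  rfl

lemma inner_grad_mul {φ ψ : M → ℝ} {x : M}
    (hφ : MDifferentiableAt (𝓡 n) 𝓘(ℝ, ℝ) φ x) (hψ : MDifferentiableAt (𝓡 n) 𝓘(ℝ, ℝ) ψ x)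
    (X : TangentSpace (𝓡 n) x) :
    inner ℝ X (grad n (φ * ψ) x) =
      φ x * inner ℝ X (grad n ψ x) + ψ x * inner ℝ X (grad n φ x) := by
  rw [real_inner_comm, real_inner_comm (grad n φ x), real_inner_comm (grad n ψ x), inner_grad,
    inner_grad, inner_grad, (hφ.hasMFDerivAt.mul hψ.hasMFDerivAt).mfderiv]
  rfl

/-- Outside U the product vanishes in a neighbourhood of each point, so smoothness of φ on U
suffices. -/
lemma contMDiff_mul_of_tsupport {U : Set M} (hU : IsOpen U) {w φ : M → ℝ}
    (hw : ContMDiff (𝓡 n) 𝓘(ℝ, ℝ) 1 w) (hwU : tsupport w ⊆ U)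
    (hφ : ContMDiffOn (𝓡 n) 𝓘(ℝ, ℝ) 1 φ U) : ContMDiff (𝓡 n) 𝓘(ℝ, ℝ) 1 (w * φ) := by
  intro x
  by_cases hx : x ∈ U
  · exact (hw x).mul (hφ.contMDiffAt (hU.mem_nhds hx))
  · have h1 : w =ᶠ[𝓝 x] 0 := notMem_tsupport_iff_eventuallyEq.1 fun h ↦ hx (hwU h)
    have h2 : w * φ =ᶠ[𝓝 x] fun _ ↦ (0 : ℝ) := by
      filter_upwards [h1] with y hy
      simp [hy]
    exact contMDiffAt_const.congr_of_eventuallyEq h2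

end ChainRules

/-! ### Superharmonicity tested with compositions. -/

section TestInequality

variable {n : ℕ} {M : Type*} [EMetricSpace M] [ChartedSpace (EuclideanSpace ℝ (Fin n)) M]
  [IsManifold (𝓡 n) ∞ M]
  [RiemannianBundle (fun x : M ↦ TangentSpace (𝓡 n) x)]
  [IsContMDiffRiemannianBundle (𝓡 n) ∞ (EuclideanSpace ℝ (Fin n))
      (fun x : M ↦ TangentSpace (𝓡 n) x)]
  [MeasurableSpace M] [BorelSpace M]

/-- The exponent p - 2 may be negative. At X = 0 the inner product vanishes, so the conventional
value of the power is harmless. -/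
lemma norm_rpow_mul_inner_self {V : Type*} [NormedAddCommGroup V] [InnerProductSpace ℝ V]
    {p : ℝ} (hp : 1 < p) (X : V) : ‖X‖ ^ (p - 2) * inner ℝ X X = ‖X‖ ^ p := by
  rcases eq_or_ne X 0 with rfl | hX
  · simp [Real.zero_rpow (show p ≠ 0 by linarith)]
  · rw [real_inner_self_eq_norm_sq, ← Real.rpow_natCast, ← Real.rpow_add (norm_pos_iff.2 hX)]
    norm_num

lemma norm_rpow_mul_inner_le {V : Type*} [NormedAddCommGroup V] [InnerProductSpace ℝ V]
    (p : ℝ) (X Y : V) : |‖X‖ ^ (p - 2) * inner ℝ X Y| ≤ ‖X‖ ^ (p - 1) * ‖Y‖ := by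
  rcases eq_or_ne X 0 with rfl | hX
  · simp only [inner_zero_left, mul_zero, abs_zero]
    positivity
  · rw [abs_mul, abs_of_nonneg (by positivity)]
    calc ‖X‖ ^ (p - 2) * |inner ℝ X Y| ≤ ‖X‖ ^ (p - 2) * (‖X‖ * ‖Y‖) := by
          gcongr
          exact abs_real_inner_le_norm _ _
      _ = ‖X‖ ^ (p - 1) * ‖Y‖ := by
          rw [← mul_assoc]
          congr 1
          nth_rewrite 2 [← Real.rpow_one ‖X‖]
          rw [← Real.rpow_add (norm_pos_iff.2 hX)]
          congr 1
          ring

/-- The weak inequality `-Δ_p ρ ≥ 0` tested with `w F(ρ)`. -/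
lemma IsPSuperharmonic.integral_nonneg {p : ℝ} (hp : 1 < p) {Ω U : Set M} (hΩ : IsOpen Ω)
    (hU : IsOpen U) (hUΩ : U ⊆ Ω) {ρ : M → ℝ} {G : ∀ x : M, TangentSpace (𝓡 n) x}
    (hG : HasGradApprox n p U ρ G) (hGp : ∫⁻ x in U, ‖G x‖ₑ ^ p ∂(riemVol n M) < ⊤)
    (hsuper : IsPSuperharmonic n p Ω G) {F F' : ℝ → ℝ} (hF : ∀ t, HasDerivAt F (F' t) t)
    (hF' : Continuous F') {B C : ℝ} (hF0 : ∀ t, 0 ≤ F t) (hB : ∀ t, |F t| ≤ B)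
    (hC : ∀ t, |F' t| ≤ C) {w : M → ℝ} (hw : ContMDiff (𝓡 n) 𝓘(ℝ, ℝ) 1 w) (hw0 : ∀ x, 0 ≤ w x)
    (hwc : HasCompactSupport w) (hwU : tsupport w ⊆ U) :
    Integrable (fun x ↦ ‖G x‖ ^ p) ((riemVol n M).restrict U) ∧
    AEMeasurable ρ ((riemVol n M).restrict U) ∧
    Integrable (fun x ↦ F (ρ x) * (‖G x‖ ^ (p - 2) * inner ℝ (G x) (grad n w x)))
      ((riemVol n M).restrict U) ∧
    Integrable (fun x ↦ w x * F' (ρ x) * ‖G x‖ ^ p) ((riemVol n M).restrict U) ∧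
    0 ≤ ∫ x in U, (F (ρ x) * (‖G x‖ ^ (p - 2) * inner ℝ (G x) (grad n w x)) +
      w x * F' (ρ x) * ‖G x‖ ^ p) ∂(riemVol n M) := by
  set μ := (riemVol n M).restrict U with hμ
  obtain ⟨r, hr, h1, h2, h3, h4⟩ := hG
  have hp0 : 0 < p := by linarith
  have hUm := hU.measurableSet
  have hK : IsCompact (tsupport w) := hwc
  have hFc : Continuous F := continuous_iff_continuousAt.2 fun t ↦ (hF t).continuousAt
  have hF1 : ContDiff ℝ 1 F := by
    have hd : deriv F = F' := funext fun t ↦ (hF t).deriv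
    exact contDiff_one_iff_deriv.2 ⟨fun t ↦ (hF t).differentiableAt, by rwa [hd]⟩
  have hGn : AEMeasurable (fun x ↦ ‖G x‖) μ := aemeasurable_norm_of_tendsto hU hr h4
  have hrm : ∀ j, AEMeasurable (r j) μ := fun j ↦ (hr j).continuousOn.aemeasurable hUm
  have hρm : AEMeasurable ρ μ := aemeasurable_of_tendsto_metrizable_ae atTop hrm h3
  have hA : Integrable (fun x ↦ ‖G x‖ ^ p) μ := by
    refine ⟨(hGn.pow_const p).aestronglyMeasurable, ?_⟩
    refine lt_of_le_of_lt (lintegral_mono fun x ↦ ?_) hGp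
    rw [Real.enorm_of_nonneg (by positivity), ← ofReal_norm,
      ENNReal.ofReal_rpow_of_nonneg (norm_nonneg _) hp0.le]
  obtain ⟨W, hW⟩ := hK.exists_bound_of_continuousOn hw.continuous.continuousOn
  have hW' : ∀ x, |w x| ≤ |W| := fun x ↦ by
    by_cases hx : x ∈ tsupport w
    · exact (hW x hx).trans (le_abs_self _)
    · rw [image_eq_zero_of_notMem_tsupport hx, abs_zero]
      exact abs_nonneg _
  have hwtest : IsTest n 1 Ω w := ⟨hw, hwc, hwU.trans hUΩ⟩
  have hgw := hwtest.setLIntegral_lt_top hp le_rfl U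
  -- the linear term is integrable
  have hgwm : AEMeasurable (fun x ↦ ‖grad n w x‖) μ :=
    (continuousOn_norm_grad hU hw.contMDiffOn).aemeasurable hUm
  have hBi : Integrable (fun x ↦ ‖G x‖ ^ (p - 2) * inner ℝ (G x) (grad n w x)) μ := by
    refine ⟨((hGn.pow_const _).mul
      (aemeasurable_inner_grad_of_tendsto hU hr h4 hw.contMDiffOn)).aestronglyMeasurable, ?_⟩
    calc ∫⁻ x, ‖‖G x‖ ^ (p - 2) * inner ℝ (G x) (grad n w x)‖ₑ ∂μ
        ≤ ∫⁻ x, ‖G x‖ₑ ^ (p - 1) * ‖grad n w x‖ₑ ∂μ := by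
          refine lintegral_mono fun x ↦ ?_
          rw [Real.enorm_eq_ofReal_abs, ← ofReal_norm, ← ofReal_norm,
            ENNReal.ofReal_rpow_of_nonneg (norm_nonneg _) (by linarith),
            ← ENNReal.ofReal_mul (by positivity)]
          exact ENNReal.ofReal_le_ofReal (norm_rpow_mul_inner_le p _ _)
      _ ≤ _ := ENNReal.lintegral_mul_le_Lp_mul_Lq μ
          (Real.HolderConjugate.conjExponent hp).symm
          ((by simpa using hGn.enorm : AEMeasurable (fun x ↦ ‖G x‖ₑ) μ).pow_const _)
          (by simpa using hgwm.enorm)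
      _ < ⊤ := by
          have hp1 : p - 1 ≠ 0 := by linarith
          simp only [← ENNReal.rpow_mul, Real.conjExponent]
          rw [mul_div_cancel₀ _ hp1]
          refine ENNReal.mul_lt_top (ENNReal.rpow_lt_top_of_nonneg ?_ hGp.ne)
            (ENNReal.rpow_lt_top_of_nonneg (by positivity) hgw.ne)
          have : 0 < p - 1 := by linarith
          positivity
  have hnull := tendsto_lintegral_rpow_mul (μ := μ) hp (g := fun x ↦ ‖G x‖ₑ)
    (a := fun j x ↦ ‖‖grad n (r j) x - G x‖‖ₑ) (by simpa using hGn.enorm)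
    (fun j ↦ (h2.1 j).enorm) hGp h2.2
  -- By Hölder's inequality, with |G|^{p-1} in the conjugate exponent, |G|^{p-2}⟨G, ∇r_j⟩ tends to
  -- |G|^p in L¹.
  have hLA : Tendsto (fun j ↦ ∫⁻ x, ‖‖G x‖ ^ (p - 2) * inner ℝ (G x) (grad n (r j) x) -
      ‖G x‖ ^ p‖ₑ ∂μ) atTop (𝓝 0) := by
    refine tendsto_of_tendsto_of_tendsto_of_le_of_le tendsto_const_nhds hnull
      (fun _ ↦ zero_le) (fun j ↦ lintegral_mono fun x ↦ ?_)
    rw [← norm_rpow_mul_inner_self hp (G x), ← mul_sub, ← inner_sub_right,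
      Real.enorm_eq_ofReal_abs, enorm_norm, ← ofReal_norm, ← ofReal_norm,
      ENNReal.ofReal_rpow_of_nonneg (norm_nonneg _) (by linarith),
      ← ENNReal.ofReal_mul (by positivity)]
    exact ENNReal.ofReal_le_ofReal (norm_rpow_mul_inner_le p _ _)
  have hAj : ∀ j, AEStronglyMeasurable
      (fun x ↦ ‖G x‖ ^ (p - 2) * inner ℝ (G x) (grad n (r j) x)) μ := fun j ↦
    ((hGn.pow_const _).mul
      (aemeasurable_inner_grad_of_tendsto hU hr h4 (hr j))).aestronglyMeasurable
  have hwm : AEStronglyMeasurable w μ := hw.continuous.aestronglyMeasurable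
  have T1 := tendsto_integral_mul_of_L1 (μ := μ) (C := |W| * C) (b := fun x ↦ w x * F' (ρ x))
    (bj := fun j x ↦ w x * F' (r j x)) hA hAj
    (fun j ↦ hwm.mul (hF'.comp_aestronglyMeasurable (hrm j).aestronglyMeasurable))
    (fun j ↦ Eventually.of_forall fun x ↦ by
      rw [abs_mul]
      exact mul_le_mul (hW' x) (hC _) (abs_nonneg _) (abs_nonneg _))
    (by
      filter_upwards [h3] with x hx
      exact ((hF'.tendsto _).comp hx).const_mul _) hLA
  have T2 := tendsto_integral_mul_of_L1 (μ := μ) (C := B) (b := fun x ↦ F (ρ x))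
    (bj := fun j x ↦ F (r j x))
    (aj := fun _ x ↦ ‖G x‖ ^ (p - 2) * inner ℝ (G x) (grad n w x)) hBi (fun _ ↦ hBi.1)
    (fun j ↦ hFc.comp_aestronglyMeasurable (hrm j).aestronglyMeasurable)
    (fun j ↦ Eventually.of_forall fun x ↦ hB _)
    (by
      filter_upwards [h3] with x hx
      exact (hFc.tendsto _).comp hx) (by simp)
  refine ⟨hA, hρm, T2.1, T1.1, ?_⟩
  rw [integral_add T2.1 T1.1]
  refine ge_of_tendsto (T2.2.add T1.2) ?_
  have hAev : ∀ᶠ j in atTop, Integrable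
      (fun x ↦ ‖G x‖ ^ (p - 2) * inner ℝ (G x) (grad n (r j) x)) μ := by
    filter_upwards [hLA.eventually (gt_mem_nhds (show (0 : ℝ≥0∞) < ⊤ by simp))] with j hj
    have h5 : Integrable (fun x ↦ ‖G x‖ ^ (p - 2) * inner ℝ (G x) (grad n (r j) x) -
      ‖G x‖ ^ p) μ := ⟨(hAj j).sub hA.1, hj⟩
    exact (h5.add hA).congr (Eventually.of_forall fun x ↦ by simp)
  filter_upwards [hAev] with j hj
  -- Since w F(ρ) is not C¹, the approximants r_j replace ρ. They may take negative values, which is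
  -- why F is required to be C¹, bounded and nonnegative on the whole line. The weight |G|^{p-2} G
  -- stays fixed, so only linear terms pass to the limit.
  set φ : M → ℝ := w * (F ∘ r j) with hφ
  have hFr : ContMDiffOn (𝓡 n) 𝓘(ℝ, ℝ) 1 (F ∘ r j) U := hF1.contMDiff.comp_contMDiffOn (hr j)
  have hts : tsupport φ ⊆ tsupport w := tsupport_mul_subset_left
  have hφtest : IsTest n 1 Ω φ :=
    ⟨contMDiff_mul_of_tsupport hU hw hwU hFr, hK.of_isClosed_subset (isClosed_tsupport _) hts,
      hts.trans (hwU.trans hUΩ)⟩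
  have h6 := hsuper φ hφtest fun x ↦ mul_nonneg (hw0 x) (hF0 _)
  have h7 : ∀ x ∈ U, ‖G x‖ ^ (p - 2) * inner ℝ (G x) (grad n φ x) =
      F (r j x) * (‖G x‖ ^ (p - 2) * inner ℝ (G x) (grad n w x)) +
      w x * F' (r j x) * (‖G x‖ ^ (p - 2) * inner ℝ (G x) (grad n (r j) x)) := fun x hx ↦ by
    have hrd := ((hr j).contMDiffAt (hU.mem_nhds hx)).mdifferentiableAt (by simp)
    rw [inner_grad_mul (hw.mdifferentiableAt (by simp))
      ((hFr.contMDiffAt (hU.mem_nhds hx)).mdifferentiableAt (by simp)),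
      inner_grad_comp hrd (hF _)]
    simp only [Function.comp]
    ring
  have h8 : ∫ x in Ω, ‖G x‖ ^ (p - 2) * inner ℝ (G x) (grad n φ x) ∂(riemVol n M) =
      ∫ x in U, ‖G x‖ ^ (p - 2) * inner ℝ (G x) (grad n φ x) ∂(riemVol n M) := by
    refine setIntegral_eq_of_subset_of_forall_sdiff_eq_zero hΩ.measurableSet hUΩ fun x hx ↦ ?_
    rw [grad_eq_zero_of_notMem_tsupport fun h ↦ hx.2 (hwU (hts h))]
    simp
  rw [h8, setIntegral_congr_fun hUm h7] at h6
  rw [← integral_add]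
  · exact h6
  · exact hBi.bdd_mul (hFc.comp_aestronglyMeasurable (hrm j).aestronglyMeasurable)
      (Eventually.of_forall fun x ↦ hB _)
  · refine hj.bdd_mul (c := |W| * C)
      (hwm.mul (hF'.comp_aestronglyMeasurable (hrm j).aestronglyMeasurable))
      (Eventually.of_forall fun x ↦ ?_)
    rw [norm_mul]
    exact mul_le_mul (hW' x) (hC _) (abs_nonneg _) (abs_nonneg _)

end TestInequality

/-! ### The one-variable Riccati inequality. -/

section RealAnalysis

/-- A bounded nonincreasing `C¹` function on `[0, ∞)` extends to a bounded nonnegative `C¹` function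
on the line with bounded derivative. -/
lemma exists_C1_extension {f f' : ℝ → ℝ} (hf : ∀ t, 0 ≤ t → HasDerivAt f (f' t) t)
    (hf' : ContinuousOn f' (Ici 0)) {B C : ℝ} (hf0 : ∀ t, 0 ≤ t → 0 ≤ f t)
    (hB : ∀ t, 0 ≤ t → f t ≤ B) (hf'0 : ∀ t, 0 ≤ t → f' t ≤ 0) (hC : ∀ t, 0 ≤ t → -f' t ≤ C) :
    ∃ F F' : ℝ → ℝ, (∀ t, HasDerivAt F (F' t) t) ∧ Continuous F' ∧ (∀ t, 0 ≤ F t) ∧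
      (∃ B', ∀ t, |F t| ≤ B') ∧ (∃ C', ∀ t, |F' t| ≤ C') ∧ (∀ t, 0 ≤ t → F t = f t) ∧
      ∀ t, 0 ≤ t → F' t = f' t := by
  have hm0 : ∀ t : ℝ, 0 ≤ max t 0 := fun t ↦ le_max_right _ _
  have hpos : ∀ t : ℝ, 0 ≤ f' 0 * Real.arctan (min t 0) := fun t ↦
    mul_nonneg_of_nonpos_of_nonpos (hf'0 0 le_rfl) (by
      have := Real.arctan_mono (min_le_right t 0)
      rwa [Real.arctan_zero] at this)
  have hC0 : 0 ≤ C := (neg_nonneg.2 (hf'0 0 le_rfl)).trans (hC 0 le_rfl)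
  -- To the left of 0 the extension is f(0) + f'(0) arctan t, which matches value and slope at 0, is
  -- bounded, and stays nonnegative because f'(0) ≤ 0 and arctan t ≤ 0.
  refine ⟨fun t ↦ f (max t 0) + f' 0 * Real.arctan (min t 0),
    fun t ↦ f' (max t 0) / (1 + (min t 0) ^ 2), fun t ↦ ?_, ?_, fun t ↦ ?_, ⟨B + C * (Real.pi / 2),
    fun t ↦ ?_⟩, ⟨C, fun t ↦ ?_⟩, fun t ht ↦ ?_, fun t ht ↦ ?_⟩
  · have hleft : ∀ t ≤ 0, HasDerivAt (fun t ↦ f 0 + f' 0 * Real.arctan t)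
        (f' (max t 0) / (1 + (min t 0) ^ 2)) t := fun t ht ↦ by
      have := ((Real.hasDerivAt_arctan t).const_mul (f' 0)).const_add (f 0)
      rw [max_eq_right ht, min_eq_left ht]
      exact this.congr_deriv (by ring)
    have hright : ∀ t, 0 ≤ t → HasDerivAt f (f' (max t 0) / (1 + (min t 0) ^ 2)) t :=
      fun t ht ↦ by
        rw [max_eq_left ht, min_eq_right ht]
        exact (hf t ht).congr_deriv (by simp)
    rcases lt_trichotomy t 0 with ht | rfl | ht
    · refine (hleft t ht.le).congr_of_eventuallyEq ?_
      filter_upwards [gt_mem_nhds ht] with s hs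
      rw [max_eq_right hs.le, min_eq_left hs.le]
    · have h1 : HasDerivWithinAt (fun t ↦ f (max t 0) + f' 0 * Real.arctan (min t 0))
          (f' (max 0 0) / (1 + (min 0 0) ^ 2)) (Iic 0) 0 :=
        (hleft 0 le_rfl).hasDerivWithinAt.congr (fun s hs ↦ by
          rw [max_eq_right hs, min_eq_left hs]) (by simp)
      have h2 : HasDerivWithinAt (fun t ↦ f (max t 0) + f' 0 * Real.arctan (min t 0))
          (f' (max 0 0) / (1 + (min 0 0) ^ 2)) (Ici 0) 0 :=
        (hright 0 le_rfl).hasDerivWithinAt.congr (fun s hs ↦ by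
          rw [max_eq_left hs, min_eq_right hs]
          simp) (by simp)
      have h3 := h1.union h2
      rwa [Iic_union_Ici, hasDerivWithinAt_univ] at h3
    · refine (hright t ht.le).congr_of_eventuallyEq ?_
      filter_upwards [lt_mem_nhds ht] with s hs
      rw [max_eq_left hs.le, min_eq_right hs.le]
      simp
  · refine Continuous.div (hf'.comp_continuous (by fun_prop) hm0) (by fun_prop) fun t ↦ ?_
    positivity
  · exact add_nonneg (hf0 _ (hm0 t)) (hpos t)
  · rw [abs_of_nonneg (add_nonneg (hf0 _ (hm0 t)) (hpos t))]
    refine add_le_add (hB _ (hm0 t)) ?_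
    calc f' 0 * Real.arctan (min t 0) = -f' 0 * -Real.arctan (min t 0) := by ring
      _ ≤ C * (Real.pi / 2) := by
          refine mul_le_mul (hC 0 le_rfl) ?_ ?_ hC0
          · linarith [Real.neg_pi_div_two_lt_arctan (min t 0)]
          · have := Real.arctan_mono (min_le_right t 0)
            rw [Real.arctan_zero] at this
            linarith
  · rw [abs_div, abs_of_nonpos (hf'0 _ (hm0 t)), abs_of_pos (by positivity)]
    refine (div_le_self (neg_nonneg.2 (hf'0 _ (hm0 t))) ?_).trans (hC _ (hm0 t))
    nlinarith [sq_nonneg (min t 0)]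
  · simp [ht]
  · simp [ht]

/-- The weight of the improved Hardy inequality. -/
noncomputable def improvedWeight (p ε s : ℝ) : ℝ :=
  ((p - 1) / p) ^ p - p * ((p - 1) / p) ^ (p - 1) * ε ^ 2 +
    ε * ((p - 1) / p) ^ (p - 1) * (s / (1 + s) ^ 2)

/-- The function generating the improved Hardy inequality. -/
noncomputable def riccatiFun (p ε s : ℝ) : ℝ :=
  ((p - 1) / p) ^ (p - 1) * s ^ (1 - p) * (1 + ε / (1 + s))

/-- The derivative of `riccatiFun`. -/
noncomputable def riccatiDeriv (p ε s : ℝ) : ℝ :=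
  -(((p - 1) / p) ^ (p - 1) * ((p - 1) * s ^ (-p) * (1 + ε / (1 + s)) +
    s ^ (1 - p) * (ε / (1 + s) ^ 2)))

lemma hasDerivAt_riccatiFun (p ε : ℝ) {s : ℝ} (hs : 0 < s) :
    HasDerivAt (riccatiFun p ε) (riccatiDeriv p ε s) s := by
  have h1 : HasDerivAt (fun s : ℝ ↦ s ^ (1 - p)) ((1 - p) * s ^ (1 - p - 1)) s :=
    Real.hasDerivAt_rpow_const (Or.inl hs.ne')
  have h2 : HasDerivAt (fun s : ℝ ↦ 1 + ε / (1 + s)) (-(ε / (1 + s) ^ 2)) s := by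
    have h3 : HasDerivAt (fun s : ℝ ↦ 1 + s) 1 s := (hasDerivAt_id s).const_add 1
    have h4 := ((h3.inv (by positivity)).const_mul ε).const_add 1
    simp only [div_eq_mul_inv] at h4 ⊢
    exact h4.congr_deriv (by ring)
  have h5 := (h1.const_mul (((p - 1) / p) ^ (p - 1))).mul h2
  refine h5.congr_deriv ?_
  rw [show 1 - p - 1 = -p by ring, riccatiDeriv]
  ring

/-- From 1 + x ≤ e^x and the second order bound for the exponential on [0, 1]. The explicit
quadratic error is what makes the loss in the improved weight of order ε². -/
lemma one_add_rpow_le {q x : ℝ} (hq : 0 < q) (hx : 0 ≤ x) (hqx : q * x ≤ 1) :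
    (1 + x) ^ q ≤ 1 + q * x + (q * x) ^ 2 := by
  have h0 : 0 ≤ q * x := by positivity
  calc (1 + x) ^ q ≤ (Real.exp x) ^ q := by
        refine Real.rpow_le_rpow (by linarith) ?_ hq.le
        linarith [Real.add_one_le_exp x]
    _ = Real.exp (q * x) := by rw [← Real.exp_mul, mul_comm]
    _ ≤ _ := by
        have := (abs_le.1 (Real.abs_exp_sub_one_sub_id_le (by rwa [abs_of_nonneg h0]))).2
        linarith

/-- The Riccati inequality behind the improved Hardy inequality. -/
lemma improvedWeight_le {p ε s : ℝ} (hp : 1 < p) (hε : 0 ≤ ε) (hε1 : p / (p - 1) * ε ≤ 1)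
    (hs : 0 < s) :
    s ^ (-p) * improvedWeight p ε s ≤
      -riccatiDeriv p ε s - (p - 1) * riccatiFun p ε s ^ (p / (p - 1)) := by
  have hp1 : 0 < p - 1 := by linarith
  have hp0 : 0 < p := by linarith
  set a := (p - 1) / p with ha
  have ha0 : 0 < a := by positivity
  set q := p / (p - 1) with hq
  have hq0 : 0 < q := by positivity
  have haq : a * q = 1 := by
    rw [ha, hq]
    field_simp
  set x := ε / (1 + s) with hx
  have hx0 : 0 ≤ x := by positivity
  have hxε : x ≤ ε := div_le_self hε (by linarith)
  have hqx : q * x ≤ 1 := (mul_le_mul_of_nonneg_left hxε hq0.le).trans hε1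
  have hsp : 0 < s ^ (-p) := Real.rpow_pos_of_pos hs _
  have e1 : riccatiFun p ε s ^ q = a ^ p * s ^ (-p) * (1 + x) ^ q := by
    rw [riccatiFun, Real.mul_rpow (by positivity) (by positivity),
      Real.mul_rpow (by positivity) (by positivity), ← Real.rpow_mul ha0.le, ← Real.rpow_mul hs.le]
    congr 2
    · congr 1
      rw [hq]
      field_simp
    · congr 1
      rw [hq]
      field_simp
      ring
  have e2 : s ^ (1 - p) = s ^ (-p) * s := by
    nth_rewrite 3 [← Real.rpow_one s]
    rw [← Real.rpow_add hs]
    congr 1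
    ring
  have e3 : a ^ p = a ^ (p - 1) * a := by
    nth_rewrite 3 [← Real.rpow_one a]
    rw [← Real.rpow_add ha0]
    congr 1
    ring
  have hl : 0 < a ^ (p - 1) := by positivity
  have h1 := one_add_rpow_le hq0 hx0 hqx
  have h2 : (p - 1) * (a ^ p * (1 + x) ^ q) ≤
      (p - 1) * (a ^ p * (1 + q * x + (q * x) ^ 2)) := by gcongr
  -- Because a q = 1, the linear term here is (p-1) a^{p-1} x, which cancels exactly the linear term
  -- of -F'. Only the quadratic loss, at most p a^{p-1} ε², remains against the gain from
  -- differentiating ε/(1+s).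
  have h3 : (p - 1) * (a ^ p * (1 + q * x + (q * x) ^ 2)) =
      (p - 1) * a ^ (p - 1) * (a + x + q * x ^ 2) := by
    rw [e3]
    linear_combination (p - 1) * a ^ (p - 1) * (x + q * x ^ 2) * haq
  have hpq : (p - 1) * q = p := by
    rw [hq]
    field_simp
  have hpa : (p - 1) * (1 - a) = a := by
    rw [ha]
    field_simp
    ring
  have h4 : (p - 1) * a ^ (p - 1) * (q * x ^ 2) ≤ p * a ^ (p - 1) * ε ^ 2 := by
    have : (p - 1) * a ^ (p - 1) * (q * x ^ 2) = p * a ^ (p - 1) * x ^ 2 := by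
      linear_combination a ^ (p - 1) * x ^ 2 * hpq
    rw [this]
    gcongr
  have h5 : s * (ε / (1 + s) ^ 2) = ε * (s / (1 + s) ^ 2) := by ring
  have key : improvedWeight p ε s ≤ a ^ (p - 1) * ((p - 1) * (1 + x) + s * (ε / (1 + s) ^ 2)) -
      (p - 1) * (a ^ p * (1 + x) ^ q) := by
    rw [improvedWeight, ← ha, h5]
    -- The zeroth order terms: (p-1)(1-a) = a, whence the sharp constant a^p.
    have h6 : a ^ p = (p - 1) * a ^ (p - 1) * (1 - a) := by
      rw [e3]
      linear_combination -(a ^ (p - 1)) * hpa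
    nlinarith
  calc s ^ (-p) * improvedWeight p ε s ≤ s ^ (-p) * _ := mul_le_mul_of_nonneg_left key hsp.le
    _ = _ := by
      rw [e1, riccatiDeriv, e2]
      ring

end RealAnalysis

lemma exists_isOpen_closure_subset (n : ℕ) {M : Type*} [EMetricSpace M]
    [ChartedSpace (EuclideanSpace ℝ (Fin n)) M] {K Ω : Set M} (hK : IsCompact K)
    (hΩ : IsOpen Ω) (hKΩ : K ⊆ Ω) : ∃ U, IsOpen U ∧ K ⊆ U ∧ closure U ⊆ Ω ∧ IsCompact (closure U) := by
  have : LocallyCompactSpace M := ChartedSpace.locallyCompactSpace (Euc n) M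
  exact exists_open_between_and_isCompact_closure hK hΩ hKΩ

/-! ### The weighted Hardy inequality for test functions. -/

section HardyTest

variable {n : ℕ} {M : Type*} [EMetricSpace M] [ChartedSpace (EuclideanSpace ℝ (Fin n)) M]
  [IsManifold (𝓡 n) ∞ M]
  [RiemannianBundle (fun x : M ↦ TangentSpace (𝓡 n) x)]
  [IsContMDiffRiemannianBundle (𝓡 n) ∞ (EuclideanSpace ℝ (Fin n))
      (fun x : M ↦ TangentSpace (𝓡 n) x)]
  [MeasurableSpace M] [BorelSpace M]

/-- Young's inequality in the form used for the Hardy inequality. -/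
lemma young_mul_le {p a b : ℝ} (hp : 1 < p) (ha : 0 ≤ a) (hb : 0 ≤ b) :
    p * (b * a) ≤ a ^ p + (p - 1) * b ^ (p / (p - 1)) := by
  have h := Real.young_inequality_of_nonneg ha hb (Real.HolderConjugate.conjExponent hp)
  have hp1 : 0 < p - 1 := by linarith
  have hp0 : 0 < p := by linarith
  have h1 := mul_le_mul_of_nonneg_left h hp0.le
  rw [mul_add, mul_div_cancel₀ _ hp0.ne'] at h1
  have h2 : p * (b ^ p.conjExponent / p.conjExponent) = (p - 1) * b ^ (p / (p - 1)) := by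
    rw [Real.conjExponent]
    field_simp
  rw [h2] at h1
  linarith

/-- Second countability allows passing to a countable subcover. -/
lemma aemeasurable_of_locally {X : Type*} [TopologicalSpace X] [SecondCountableTopology X]
    [MeasurableSpace X] {μ : Measure X} {Ω : Set X}
    {f : X → ℝ} (h : ∀ x ∈ Ω, ∃ U, IsOpen U ∧ x ∈ U ∧ AEMeasurable f (μ.restrict U)) :
    AEMeasurable f (μ.restrict Ω) := by
  choose! U hU hxU hf using h
  obtain ⟨t, htΩ, htc, ht⟩ := TopologicalSpace.countable_cover_nhdsWithin
    (f := U) (s := Ω) fun x hx ↦ mem_nhdsWithin_of_mem_nhds ((hU x hx).mem_nhds (hxU x hx))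
  have : Countable t := htc
  have h1 : AEMeasurable f (μ.restrict (⋃ x : t, U x)) :=
    aemeasurable_iUnion_iff.2 fun x ↦ hf x (htΩ x.2)
  refine h1.mono_set ?_
  rwa [biUnion_eq_iUnion] at ht

lemma HasGradWLoc.aemeasurable [SecondCountableTopology M] {p : ℝ} (hp : 1 < p) {Ω : Set M}
    (hΩ : IsOpen Ω) {ρ : M → ℝ} {G : ∀ x : M, TangentSpace (𝓡 n) x}
    (h : HasGradWLoc n p Ω ρ G) :
    AEMeasurable ρ ((riemVol n M).restrict Ω) ∧
      AEMeasurable (fun x ↦ ‖G x‖) ((riemVol n M).restrict Ω) := by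
  have key : ∀ x ∈ Ω, ∃ U, IsOpen U ∧ x ∈ U ∧ AEMeasurable ρ ((riemVol n M).restrict U) ∧
      AEMeasurable (fun x ↦ ‖G x‖) ((riemVol n M).restrict U) := fun x hx ↦ by
    obtain ⟨U, hU, hxU, hUΩ, hUc⟩ := exists_isOpen_closure_subset n isCompact_singleton hΩ
      (singleton_subset_iff.2 hx)
    obtain ⟨φ, hφ, h1, h2, h3, h4⟩ := (h U hU hUc hUΩ).hasGradApprox hp
    exact ⟨U, hU, hxU rfl, aemeasurable_of_tendsto_metrizable_ae atTop
      (fun j ↦ (hφ j).continuousOn.aemeasurable hU.measurableSet) h3,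
      aemeasurable_norm_of_tendsto hU hφ h4⟩
  constructor
  · refine aemeasurable_of_locally fun x hx ↦ ?_
    obtain ⟨U, hU, hxU, h1, h2⟩ := key x hx
    exact ⟨U, hU, hxU, h1⟩
  · refine aemeasurable_of_locally fun x hx ↦ ?_
    obtain ⟨U, hU, hxU, h1, h2⟩ := key x hx
    exact ⟨U, hU, hxU, h2⟩

/-- A weighted Hardy inequality for test functions. -/
lemma hardy_test {p : ℝ} (hp : 1 < p) {Ω : Set M} (hΩ : IsOpen Ω) {ρ : M → ℝ}
    {G : ∀ x : M, TangentSpace (𝓡 n) x} (hρG : HasGradWLoc n p Ω ρ G)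
    (hρ : ∀ᵐ x ∂((riemVol n M).restrict Ω), 0 ≤ ρ x) (hsuper : IsPSuperharmonic n p Ω G)
    {F F' : ℝ → ℝ} (hF : ∀ t, HasDerivAt F (F' t) t) (hF' : Continuous F') {B C : ℝ}
    (hF0 : ∀ t, 0 ≤ F t) (hB : ∀ t, |F t| ≤ B) (hC : ∀ t, |F' t| ≤ C) {b : ℝ → ℝ}
    (hb0 : ∀ t, 0 ≤ t → 0 ≤ b t) (hb : ∀ t, 0 ≤ t → b t ≤ -F' t - (p - 1) * F t ^ (p / (p - 1)))
    {k : ℕ∞} (hk : 1 ≤ k) {u : M → ℝ} (hu : IsTest n k Ω u) :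
    ∫⁻ x in Ω, ENNReal.ofReal (|u x| ^ p * ‖G x‖ ^ p * b (ρ x)) ∂(riemVol n M) ≤
      energy n p Ω (grad n u) := by
  have hp0 : 0 < p := by linarith
  obtain ⟨hus, huc, huΩ⟩ := hu
  have hu1 : ContMDiff (𝓡 n) 𝓘(ℝ, ℝ) 1 u := hus.of_le (by exact_mod_cast hk)
  obtain ⟨U, hU, hKU, hUΩ, hUc⟩ := exists_isOpen_closure_subset n huc hΩ huΩ
  have hUΩ' : U ⊆ Ω := subset_closure.trans hUΩ
  have hW := hρG U hU hUc hUΩ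
  -- The weight |u|^p is C¹ because p > 1, and this is the regularity allowed for test functions of
  -- the superharmonicity condition.
  set w : M → ℝ := fun x ↦ |u x| ^ p with hw
  have hwF : w = (fun t : ℝ ↦ |t| ^ p) ∘ u := rfl
  have hwts : tsupport w ⊆ tsupport u := by
    refine closure_mono fun x hx ↦ ?_
    simp only [Function.mem_support, hw] at hx ⊢
    rintro h0
    exact hx (by rw [h0, abs_zero, Real.zero_rpow hp0.ne'])
  have hw1 : ContMDiff (𝓡 n) 𝓘(ℝ, ℝ) 1 w := by
    have : ContDiff ℝ 1 (fun t : ℝ ↦ |t| ^ p) := by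
      simpa only [Real.norm_eq_abs] using contDiff_norm_rpow (E := ℝ) hp
    exact this.contMDiff.comp hu1
  have hwc : HasCompactSupport w := IsCompact.of_isClosed_subset huc (isClosed_tsupport _) hwts
  obtain ⟨-, -, I1, I2, I3⟩ := hsuper.integral_nonneg hp hΩ hU hUΩ' (hW.hasGradApprox hp)
    (hW.setLIntegral_lt_top hp) hF hF' hF0 hB hC hw1 (fun x ↦ by positivity) hwc (hwts.trans hKU)
  set μ := (riemVol n M).restrict U with hμ
  have hE : Integrable (fun x ↦ ‖grad n u x‖ ^ p) μ := by
    have h1 : AEMeasurable (fun x ↦ ‖grad n u x‖) μ :=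
      (continuousOn_norm_grad hU hu1.contMDiffOn).aemeasurable hU.measurableSet
    refine ⟨(h1.pow_const p).aestronglyMeasurable, ?_⟩
    refine lt_of_le_of_lt (lintegral_mono fun x ↦ ?_)
      (IsTest.setLIntegral_lt_top hp hk ⟨hus, huc, huΩ⟩ U)
    rw [Real.enorm_of_nonneg (by positivity), ← ofReal_norm,
      ENNReal.ofReal_rpow_of_nonneg (norm_nonneg _) hp0.le]
  have hρU : ∀ᵐ x ∂μ, 0 ≤ ρ x := ae_restrict_of_ae_restrict_of_subset hUΩ' hρ
  have hpt : ∀ᵐ x ∂μ, |u x| ^ p * ‖G x‖ ^ p * b (ρ x) ≤ ‖grad n u x‖ ^ p -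
      (F (ρ x) * (‖G x‖ ^ (p - 2) * inner ℝ (G x) (grad n w x)) +
        w x * F' (ρ x) * ‖G x‖ ^ p) := by
    filter_upwards [hρU] with x hx
    have h1 : inner ℝ (G x) (grad n w x) =
        p * |u x| ^ (p - 2) * u x * inner ℝ (G x) (grad n u x) := by
      rw [hwF, inner_grad_comp (hu1.mdifferentiableAt (by simp)) (hasDerivAt_abs_rpow (u x) hp)]
    have habs : |(|u x| ^ (p - 2) * u x)| = |u x| ^ (p - 1) := by
      rcases eq_or_ne (u x) 0 with h0 | h0
      · simp [h0, Real.zero_rpow (show p - 1 ≠ 0 by linarith)]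
      · rw [abs_mul, abs_of_nonneg (by positivity)]
        nth_rewrite 2 [← Real.rpow_one |u x|]
        rw [← Real.rpow_add (abs_pos.2 h0)]
        congr 1
        ring
    -- The product y |∇u| bounds the cross term up to the factor p. Young's inequality with
    -- exponents p and p/(p-1) gives |∇u|^p and (p-1) y^{p/(p-1)} = (p-1) F^{p/(p-1)} |u|^p |G|^p.
    set y := F (ρ x) * |u x| ^ (p - 1) * ‖G x‖ ^ (p - 1) with hy
    have hy0 : 0 ≤ y := mul_nonneg (mul_nonneg (hF0 _) (by positivity)) (by positivity)
    have h2 : F (ρ x) * (‖G x‖ ^ (p - 2) * inner ℝ (G x) (grad n w x)) ≤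
        p * (y * ‖grad n u x‖) := by
      have h3 : F (ρ x) * (‖G x‖ ^ (p - 2) * inner ℝ (G x) (grad n w x)) =
          p * (F (ρ x) * ((|u x| ^ (p - 2) * u x) *
            (‖G x‖ ^ (p - 2) * inner ℝ (G x) (grad n u x)))) := by
        rw [h1]
        ring
      rw [h3, hy]
      refine mul_le_mul_of_nonneg_left ?_ hp0.le
      calc F (ρ x) * ((|u x| ^ (p - 2) * u x) *
            (‖G x‖ ^ (p - 2) * inner ℝ (G x) (grad n u x)))
          ≤ F (ρ x) * (|u x| ^ (p - 1) * (‖G x‖ ^ (p - 1) * ‖grad n u x‖)) := by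
            refine mul_le_mul_of_nonneg_left ((le_abs_self _).trans ?_) (hF0 _)
            rw [abs_mul, habs]
            exact mul_le_mul_of_nonneg_left (norm_rpow_mul_inner_le p _ _) (by positivity)
        _ = _ := by ring
    have hp1 : 0 < p - 1 := by linarith
    have h4 : y ^ (p / (p - 1)) = F (ρ x) ^ (p / (p - 1)) * |u x| ^ p * ‖G x‖ ^ p := by
      rw [hy, Real.mul_rpow (mul_nonneg (hF0 _) (by positivity)) (by positivity),
        Real.mul_rpow (hF0 _) (by positivity), ← Real.rpow_mul (abs_nonneg _),
        ← Real.rpow_mul (norm_nonneg _), mul_div_cancel₀ _ hp1.ne']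
    have h5 := young_mul_le hp (norm_nonneg (grad n u x)) hy0
    rw [h4] at h5
    have h6 : |u x| ^ p * ‖G x‖ ^ p * b (ρ x) ≤ |u x| ^ p * ‖G x‖ ^ p *
        (-F' (ρ x) - (p - 1) * F (ρ x) ^ (p / (p - 1))) :=
      mul_le_mul_of_nonneg_left (hb _ hx) (by positivity)
    simp only [hw] at h2 ⊢
    linarith
  have hnn : ∀ᵐ x ∂μ, 0 ≤ ‖grad n u x‖ ^ p := Eventually.of_forall fun x ↦ by positivity
  have hIint : Integrable (fun x ↦ F (ρ x) * (‖G x‖ ^ (p - 2) * inner ℝ (G x) (grad n w x)) +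
      w x * F' (ρ x) * ‖G x‖ ^ p) μ := I1.add I2
  have hsub : Integrable (fun x ↦ ‖grad n u x‖ ^ p -
      (F (ρ x) * (‖G x‖ ^ (p - 2) * inner ℝ (G x) (grad n w x)) +
        w x * F' (ρ x) * ‖G x‖ ^ p)) μ := hE.sub hIint
  calc ∫⁻ x in Ω, ENNReal.ofReal (|u x| ^ p * ‖G x‖ ^ p * b (ρ x)) ∂(riemVol n M)
      ≤ ∫⁻ x in U, ENNReal.ofReal (|u x| ^ p * ‖G x‖ ^ p * b (ρ x)) ∂(riemVol n M) := by
        rw [← lintegral_indicator hU.measurableSet]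
        refine (lintegral_mono fun x ↦ ?_).trans (setLIntegral_le_lintegral Ω _)
        by_cases hx : x ∈ U
        · rw [indicator_of_mem hx]
        · rw [image_eq_zero_of_notMem_tsupport fun h ↦ hx (hKU h)]
          simp [Real.zero_rpow hp0.ne']
    _ ≤ ∫⁻ x, ENNReal.ofReal (‖grad n u x‖ ^ p -
          (F (ρ x) * (‖G x‖ ^ (p - 2) * inner ℝ (G x) (grad n w x)) +
            w x * F' (ρ x) * ‖G x‖ ^ p)) ∂μ := by
        refine lintegral_mono_ae ?_
        filter_upwards [hpt] with x hx using ENNReal.ofReal_le_ofReal hx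
    _ ≤ ENNReal.ofReal (∫ x, (‖grad n u x‖ ^ p) ∂μ) := by
        -- Nonnegativity of b enters here: it makes the difference nonnegative, so its lower
        -- integral is the Bochner integral.
        have hI : ∀ᵐ x ∂μ, 0 ≤ ‖grad n u x‖ ^ p -
            (F (ρ x) * (‖G x‖ ^ (p - 2) * inner ℝ (G x) (grad n w x)) +
              w x * F' (ρ x) * ‖G x‖ ^ p) := by
          filter_upwards [hpt, hρU] with x hx hx0
          exact (mul_nonneg (by positivity) (hb0 _ hx0)).trans hx
        rw [← ofReal_integral_eq_lintegral_ofReal hsub hI]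
        refine ENNReal.ofReal_le_ofReal ?_
        rw [integral_sub hE hIint]
        linarith
    _ = ∫⁻ x in U, ‖grad n u x‖ₑ ^ p ∂(riemVol n M) := by
        rw [ofReal_integral_eq_lintegral_ofReal hE hnn]
        refine lintegral_congr fun x ↦ ?_
        rw [← ofReal_norm, ENNReal.ofReal_rpow_of_nonneg (norm_nonneg _) hp0.le]
    _ ≤ _ := lintegral_mono_set hUΩ'

end HardyTest

/-! ### Regularization of the singular weight. -/

section RealWeight

lemma improvedWeight_zero (p s : ℝ) : improvedWeight p 0 s = ((p - 1) / p) ^ p := by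
  simp [improvedWeight]

/-- The second smallness condition on ε says that the quadratic loss does not exceed a^p.
Nonnegativity keeps `ENNReal.ofReal` from truncating the weight. -/
lemma improvedWeight_nonneg {p ε s : ℝ} (hp : 1 < p) (hε : 0 ≤ ε)
    (hε2 : p * ((p - 1) / p) ^ (p - 1) * ε ^ 2 ≤ ((p - 1) / p) ^ p) (hs : 0 ≤ s) :
    0 ≤ improvedWeight p ε s := by
  have ha : 0 ≤ (p - 1) / p := div_nonneg (by linarith) (by linarith)
  have : 0 ≤ ε * ((p - 1) / p) ^ (p - 1) * (s / (1 + s) ^ 2) := by positivity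
  rw [improvedWeight]
  linarith

lemma continuousOn_improvedWeight (p ε : ℝ) : ContinuousOn (improvedWeight p ε) (Ici 0) := by
  refine ContinuousOn.add continuousOn_const (continuousOn_const.mul
    (continuousOn_id.div (by fun_prop) fun s hs ↦ ?_))
  have : (0 : ℝ) ≤ s := hs
  positivity

lemma measurable_improvedWeight (p ε : ℝ) : Measurable (improvedWeight p ε) := by
  unfold improvedWeight
  fun_prop

/-- A regularization of the function generating the improved Hardy inequality. -/
lemma exists_regularized_riccatiFun {p ε δ : ℝ} (hp : 1 < p) (hε : 0 ≤ ε)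
    (hε1 : p / (p - 1) * ε ≤ 1) (hδ : 0 < δ) :
    ∃ F F' : ℝ → ℝ, (∀ t, HasDerivAt F (F' t) t) ∧ Continuous F' ∧ (∀ t, 0 ≤ F t) ∧
      (∃ B, ∀ t, |F t| ≤ B) ∧ (∃ C, ∀ t, |F' t| ≤ C) ∧
      ∀ t, 0 ≤ t → (t + δ) ^ (-p) * improvedWeight p ε (t + δ) ≤
        -F' t - (p - 1) * F t ^ (p / (p - 1)) := by
  have ha : 0 ≤ (p - 1) / p := div_nonneg (by linarith) (by linarith)
  have hp1 : 0 ≤ p - 1 := by linarith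
  have hr : ∀ t, 0 ≤ t → ∀ r : ℝ, r ≤ 0 → (t + δ) ^ r ≤ δ ^ r := fun t ht r hr ↦
    Real.rpow_le_rpow_of_nonpos hδ (by linarith) hr
  have hd1 : ∀ t, 0 ≤ t → ε / (1 + (t + δ)) ≤ ε := fun t ht ↦ div_le_self hε (by linarith)
  have hd2 : ∀ t, 0 ≤ t → ε / (1 + (t + δ)) ^ 2 ≤ ε := fun t ht ↦
    div_le_self hε (by nlinarith)
  have hrd : ∀ t, 0 ≤ t → 0 ≤ -riccatiDeriv p ε (t + δ) := fun t ht ↦ by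
    rw [riccatiDeriv, neg_neg]
    positivity
  -- The shift t ↦ t + δ removes the singularity at 0: on [0, ∞) all negative powers are bounded by
  -- their values at δ.
  obtain ⟨F, F', h1, h2, h3, h4, h5, h6, h7⟩ := exists_C1_extension
    (f := fun t ↦ riccatiFun p ε (t + δ)) (f' := fun t ↦ riccatiDeriv p ε (t + δ))
    (B := ((p - 1) / p) ^ (p - 1) * δ ^ (1 - p) * (1 + ε))
    (C := ((p - 1) / p) ^ (p - 1) * ((p - 1) * δ ^ (-p) * (1 + ε) + δ ^ (1 - p) * ε))
    (fun t ht ↦ (hasDerivAt_riccatiFun p ε (by linarith)).comp_add_const t δ)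
    (by
      have hne : ∀ t ∈ Ici (0 : ℝ), t + δ ≠ 0 := fun t ht ↦ by
        have : (0 : ℝ) ≤ t := ht
        positivity
      have hne' : ∀ t ∈ Ici (0 : ℝ), 1 + (t + δ) ≠ 0 := fun t ht ↦ by
        have : (0 : ℝ) ≤ t := ht
        positivity
      have c1 : ContinuousOn (fun t : ℝ ↦ t + δ) (Ici 0) := by fun_prop
      have c2 : ∀ r : ℝ, ContinuousOn (fun t : ℝ ↦ (t + δ) ^ r) (Ici 0) := fun r ↦
        c1.rpow_const fun t ht ↦ Or.inl (hne t ht)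
      have c3 : ContinuousOn (fun t : ℝ ↦ ε / (1 + (t + δ))) (Ici 0) :=
        continuousOn_const.div (by fun_prop) hne'
      have c4 : ContinuousOn (fun t : ℝ ↦ ε / (1 + (t + δ)) ^ 2) (Ici 0) :=
        continuousOn_const.div (by fun_prop) fun t ht ↦ pow_ne_zero 2 (hne' t ht)
      exact (continuousOn_const.mul (((continuousOn_const.mul (c2 _)).mul
        (continuousOn_const.add c3)).add ((c2 _).mul c4))).neg)
    (fun t ht ↦ by
      rw [riccatiFun]
      positivity)
    (fun t ht ↦ by
      have e1 := hr t ht (1 - p) (by linarith)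
      have e2 := hd1 t ht
      rw [riccatiFun]
      gcongr)
    (fun t ht ↦ neg_nonneg.1 (hrd t ht))
    (fun t ht ↦ by
      have e1 := hr t ht (1 - p) (by linarith)
      have e2 := hd1 t ht
      have e3 := hr t ht (-p) (by linarith)
      have e4 := hd2 t ht
      rw [riccatiDeriv, neg_neg]
      gcongr)
  refine ⟨F, F', h1, h2, h3, h4, h5, fun t ht ↦ ?_⟩
  rw [h6 t ht, h7 t ht]
  exact improvedWeight_le hp hε hε1 (by linarith)

end RealWeight

/-- A form of Fatou's lemma. -/
lemma lintegral_le_of_tendsto_ae {X : Type*} [MeasurableSpace X] {μ : Measure X}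
    {f : ℕ → X → ℝ≥0∞} {g : X → ℝ≥0∞} {c : ℕ → ℝ≥0∞} {C : ℝ≥0∞}
    (hf : ∀ k, AEMeasurable (f k) μ)
    (h : ∀ᵐ x ∂μ, g x = 0 ∨ Tendsto (fun k ↦ f k x) atTop (𝓝 (g x)))
    (hc : ∀ k, ∫⁻ x, f k x ∂μ ≤ c k) (hC : Tendsto c atTop (𝓝 C)) : ∫⁻ x, g x ∂μ ≤ C := by
  calc ∫⁻ x, g x ∂μ ≤ ∫⁻ x, liminf (fun k ↦ f k x) atTop ∂μ := by
        refine lintegral_mono_ae ?_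
        filter_upwards [h] with x hx
        rcases hx with hx | hx
        · rw [hx]
          exact zero_le
        · rw [hx.liminf_eq]
    _ ≤ liminf (fun k ↦ ∫⁻ x, f k x ∂μ) atTop := lintegral_liminf_le' hf
    _ ≤ liminf c atTop := liminf_le_liminf (Eventually.of_forall hc)
    _ = C := hC.liminf_eq

/-! ### The improved Hardy inequality on D^{1,p}(Ω). -/

section Hardy

variable {n : ℕ} {M : Type*} [EMetricSpace M] [SecondCountableTopology M]
  [ChartedSpace (EuclideanSpace ℝ (Fin n)) M]
  [IsManifold (𝓡 n) ∞ M]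
  [RiemannianBundle (fun x : M ↦ TangentSpace (𝓡 n) x)]
  [IsContMDiffRiemannianBundle (𝓡 n) ∞ (EuclideanSpace ℝ (Fin n))
      (fun x : M ↦ TangentSpace (𝓡 n) x)]
  [MeasurableSpace M] [BorelSpace M]

/-- The improved Hardy inequality for test functions. -/
lemma improved_hardy_test {p : ℝ} (hp : 1 < p) {Ω : Set M} (hΩ : IsOpen Ω) {ρ : M → ℝ}
    {G : ∀ x : M, TangentSpace (𝓡 n) x} (hρG : HasGradWLoc n p Ω ρ G)
    (hρ : ∀ᵐ x ∂((riemVol n M).restrict Ω), 0 ≤ ρ x) (hsuper : IsPSuperharmonic n p Ω G)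
    {ε : ℝ} (hε : 0 ≤ ε) (hε1 : p / (p - 1) * ε ≤ 1)
    (hε2 : p * ((p - 1) / p) ^ (p - 1) * ε ^ 2 ≤ ((p - 1) / p) ^ p)
    {u : M → ℝ} (hu : IsTest n ⊤ Ω u) :
    ∫⁻ x in Ω, ENNReal.ofReal (|u x| ^ p / ρ x ^ p * ‖G x‖ ^ p * improvedWeight p ε (ρ x))
      ∂(riemVol n M) ≤ energy n p Ω (grad n u) := by
  have hp0 : 0 < p := by linarith
  set δ : ℕ → ℝ := fun k ↦ 1 / ((k : ℝ) + 1) with hδ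
  have hδ0 : ∀ k, 0 < δ k := fun k ↦ by positivity
  have hδlim : Tendsto δ atTop (𝓝 0) := tendsto_one_div_add_atTop_nhds_zero_nat
  obtain ⟨hρm, hGm⟩ := hρG.aemeasurable hp hΩ
  have hum : AEMeasurable u ((riemVol n M).restrict Ω) := hu.1.continuous.aemeasurable
  refine lintegral_le_of_tendsto_ae (f := fun k x ↦ ENNReal.ofReal (|u x| ^ p * ‖G x‖ ^ p *
    ((ρ x + δ k) ^ (-p) * improvedWeight p ε (ρ x + δ k)))) (fun k ↦ ?_) ?_ (fun k ↦ ?_)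
    tendsto_const_nhds
  · refine AEMeasurable.ennreal_ofReal ?_
    have h1 : AEMeasurable (fun x ↦ |u x|) ((riemVol n M).restrict Ω) := hum.abs
    have h2 := hρm.add_const (δ k)
    exact ((h1.pow_const p).mul (hGm.pow_const p)).mul ((h2.pow_const (-p)).mul
      ((measurable_improvedWeight p ε).comp_aemeasurable h2))
  -- Where ρ = 0 the regularized integrands may blow up, but the limiting integrand is 0 there since
  -- division by zero gives 0; this is the first alternative in the Fatou lemma. Elsewhere the
  -- convergence as δ tends to 0 is pointwise.
  · filter_upwards [hρ] with x hx
    rcases hx.eq_or_lt with h0 | h0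
    · left
      rw [← h0]
      simp [Real.zero_rpow hp0.ne']
    · right
      have h1 : Tendsto (fun k ↦ ρ x + δ k) atTop (𝓝 (ρ x)) := by
        simpa using hδlim.const_add (ρ x)
      have h2 : ContinuousAt (improvedWeight p ε) (ρ x) :=
        (continuousOn_improvedWeight p ε).continuousAt (Ici_mem_nhds h0)
      have h3 : Tendsto (fun k ↦ (ρ x + δ k) ^ (-p)) atTop (𝓝 (ρ x ^ (-p))) :=
        h1.rpow_const (Or.inl h0.ne')
      have h4 := (h3.mul (h2.tendsto.comp h1)).const_mul (|u x| ^ p * ‖G x‖ ^ p)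
      have h5 : |u x| ^ p / ρ x ^ p * ‖G x‖ ^ p * improvedWeight p ε (ρ x) =
          |u x| ^ p * ‖G x‖ ^ p * (ρ x ^ (-p) * improvedWeight p ε (ρ x)) := by
        rw [Real.rpow_neg hx]
        ring
      rw [h5]
      exact (ENNReal.continuous_ofReal.tendsto _).comp h4
  · obtain ⟨F, F', h1, h2, h3, ⟨B, h4⟩, ⟨C, h5⟩, h6⟩ :=
      exists_regularized_riccatiFun hp hε hε1 (hδ0 k)
    exact hardy_test hp hΩ hρG hρ hsuper h1 h2 h3 h4 h5
      (b := fun t ↦ (t + δ k) ^ (-p) * improvedWeight p ε (t + δ k))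
      (fun t ht ↦ mul_nonneg (Real.rpow_nonneg (add_nonneg ht (hδ0 k).le) _)
        (improvedWeight_nonneg hp hε hε2 (add_nonneg ht (hδ0 k).le))) h6 le_top hu

lemma HasGradD.aemeasurable_norm {p : ℝ} (hp : 1 < p) {Ω : Set M} (hΩ : IsOpen Ω) {u : M → ℝ}
    {H : ∀ x : M, TangentSpace (𝓡 n) x} (h : HasGradD n p Ω u H) :
    AEMeasurable (fun x ↦ ‖H x‖) ((riemVol n M).restrict Ω) := by
  obtain ⟨φ, hφ, -, h2⟩ := h
  obtain ⟨ns, -, hae⟩ := exists_subseq_tendsto_ae hp h2.1 h2.2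
  exact aemeasurable_norm_of_tendsto hΩ
    (fun j ↦ ((hφ (ns j)).1.of_le (by simp)).contMDiffOn) hae

lemma HasGradD.aemeasurable {p : ℝ} (hp : 1 < p) {Ω : Set M} (hΩ : IsOpen Ω) {u : M → ℝ}
    {H : ∀ x : M, TangentSpace (𝓡 n) x} (h : HasGradD n p Ω u H) :
    AEMeasurable u ((riemVol n M).restrict Ω) := by
  refine aemeasurable_of_locally fun x hx ↦ ?_
  obtain ⟨U, hU, hxU, hUΩ, hUc⟩ := exists_isOpen_closure_subset n isCompact_singleton hΩ
    (singleton_subset_iff.2 hx)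
  obtain ⟨φ, hφ, h1, h2, h3, h4⟩ := h.hasGradApprox hp hUc hUΩ
  exact ⟨U, hU, hxU rfl, aemeasurable_of_tendsto_metrizable_ae atTop
    (fun j ↦ (hφ j).continuousOn.aemeasurable hU.measurableSet) h3⟩

lemma HasGradD.energy_lt_top {p : ℝ} (hp : 1 < p) {Ω : Set M} {u : M → ℝ}
    {H : ∀ x : M, TangentSpace (𝓡 n) x} (h : HasGradD n p Ω u H) : energy n p Ω H < ⊤ := by
  obtain ⟨φ, hφ, -, h2⟩ := h
  exact h2.setLIntegral_lt_top hp fun j ↦ (hφ j).setLIntegral_lt_top hp le_top Ω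

/-- An open subset of `M` is the union of an increasing sequence of compact sets. -/
lemma exists_monotone_isCompact_iUnion_eq (n : ℕ) {M : Type*} [EMetricSpace M]
    [SecondCountableTopology M] [ChartedSpace (EuclideanSpace ℝ (Fin n)) M] {Ω : Set M}
    (hΩ : IsOpen Ω) : ∃ K : ℕ → Set M, Monotone K ∧ (∀ m, IsCompact (K m)) ∧ ⋃ m, K m = Ω := by
  have : LocallyCompactSpace M := ChartedSpace.locallyCompactSpace (Euc n) M
  obtain ⟨F, hF, hFΩ, hFU, hmono⟩ := hΩ.exists_iUnion_isClosed
  refine ⟨fun m ↦ F m ∩ compactCovering M m,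
    fun i j hij ↦ inter_subset_inter (hmono hij) (compactCovering_subset M hij),
    fun m ↦ (isCompact_compactCovering M m).inter_left (hF m), ?_⟩
  refine Subset.antisymm (iUnion_subset fun m ↦ inter_subset_left.trans (hFΩ m)) fun x hx ↦ ?_
  rw [← hFU] at hx
  obtain ⟨i, hi⟩ := mem_iUnion.1 hx
  obtain ⟨j, hj⟩ := mem_iUnion.1 ((iUnion_compactCovering M).ge (mem_univ x))
  exact mem_iUnion.2 ⟨max i j, hmono (le_max_left i j) hi,
    compactCovering_subset M (le_max_right i j) hj⟩

/-- A weighted inequality for test functions extends to `D^{1,p}(Ω)`. -/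
lemma HasGradD.lintegral_le_of_test {p : ℝ} (hp : 1 < p) {Ω : Set M} (hΩ : IsOpen Ω)
    {η : M → ℝ≥0∞} (hη : AEMeasurable η ((riemVol n M).restrict Ω)) (hη' : ∀ x, η x ≠ ⊤)
    (htest : ∀ φ : M → ℝ, IsTest n ⊤ Ω φ →
      ∫⁻ x in Ω, ENNReal.ofReal (|φ x| ^ p) * η x ∂(riemVol n M) ≤ energy n p Ω (grad n φ))
    {u : M → ℝ} {H : ∀ x : M, TangentSpace (𝓡 n) x} (h : HasGradD n p Ω u H) :
    ∫⁻ x in Ω, ENNReal.ofReal (|u x| ^ p) * η x ∂(riemVol n M) ≤ energy n p Ω H := by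
  have hp0 : 0 < p := by linarith
  have hHm := h.aemeasurable_norm hp hΩ
  obtain ⟨φ, hφ, h1, h2⟩ := h
  -- The Minkowski bound for the energy of φ_j, which tends to the energy of u.
  set c : ℕ → ℝ≥0∞ := fun j ↦ ((∫⁻ x in Ω, ‖‖grad n (φ j) x - H x‖‖ₑ ^ p ∂(riemVol n M)) ^ (1 / p) +
    energy n p Ω H ^ (1 / p)) ^ p with hc
  have hclim : Tendsto c atTop (𝓝 (energy n p Ω H)) := by
    have h3 := (ENNReal.continuous_rpow_const (y := 1 / p)).tendsto 0 |>.comp h2.2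
    rw [ENNReal.zero_rpow_of_pos (by positivity)] at h3
    have h4 := (ENNReal.continuous_rpow_const (y := p)).tendsto _ |>.comp
      (h3.add_const (energy n p Ω H ^ (1 / p)))
    rw [zero_add, ← ENNReal.rpow_mul, one_div_mul_cancel hp0.ne', ENNReal.rpow_one] at h4
    exact h4
  have hE : ∀ j, energy n p Ω (grad n (φ j)) ≤ c j := fun j ↦ by
    have hm : AEMeasurable (fun x ↦ ‖‖H x‖‖ₑ) ((riemVol n M).restrict Ω) := hHm.enorm
    have h5 := ENNReal.lintegral_Lp_add_le (h2.1 j).enorm hm hp.le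
    have h6 : energy n p Ω (grad n (φ j)) ≤ ∫⁻ x in Ω,
        ((fun x ↦ ‖‖grad n (φ j) x - H x‖‖ₑ) + fun x ↦ ‖‖H x‖‖ₑ) x ^ p ∂(riemVol n M) := by
      refine lintegral_mono fun x ↦ ?_
      simp only [Pi.add_apply, enorm_norm]
      refine ENNReal.rpow_le_rpow ?_ hp0.le
      have := enorm_add_le (grad n (φ j) x - H x) (H x)
      rwa [sub_add_cancel] at this
    refine h6.trans ?_
    have h7 := ENNReal.rpow_le_rpow h5 hp0.le
    rw [← ENNReal.rpow_mul, one_div_mul_cancel hp0.ne', ENNReal.rpow_one] at h7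
    simpa only [hc, energy, enorm_norm] using h7
  obtain ⟨K, hKm, hKc, hKΩ⟩ := exists_monotone_isCompact_iUnion_eq n hΩ
  have hKsub : ∀ m, K m ⊆ Ω := fun m ↦ hKΩ ▸ subset_iUnion K m
  -- Convergence of φ_j to u is given on compact sets only, so Fatou's lemma is applied on each K_m
  -- along its own subsequence; the bound is independent of m, and monotone exhaustion finishes.
  have hlocal : ∀ m, ∫⁻ x in K m, ENNReal.ofReal (|u x| ^ p) * η x ∂(riemVol n M) ≤
      energy n p Ω H := fun m ↦ by
    have hnull := h1 (K m) (hKc m) (hKsub m)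
    obtain ⟨ns, hns, hae⟩ := exists_subseq_tendsto_ae hp hnull.1 hnull.2
    refine lintegral_le_of_tendsto_ae
      (f := fun j x ↦ ENNReal.ofReal (|φ (ns j) x| ^ p) * η x) (fun j ↦ ?_) ?_ (fun j ↦ ?_)
      (hclim.comp hns.tendsto_atTop)
    · have h8 : AEMeasurable (fun x ↦ |φ (ns j) x|) ((riemVol n M).restrict (K m)) :=
        (hφ (ns j)).1.continuous.abs.aemeasurable
      exact (h8.pow_const p).ennreal_ofReal.mul (hη.mono_set (hKsub m))
    · filter_upwards [hae] with x hx
      right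
      have h9 : Tendsto (fun j ↦ φ (ns j) x) atTop (𝓝 (u x)) := by
        simpa using hx.add_const (u x)
      exact ENNReal.Tendsto.mul_const ((ENNReal.continuous_ofReal.tendsto _).comp
        (h9.abs.rpow_const (Or.inr hp0.le))) (Or.inr (hη' x))
    · exact (lintegral_mono_set (hKsub m)).trans ((htest _ (hφ (ns j))).trans (hE (ns j)))
  rw [← hKΩ, setLIntegral_iUnion_of_directed _ hKm.directed_le, hKΩ]
  exact iSup_le hlocal

/-- The improved Hardy inequality. -/
lemma HasGradD.improved_hardy {p : ℝ} (hp : 1 < p) {Ω : Set M} (hΩ : IsOpen Ω) {ρ : M → ℝ}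
    {G : ∀ x : M, TangentSpace (𝓡 n) x} (hρG : HasGradWLoc n p Ω ρ G)
    (hρ : ∀ᵐ x ∂((riemVol n M).restrict Ω), 0 ≤ ρ x) (hsuper : IsPSuperharmonic n p Ω G)
    {ε : ℝ} (hε : 0 ≤ ε) (hε1 : p / (p - 1) * ε ≤ 1)
    (hε2 : p * ((p - 1) / p) ^ (p - 1) * ε ^ 2 ≤ ((p - 1) / p) ^ p)
    {u : M → ℝ} {H : ∀ x : M, TangentSpace (𝓡 n) x} (hu : HasGradD n p Ω u H) :
    ∫⁻ x in Ω, ENNReal.ofReal (|u x| ^ p / ρ x ^ p * ‖G x‖ ^ p * improvedWeight p ε (ρ x))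
      ∂(riemVol n M) ≤ energy n p Ω H := by
  have key : ∀ v : M → ℝ, ∀ x, ENNReal.ofReal (|v x| ^ p / ρ x ^ p * ‖G x‖ ^ p *
      improvedWeight p ε (ρ x)) = ENNReal.ofReal (|v x| ^ p) *
        ENNReal.ofReal (1 / ρ x ^ p * ‖G x‖ ^ p * improvedWeight p ε (ρ x)) := fun v x ↦ by
    rw [← ENNReal.ofReal_mul (by positivity)]
    congr 1
    ring
  obtain ⟨hρm, hGm⟩ := hρG.aemeasurable hp hΩ
  simp only [key]
  refine hu.lintegral_le_of_test hp hΩ (AEMeasurable.ennreal_ofReal ?_)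
    (fun x ↦ ENNReal.ofReal_ne_top) fun φ hφ ↦ ?_
  · exact ((aemeasurable_const.div (hρm.pow_const p)).mul (hGm.pow_const p)).mul
      ((measurable_improvedWeight p ε).comp_aemeasurable hρm)
  · have := improved_hardy_test hp hΩ hρG hρ hsuper hε hε1 hε2 hφ
    simpa only [key] using this

/-- The Hardy inequality. -/
lemma HasGradD.hardy {p : ℝ} (hp : 1 < p) {Ω : Set M} (hΩ : IsOpen Ω) {ρ : M → ℝ}
    {G : ∀ x : M, TangentSpace (𝓡 n) x} (hρG : HasGradWLoc n p Ω ρ G)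
    (hρ : ∀ᵐ x ∂((riemVol n M).restrict Ω), 0 ≤ ρ x) (hsuper : IsPSuperharmonic n p Ω G)
    {u : M → ℝ} {H : ∀ x : M, TangentSpace (𝓡 n) x} (hu : HasGradD n p Ω u H) :
    ENNReal.ofReal (((p - 1) / p) ^ p) * hardyIntegral n p Ω ρ G u ≤ energy n p Ω H := by
  have ha : 0 ≤ (p - 1) / p := div_nonneg (by linarith) (by linarith)
  refine le_trans (le_of_eq ?_) (hu.improved_hardy hp hΩ hρG hρ hsuper le_rfl (by simp)
    (by simpa using Real.rpow_nonneg ha p))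
  rw [hardyIntegral, ← lintegral_const_mul' _ _ ENNReal.ofReal_ne_top]
  refine lintegral_congr fun x ↦ ?_
  rw [improvedWeight_zero, ← ENNReal.ofReal_mul (by positivity), mul_comm]

end Hardy

/-! ### Strictness, and the energy of the candidate minimizer. -/

section Main

variable {n : ℕ} {M : Type*} [EMetricSpace M] [SecondCountableTopology M]
  [ChartedSpace (EuclideanSpace ℝ (Fin n)) M]
  [IsManifold (𝓡 n) ∞ M]
  [RiemannianBundle (fun x : M ↦ TangentSpace (𝓡 n) x)]
  [IsContMDiffRiemannianBundle (𝓡 n) ∞ (EuclideanSpace ℝ (Fin n))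
      (fun x : M ↦ TangentSpace (𝓡 n) x)]
  [MeasurableSpace M] [BorelSpace M]

/-- Equality in the Hardy inequality does not occur. -/
lemma HasGradD.hardy_ne {p : ℝ} (hp : 1 < p) {Ω : Set M} (hΩ : IsOpen Ω) {ρ : M → ℝ}
    {G : ∀ x : M, TangentSpace (𝓡 n) x} (hρG : HasGradWLoc n p Ω ρ G)
    (hρ : ∀ᵐ x ∂((riemVol n M).restrict Ω), 0 ≤ ρ x) (hsuper : IsPSuperharmonic n p Ω G)
    {u : M → ℝ} {H : ∀ x : M, TangentSpace (𝓡 n) x} (hu : HasGradD n p Ω u H)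
    (hfin : hardyIntegral n p Ω ρ G u ≠ ⊤) (h0 : hardyIntegral n p Ω ρ G u ≠ 0) :
    energy n p Ω H ≠ ENNReal.ofReal (((p - 1) / p) ^ p) * hardyIntegral n p Ω ρ G u := by
  intro heq
  have hp0 : 0 < p := by linarith
  have hp1 : 0 < p - 1 := by linarith
  set μ := (riemVol n M).restrict Ω with hμ
  set a := (p - 1) / p with ha
  have ha0 : 0 < a := by positivity
  obtain ⟨hρm, hGm⟩ := hρG.aemeasurable hp hΩ
  have hum : AEMeasurable (fun x ↦ |u x|) μ := (hu.aemeasurable hp hΩ).abs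
  set h : M → ℝ := fun x ↦ |u x| ^ p / ρ x ^ p * ‖G x‖ ^ p with hh
  set κ : M → ℝ := fun x ↦ ρ x / (1 + ρ x) ^ 2 with hκ
  have hhm : AEMeasurable h μ := ((hum.pow_const p).div (hρm.pow_const p)).mul (hGm.pow_const p)
  have hκm : AEMeasurable κ μ := hρm.div ((hρm.const_add 1).pow_const 2)
  have hh0 : ∀ᵐ x ∂μ, 0 ≤ h x := by
    filter_upwards [hρ] with x hx
    positivity
  have hκ0 : ∀ᵐ x ∂μ, 0 ≤ κ x := by
    filter_upwards [hρ] with x hx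
    positivity
  have hint : Integrable h μ := by
    refine ⟨hhm.aestronglyMeasurable, ?_⟩
    rw [hasFiniteIntegral_iff_ofReal hh0]
    exact hfin.lt_top
  have hintκ : Integrable (fun x ↦ κ x * h x) μ := by
    refine hint.bdd_mul (c := 1) hκm.aestronglyMeasurable ?_
    filter_upwards [hρ] with x hx
    rw [Real.norm_of_nonneg (by positivity)]
    refine div_le_one_of_le₀ (by nlinarith) (by positivity)
  have hhardy : hardyIntegral n p Ω ρ G u = ENNReal.ofReal (∫ x, h x ∂μ) :=
    (ofReal_integral_eq_lintegral_ofReal hint hh0).symm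
  have hI0 : 0 ≤ ∫ x, h x ∂μ := integral_nonneg_of_ae hh0
  -- Under the assumed equality the a^p terms of the improved inequality cancel, leaving ε a^{p-1} ∫
  -- κ h ≤ p a^{p-1} ε² ∫ h; divide by ε a^{p-1}. The cancellation needs ∫ h finite.
  have hsmall : ∀ ε : ℝ, 0 < ε → p / (p - 1) * ε ≤ 1 → p * a ^ (p - 1) * ε ^ 2 ≤ a ^ p →
      ∫ x, κ x * h x ∂μ ≤ p * ε * ∫ x, h x ∂μ := fun ε hε hε1 hε2 ↦ by
    have h1 := hu.improved_hardy hp hΩ hρG hρ hsuper hε.le hε1 hε2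
    have h2 : ∀ x, |u x| ^ p / ρ x ^ p * ‖G x‖ ^ p * improvedWeight p ε (ρ x) =
        (a ^ p - p * a ^ (p - 1) * ε ^ 2) * h x + ε * a ^ (p - 1) * (κ x * h x) := fun x ↦ by
      rw [improvedWeight]
      simp only [hh, hκ]
      ring
    simp only [h2] at h1
    have h3 : Integrable (fun x ↦ (a ^ p - p * a ^ (p - 1) * ε ^ 2) * h x +
        ε * a ^ (p - 1) * (κ x * h x)) μ := (hint.const_mul _).add (hintκ.const_mul _)
    have h4 : ∀ᵐ x ∂μ, 0 ≤ (a ^ p - p * a ^ (p - 1) * ε ^ 2) * h x +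
        ε * a ^ (p - 1) * (κ x * h x) := by
      filter_upwards [hh0, hκ0] with x hx hx'
      have := sub_nonneg.2 hε2
      positivity
    rw [← ofReal_integral_eq_lintegral_ofReal h3 h4, heq, hhardy,
      ← ENNReal.ofReal_mul (by positivity), ENNReal.ofReal_le_ofReal_iff (by positivity),
      integral_add (hint.const_mul _) (hintκ.const_mul _), integral_const_mul,
      integral_const_mul] at h1
    have h5 : ε * a ^ (p - 1) * ∫ x, κ x * h x ∂μ ≤
        ε * a ^ (p - 1) * (p * ε * ∫ x, h x ∂μ) := by linarith
    exact le_of_mul_le_mul_left h5 (by positivity)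
  have hle : ∫ x, κ x * h x ∂μ ≤ 0 := by
    have t1 : Tendsto (fun ε : ℝ ↦ p * ε * ∫ x, h x ∂μ) (𝓝[>] 0) (𝓝 0) := by
      have : Continuous (fun ε : ℝ ↦ p * ε * ∫ x, h x ∂μ) := by fun_prop
      simpa using (this.tendsto 0).mono_left nhdsWithin_le_nhds
    have t2 : ∀ᶠ ε : ℝ in 𝓝[>] 0, p / (p - 1) * ε ≤ 1 := by
      have : Continuous (fun ε : ℝ ↦ p / (p - 1) * ε) := by fun_prop
      have h6 := (this.tendsto 0).mono_left (nhdsWithin_le_nhds (s := Ioi 0))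
      rw [mul_zero] at h6
      filter_upwards [h6.eventually (gt_mem_nhds one_pos)] with ε hε using hε.le
    have t3 : ∀ᶠ ε : ℝ in 𝓝[>] 0, p * a ^ (p - 1) * ε ^ 2 ≤ a ^ p := by
      have : Continuous (fun ε : ℝ ↦ p * a ^ (p - 1) * ε ^ 2) := by fun_prop
      have h6 := (this.tendsto 0).mono_left (nhdsWithin_le_nhds (s := Ioi 0))
      rw [zero_pow two_ne_zero, mul_zero] at h6
      filter_upwards [h6.eventually (gt_mem_nhds (Real.rpow_pos_of_pos ha0 p))] with ε hε
        using hε.le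
    refine ge_of_tendsto t1 ?_
    filter_upwards [t2, t3, self_mem_nhdsWithin] with ε h1 h2 h3 using hsmall ε h3 h1 h2
  have hκh0 : 0 ≤ᵐ[μ] fun x ↦ κ x * h x := by
    filter_upwards [hh0, hκ0] with x hx hx' using mul_nonneg hx' hx
  have hzero := (integral_eq_zero_iff_of_nonneg_ae hκh0 hintκ).1
    (le_antisymm hle (integral_nonneg_of_ae hκh0))
  refine h0 ?_
  rw [hardyIntegral, lintegral_eq_zero_iff' hhm.ennreal_ofReal]
  filter_upwards [hzero, hρ] with x hx hx0
  simp only [Pi.zero_apply, ENNReal.ofReal_eq_zero] at hx ⊢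
  rcases hx0.eq_or_lt with h1 | h1
  · simp [hh, ← h1, Real.zero_rpow hp0.ne']
  -- Since κ > 0 where ρ > 0, the vanishing of κ h gives h = 0 there; where ρ = 0, h is 0 by
  -- convention.
  · have : κ x ≠ 0 := by
      simp only [hκ]
      positivity
    exact ((mul_eq_zero.1 hx).resolve_left this).le

/-- The energy of `ρ ^ ((p - 1) / p)`. -/
lemma HasGradD.energy_rpow_eq {p : ℝ} (hp : 1 < p) {Ω : Set M} (hΩ : IsOpen Ω) {ρ : M → ℝ}
    {G : ∀ x : M, TangentSpace (𝓡 n) x} (hρG : HasGradWLoc n p Ω ρ G)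
    (hρ : ∀ᵐ x ∂((riemVol n M).restrict Ω), 0 ≤ ρ x) {H : ∀ x : M, TangentSpace (𝓡 n) x}
    (h : HasGradD n p Ω (fun x ↦ ρ x ^ ((p - 1) / p)) H) :
    energy n p Ω H = ENNReal.ofReal (((p - 1) / p) ^ p) *
      hardyIntegral n p Ω ρ G (fun x ↦ ρ x ^ ((p - 1) / p)) ∧
    (energy n p Ω H = 0 → ∀ᵐ x ∂((riemVol n M).restrict Ω), G x = 0) := by
  have hp0 : 0 < p := by linarith
  have hp1 : 0 < p - 1 := by linarith
  set a := (p - 1) / p with ha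
  have ha0 : 0 < a := by positivity
  have ha1 : a < 1 := (div_lt_one hp0).2 (by linarith)
  have hae : ∀ᵐ x ∂((riemVol n M).restrict Ω), (ρ x = 0 → G x = 0 ∧ H x = 0) ∧
      (0 < ρ x → ‖H x‖ = a * ρ x ^ (a - 1) * ‖G x‖) := by
    refine ae_restrict_of_locally hΩ fun x hx ↦ ?_
    obtain ⟨U, hU, hxU, hUΩ, hUc⟩ := exists_isOpen_closure_subset n isCompact_singleton hΩ
      (singleton_subset_iff.2 hx)
    exact ⟨U, hU, hxU rfl, ((hρG U hU hUc hUΩ).hasGradApprox hp).norm_rpow hp hU ha0 ha1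
      (h.hasGradApprox hp hUc hUΩ)
      (ae_restrict_of_ae_restrict_of_subset (subset_closure.trans hUΩ) hρ)⟩
  constructor
  · rw [hardyIntegral, ← lintegral_const_mul' _ _ ENNReal.ofReal_ne_top]
    refine lintegral_congr_ae ?_
    filter_upwards [hae, hρ] with x hx hx0
    rw [← ofReal_norm, ENNReal.ofReal_rpow_of_nonneg (norm_nonneg _) hp0.le,
      ← ENNReal.ofReal_mul (by positivity)]
    congr 1
    rcases hx0.eq_or_lt with h0 | h0
    · rw [(hx.1 h0.symm).1, (hx.1 h0.symm).2]
      simp [Real.zero_rpow hp0.ne']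
    -- This makes |∇ρ^a|^p equal to a^p times the Hardy integrand of ρ^a pointwise, without any
    -- integration by parts.
    · have e1 : (ρ x ^ (a - 1)) ^ p = (ρ x ^ a) ^ p / ρ x ^ p := by
        rw [Real.rpow_sub_one h0.ne', Real.div_rpow (by positivity) h0.le]
      rw [hx.2 h0, Real.mul_rpow (by positivity) (norm_nonneg _),
        Real.mul_rpow ha0.le (by positivity), e1, abs_of_nonneg (Real.rpow_nonneg hx0 a), mul_assoc]
  · intro hE
    have hHm : AEMeasurable (fun x ↦ ‖H x‖ₑ ^ p) ((riemVol n M).restrict Ω) := by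
      have := (h.aemeasurable_norm hp hΩ).enorm.pow_const p
      simpa only [enorm_norm] using this
    rw [energy, lintegral_eq_zero_iff' hHm] at hE
    filter_upwards [hE, hae, hρ] with x hx hx1 hx0
    rcases hx0.eq_or_lt with h0 | h0
    · exact (hx1.1 h0.symm).1
    · have hH : ‖H x‖ = 0 := by
        have h2 : ‖H x‖ₑ = 0 := by
          rcases ENNReal.rpow_eq_zero_iff.1 hx with h3 | h3
          · exact h3.1
          · exact absurd h3.2 (by linarith)
        rw [norm_eq_zero]
        exact enorm_eq_zero.1 h2
      have h3 := hx1.2 h0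
      rw [hH] at h3
      have h4 : a * ρ x ^ (a - 1) ≠ 0 := (mul_pos ha0 (Real.rpow_pos_of_pos h0 _)).ne'
      exact norm_eq_zero.1 ((mul_eq_zero.1 h3.symm).resolve_left h4)

end Main

end HardyRiem

/-! ### The theorem on the best constant. -/

open HardyRiem in
theorem mainTheorem8 {n : ℕ} {M : Type*} [EMetricSpace M] [SecondCountableTopology M]
    [ChartedSpace (EuclideanSpace ℝ (Fin n)) M] [IsManifold (𝓡 n) ∞ M]
    [RiemannianBundle (fun x : M ↦ TangentSpace (𝓡 n) x)]
    [IsContMDiffRiemannianBundle (𝓡 n) ∞ (EuclideanSpace ℝ (Fin n))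
      (fun x : M ↦ TangentSpace (𝓡 n) x)]
    [IsRiemannianManifold (𝓡 n) M] [CompleteSpace M]
    [MeasurableSpace M] [BorelSpace M]
    (p : ℝ) (hp : 1 < p) (Ω : Set M) (hΩ : IsOpen Ω)
    (ρ : M → ℝ) (G : ∀ x : M, TangentSpace (𝓡 n) x)
    (hρG : HasGradWLoc n p Ω ρ G)
    (hρ : ∀ᵐ x ∂((riemVol n M).restrict Ω), 0 ≤ ρ x)
    (hsuper : IsPSuperharmonic n p Ω G) :
    ((¬ ∀ᵐ x ∂((riemVol n M).restrict Ω), G x = 0) →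
      MemD n p Ω (fun x ↦ ρ x ^ ((p - 1) / p)) →
        bestConst n p Ω ρ G = ENNReal.ofReal (((p - 1) / p) ^ p) ∧
        IsMinimizer n p Ω ρ G (fun x ↦ ρ x ^ ((p - 1) / p))) ∧
    (¬ MemD n p Ω (fun x ↦ ρ x ^ ((p - 1) / p)) → 2 ≤ p →
      bestConst n p Ω ρ G = ENNReal.ofReal (((p - 1) / p) ^ p) →
        ¬ ∃ u : M → ℝ, IsMinimizer n p Ω ρ G u) := by
  have ha : 0 < (p - 1) / p := div_pos (by linarith) (by linarith)
  have hc0 : ENNReal.ofReal (((p - 1) / p) ^ p) ≠ 0 := by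
    simpa using Real.rpow_pos_of_pos ha p
  refine ⟨fun hG ⟨H, hH⟩ ↦ ?_, fun _ _ hbest ⟨u, H, hu, hE, hmin⟩ ↦ ?_⟩
  · obtain ⟨h1, h2⟩ := hH.energy_rpow_eq hp hΩ hρG hρ
    have hE : energy n p Ω H ≠ 0 := fun h ↦ hG (h2 h)
    have hq : energy n p Ω H / hardyIntegral n p Ω ρ G (fun x ↦ ρ x ^ ((p - 1) / p)) =
        ENNReal.ofReal (((p - 1) / p) ^ p) := by
      have h3 : hardyIntegral n p Ω ρ G (fun x ↦ ρ x ^ ((p - 1) / p)) ≠ 0 := fun h ↦ by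
        rw [h, mul_zero] at h1
        exact hE h1
      -- An infinite Hardy integral would make the energy infinite, whereas every element of
      -- D^{1,p}(Ω) has finite energy; only then may the factor be cancelled.
      have h4 : hardyIntegral n p Ω ρ G (fun x ↦ ρ x ^ ((p - 1) / p)) ≠ ⊤ := fun h ↦ by
        rw [h, ENNReal.mul_top hc0] at h1
        exact (hH.energy_lt_top hp).ne h1
      rw [h1, ENNReal.mul_div_cancel_right h3 h4]
    have hbest : bestConst n p Ω ρ G = ENNReal.ofReal (((p - 1) / p) ^ p) := by
      refine le_antisymm ?_ (le_iInf₂ fun u K ↦ le_iInf₂ fun hu hK ↦ ?_)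
      · exact (iInf₂_le_of_le _ H (iInf₂_le hH hE)).trans_eq hq
      · have h5 := hu.hardy hp hΩ hρG hρ hsuper
        exact (ENNReal.le_div_iff_mul_le (Or.inr hK) (Or.inr (hu.energy_lt_top hp).ne)).2 h5
    exact ⟨hbest, H, hH, hE, hq.trans hbest.symm⟩
  · rw [hbest] at hmin
    -- The level a^p is neither ∞ nor 0, so the quotient of a minimizer has a nonzero and finite
    -- denominator, and clearing it gives the forbidden equality.
    have h0 : hardyIntegral n p Ω ρ G u ≠ 0 := fun h ↦ by
      rw [h, ENNReal.div_zero hE] at hmin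
      exact ENNReal.ofReal_ne_top hmin.symm
    have hfin : hardyIntegral n p Ω ρ G u ≠ ⊤ := fun h ↦ by
      rw [h, ENNReal.div_top] at hmin
      exact hc0 hmin.symm
    refine hu.hardy_ne hp hΩ hρG hρ hsuper hfin h0 ?_
    rw [← hmin, ENNReal.div_mul_cancel h0 hfin]
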